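/- Let $M$ be a spacetime, i.e. a Hausdorff second countable smooth manifold with a time-oriented, globally hyperbolic Lorentzian metric, let $E\to M$ be a smooth real vector bundle of finite rank, $E^!=E^*\otimes D_M$ with $D_M$ the density bundle, and let $\mathcal E=\Gamma^\infty(M;E)$, $\mathcal E^!=\Gamma^\infty(M;E^!)$ carry their Fréchet topologies. Let $P:\mathcal E\to\mathcal E^!$ be a linear differential operator with smooth coefficients which has a retarded and an advanced Green's operator on compactly supported sections (for example any Green hyperbolic operator). Then $P$ restricts to bijections between the sections with past compact support and between those with future compact support; the inverses are denoted by $\Delta^R$ and $\Delta^A$, and $\operatorname{supp}\Delta^{R}h\subset J^{+}(\operatorname{supp}h)$, $\operatorname{supp}\Delta^{A}h\subset J^{-}(\operatorname{supp}h)$. Let $\mathcal X^k$ ($k\ge 0$) be the complex vector space of $k$-vector fields with compact spacetime support, i.e. of Bastiani smooth maps $X$ from $\mathcal E$ to the antisymmetric elements of $\mathcal E'(M^k;E^{\boxtimes k})$, equivalently (Schwartz kernel theorem) to the continuous alternating $k$-linear forms $\mathcal E^!\times\dots\times\mathcal E^!\to\mathbb C$ with the topology of uniform convergence on bounded sets;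 $\mathcal X^0=\mathcal F$ is the space of compactly supported smooth functionals $\mathcal E\to\mathbb C$. Let $\mathrm{Sol}=\ker P$, and let $\mathcal F_S$ be the space of smooth functionals $f:\mathrm{Sol}\to\mathbb C$ that are compactly supported in the sense that for some compact $K\subset M$ the value $f(\varphi)$ depends only on $\varphi|_K$. Put $\delta X(\varphi)=X(\varphi)\{P\varphi,\,\cdot\,\}$ for $X\in\mathcal X^{k+1}$ and $\iota^*F=F|_{\mathrm{Sol}}$ for $F\in\mathcal F$. These are well-defined linear maps $\delta:\mathcal X^{k+1}\to\mathcal X^{k}$ and $\iota^*:\mathcal F\to\mathcal F_S$. There exist smooth functions $\theta:M\to\mathbb R$ such that $\operatorname{supp}\theta$ is past compact and $\operatorname{supp}(1-\theta)$ is future compact. For each such $\theta$ put $$\alpha h=\Delta^A\big((1-\theta)h\big)+\Delta^R(\theta h),\qquad \gamma_\lambda\varphi=\varphi+(\lambda-1)\,\alpha P\varphi .$$ Then $P\alpha h=h$ for $h\in\mathcal E^!$, $\gamma_0$ maps $\mathcal E$ to $\mathrm{Sol}$, $\mathcal H_{-1}f=f\circ\gamma_0$ defines a linear map $\mathcal F_S\to\mathcal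 F$, the pull-back $\gamma_0^*F=F\circ\gamma_0$ equals $\mathcal H_{-1}\iota^*F$, and the formula $$\mathcal H_kY(\varphi)\{h_1,\dots,h_{k+1}\}=\sum_{i=1}^{k+1}(-1)^{i-1}\int_0^1Y^{(1)}(\gamma_\lambda\varphi)\{\alpha h_i;h_1,\dots,\widehat{h_i},\dots,h_{k+1}\}\,\lambda^k\,d\lambda$$ defines linear maps $\mathcal H_k:\mathcal X^k\to\mathcal X^{k+1}$, $k\ge0$, such that $$\mathbb 1=\delta\mathcal H+\mathcal H\delta\ \text{ on }\mathcal X^k,\ k>0,\qquad \mathbb 1=\delta\mathcal H+\gamma_0^*\ \text{ on }\mathcal X^0=\mathcal F,\qquad \iota^*\mathcal H_{-1}=\mathbb 1\ \text{ on }\mathcal F_S .$$ Consequently the sequence $$\cdots\xrightarrow{\ \delta\ }\mathcal X^2\xrightarrow{\ \delta\ }\mathcal X^1\xrightarrow{\ \delta\ }\mathcal F\xrightarrow{\ \iota^*\ }\mathcal F_S\longrightarrow 0$$ is an exact complex, i.e. $(\mathcal X^\bullet,\delta)$ is a resolution of $\mathcal F_S$; in particular the on-shell ideal $\ker\iota^*=\{F\in\mathcal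 F: F|_{\mathrm{Sol}}=0\}$ equals $\delta\mathcal X^1$. -/

import Mathlib

open Set Filter Topology Bundle Manifold
open scoped ContDiff UniformConvergence

set_option linter.unusedSectionVars false

noncomputable section

namespace Koszul

/-! ## The density bundle and the functional dual bundle -/

theorem contDiff_det {A : Type*} [NormedAddCommGroup A] [NormedSpace ℝ A] [FiniteDimensional ℝ A]
    {r : ℕ∞ω} : ContDiff ℝ r (fun f : A →L[ℝ] A => f.det) := by
  classical
  set b := Module.finBasis ℝ A
  have h : ∀ f : A →L[ℝ] A, f.det = ∑ σ : Equiv.Perm (Fin (Module.finrank ℝ A)),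
      ((Equiv.Perm.sign σ : ℤ) : ℝ) * ∏ i, b.equivFunL (f (b i)) (σ i) := by
    intro f
    change LinearMap.det (f : A →ₗ[ℝ] A) = _
    rw [← LinearMap.det_toMatrix b, Matrix.det_apply']
    simp [LinearMap.toMatrix_apply]
  simp_rw [h]
  fun_prop

section Density

variable (n : ℕ) (M : Type*) [TopologicalSpace M] [ChartedSpace (EuclideanSpace ℝ (Fin n)) M]
  [IsManifold (𝓡 n) ∞ M]

theorem tangent_det_comp (i j k : atlas (EuclideanSpace ℝ (Fin n)) M) (x : M)
    (hx : x ∈ i.1.source ∩ j.1.source ∩ k.1.source) :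
    ((tangentBundleCore (𝓡 n) M).coordChange j k x).det *
      ((tangentBundleCore (𝓡 n) M).coordChange i j x).det =
        ((tangentBundleCore (𝓡 n) M).coordChange i k x).det := by
  have hc : ((tangentBundleCore (𝓡 n) M).coordChange j k x).comp
      ((tangentBundleCore (𝓡 n) M).coordChange i j x) =
        (tangentBundleCore (𝓡 n) M).coordChange i k x :=
    ContinuousLinearMap.ext fun w => (tangentBundleCore (𝓡 n) M).coordChange_comp i j k x hx w
  rw [← hc]
  simp only [ContinuousLinearMap.det, ContinuousLinearMap.toLinearMap_comp, LinearMap.det_comp]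

theorem tangent_det_self (i : atlas (EuclideanSpace ℝ (Fin n)) M) (x : M) (hx : x ∈ i.1.source) :
    ((tangentBundleCore (𝓡 n) M).coordChange i i x).det = 1 := by
  have : (tangentBundleCore (𝓡 n) M).coordChange i i x = ContinuousLinearMap.id ℝ _ :=
    ContinuousLinearMap.ext fun w => (tangentBundleCore (𝓡 n) M).coordChange_self i x hx w
  rw [this]
  simp [ContinuousLinearMap.det]

theorem tangent_det_ne_zero (i j : atlas (EuclideanSpace ℝ (Fin n)) M) (x : M)
    (hx : x ∈ i.1.source ∩ j.1.source) :
    ((tangentBundleCore (𝓡 n) M).coordChange i j x).det ≠ 0 := by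
  intro h0
  have h := tangent_det_comp n M i j i x ⟨hx, hx.1⟩
  rw [tangent_det_self n M i x hx.1, h0, mul_zero] at h
  exact zero_ne_one h

/-- The line bundle `D_M` of (1-)densities: if `A` is the derivative of the change of coordinates
from the chart `i` to the chart `j`, then the coefficient of a density changes by `|det A|⁻¹`. -/
def densityCore : VectorBundleCore ℝ M ℝ (atlas (EuclideanSpace ℝ (Fin n)) M) where
  baseSet i := i.1.source
  isOpen_baseSet i := i.1.open_source
  indexAt := achart (EuclideanSpace ℝ (Fin n))
  mem_baseSet_at := mem_chart_source (EuclideanSpace ℝ (Fin n))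
  coordChange i j x :=
    |((tangentBundleCore (𝓡 n) M).coordChange i j x).det|⁻¹ • ContinuousLinearMap.id ℝ ℝ
  coordChange_self i x hx v := by
    rw [tangent_det_self n M i x hx]
    simp
  continuousOn_coordChange i j :=
    ContinuousOn.smul (ContinuousOn.inv₀ (ContinuousLinearMap.continuous_det.comp_continuousOn
      ((tangentBundleCore (𝓡 n) M).continuousOn_coordChange i j)).abs
        fun x hx => abs_ne_zero.2 (tangent_det_ne_zero n M i j x hx)) continuousOn_const
  coordChange_comp i j k x hx v := by
    rw [← tangent_det_comp n M i j k x hx, abs_mul, mul_inv]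
    simp [mul_assoc]

instance densityCore_isContMDiff : (densityCore n M).IsContMDiff (𝓡 n) ∞ where
  contMDiffOn_coordChange i j := by
    have : (tangentBundleCore (𝓡 n) M).IsContMDiff (𝓡 n) ∞ :=
      haveI : IsManifold (𝓡 n) (∞ + 1) M := by simpa
      tangentBundleCore.isContMDiff
    have h := (tangentBundleCore (𝓡 n) M).contMDiffOn_coordChange (𝓡 n) (n := ∞) i j
    intro x hx
    have h1 : ContMDiffWithinAt (𝓡 n) 𝓘(ℝ, ℝ) ∞
        (fun x => ((tangentBundleCore (𝓡 n) M).coordChange i j x).det)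
        (i.1.source ∩ j.1.source) x :=
      (contDiff_det.contMDiff.contMDiffAt).comp_contMDiffWithinAt x (h x hx)
    have h0 := tangent_det_ne_zero n M i j x hx
    have h2 : ContDiffAt ℝ ∞ (fun d : ℝ => |d|⁻¹ • ContinuousLinearMap.id ℝ ℝ)
        ((tangentBundleCore (𝓡 n) M).coordChange i j x).det :=
      ((contDiffAt_abs h0).inv (abs_ne_zero.2 h0)).smul contDiffAt_const
    exact ContMDiffAt.comp_contMDiffWithinAt
      (f := fun x => ((tangentBundleCore (𝓡 n) M).coordChange i j x).det) x h2.contMDiffAt h1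

/-- The fibre of the density bundle. -/
abbrev Density (x : M) : Type := (densityCore n M).Fiber x

instance (x : M) : IsTopologicalAddGroup (Density n M x) :=
  inferInstanceAs (IsTopologicalAddGroup ℝ)

instance (x : M) : ContinuousSMul ℝ (Density n M x) :=
  inferInstanceAs (ContinuousSMul ℝ ℝ)

/-- The fibre of the functional dual bundle `E^! = E^* ⊗ D_M`, i.e. the space of linear maps from
the fibre of `E` to the fibre of the density bundle. As a smooth vector bundle, it is Mathlib's
bundle of continuous linear maps from `E` to the density bundle. -/
abbrev FunctionalDual {V : M → Type*} [∀ x, AddCommGroup (V x)] [∀ x, Module ℝ (V x)]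
    [∀ x, TopologicalSpace (V x)] (x : M) : Type _ := V x →L[ℝ] Density n M x

end Density

/-! ## Smooth sections and their Fréchet topology -/

section Sections

variable (n : ℕ) {M : Type*} [TopologicalSpace M] [ChartedSpace (EuclideanSpace ℝ (Fin n)) M]
  (F : Type*) [NormedAddCommGroup F] [NormedSpace ℝ F]
  (V : M → Type*) [TopologicalSpace (TotalSpace F V)] [∀ x, AddCommGroup (V x)]
  [∀ x, Module ℝ (V x)] [∀ x, TopologicalSpace (V x)] [FiberBundle F V] [VectorBundle ℝ F V]

/-- The space of smooth sections of the vector bundle `V` with typical fibre `F`. -/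
abbrev Sections : Type _ := ContMDiffSection (𝓡 n) F ∞ V

/-- The open subset of `ℝⁿ` over which both the preferred chart and the preferred trivialization
at `x₀` are defined. -/
def localDomain (x₀ : M) : Set (EuclideanSpace ℝ (Fin n)) :=
  (extChartAt (𝓡 n) x₀).target ∩
    (extChartAt (𝓡 n) x₀).symm ⁻¹' (trivializationAt F V x₀).baseSet

theorem isOpen_localDomain (x₀ : M) : IsOpen (localDomain n F V x₀) :=
  (continuousOn_extChartAt_symm x₀).isOpen_inter_preimage (isOpen_extChartAt_target x₀)
    (trivializationAt F V x₀).open_baseSet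

variable {n F V}

/-- A section read in the preferred chart and the preferred trivialization at `x₀`, meaningful on
`localDomain n F V x₀`. -/
def localRep (x₀ : M) (s : Sections n F V) (y : EuclideanSpace ℝ (Fin n)) : F :=
  (trivializationAt F V x₀ ⟨(extChartAt (𝓡 n) x₀).symm y, s ((extChartAt (𝓡 n) x₀).symm y)⟩).2

theorem localRep_add (x₀ : M) (s t : Sections n F V) {y : EuclideanSpace ℝ (Fin n)}
    (hy : y ∈ localDomain n F V x₀) :
    localRep x₀ (s + t) y = localRep x₀ s y + localRep x₀ t y :=
  ((trivializationAt F V x₀).linear ℝ hy.2).map_add _ _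

theorem localRep_smul (x₀ : M) (c : ℝ) (s : Sections n F V) {y : EuclideanSpace ℝ (Fin n)}
    (hy : y ∈ localDomain n F V x₀) : localRep x₀ (c • s) y = c • localRep x₀ s y :=
  ((trivializationAt F V x₀).linear ℝ hy.2).map_smul _ _

section Jets

variable [IsManifold (𝓡 n) ∞ M] [ContMDiffVectorBundle ∞ F V (𝓡 n)]

theorem contDiffOn_localRep (x₀ : M) (s : Sections n F V) :
    ContDiffOn ℝ ∞ (localRep x₀ s) (localDomain n F V x₀) := by
  have h1 : ContMDiffOn (𝓡 n) 𝓘(ℝ, F) ∞ (fun x => (trivializationAt F V x₀ ⟨x, s x⟩).2)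
      (trivializationAt F V x₀).baseSet :=
    (trivializationAt F V x₀).contMDiffOn_section_baseSet_iff.1 s.contMDiff.contMDiffOn
  have h2 : ContMDiffOn 𝓘(ℝ, EuclideanSpace ℝ (Fin n)) (𝓡 n) ∞ (extChartAt (𝓡 n) x₀).symm
      (localDomain n F V x₀) := (contMDiffOn_extChartAt_symm x₀).mono inter_subset_left
  exact (h1.comp h2 fun y hy => hy.2).contDiffOn

theorem contDiffAt_localRep (x₀ : M) (s : Sections n F V) {y : EuclideanSpace ℝ (Fin n)}
    (hy : y ∈ localDomain n F V x₀) : ContDiffAt ℝ ∞ (localRep x₀ s) y :=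
  (contDiffOn_localRep x₀ s).contDiffAt ((isOpen_localDomain n F V x₀).mem_nhds hy)

/-- The `j`-th derivative of a section, read in the preferred chart and trivialization at `x₀`. -/
def jet (x₀ : M) (j : ℕ) : Sections n F V →ₗ[ℝ]
    (localDomain n F V x₀ → ContinuousMultilinearMap ℝ
      (fun _ : Fin j => EuclideanSpace ℝ (Fin n)) F) where
  toFun s y := iteratedFDeriv ℝ j (localRep x₀ s) y
  map_add' s t := by
    funext y
    have h : localRep x₀ (s + t) =ᶠ[𝓝 (y : EuclideanSpace ℝ (Fin n))]
        localRep x₀ s + localRep x₀ t := by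
      filter_upwards [(isOpen_localDomain n F V x₀).mem_nhds y.2] with z hz
      exact localRep_add x₀ s t hz
    rw [(h.iteratedFDeriv ℝ j).self_of_nhds]
    exact iteratedFDeriv_add_apply ((contDiffAt_localRep x₀ s y.2).of_le (mod_cast le_top))
      ((contDiffAt_localRep x₀ t y.2).of_le (mod_cast le_top))
  map_smul' c s := by
    funext y
    have h : localRep x₀ (c • s) =ᶠ[𝓝 (y : EuclideanSpace ℝ (Fin n))]
        c • localRep x₀ s := by
      filter_upwards [(isOpen_localDomain n F V x₀).mem_nhds y.2] with z hz
      exact localRep_smul x₀ c s hz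
    rw [(h.iteratedFDeriv ℝ j).self_of_nhds]
    exact iteratedFDeriv_const_smul_apply
      ((contDiffAt_localRep x₀ s y.2).of_le (mod_cast le_top))

theorem continuous_jet (x₀ : M) (j : ℕ) (s : Sections n F V) : Continuous (jet x₀ j s) := by
  refine continuous_iff_continuousAt.2 fun y => ?_
  have h : ContinuousAt (iteratedFDeriv ℝ j (localRep x₀ s)) (y : EuclideanSpace ℝ (Fin n)) :=
    ((contDiffAt_localRep x₀ s y.2).iteratedFDeriv_right (m := 0) (i := j)
      (mod_cast le_top)).continuousAt
  exact h.comp continuous_subtype_val.continuousAt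

/-- The topology of uniform convergence of all derivatives on compact sets. -/
instance sectionsTopology : TopologicalSpace (Sections n F V) :=
  ⨅ (x₀ : M) (j : ℕ), TopologicalSpace.induced
    (fun s => UniformOnFun.ofFun {K : Set (localDomain n F V x₀) | IsCompact K} (jet x₀ j s))
    inferInstance

instance : IsTopologicalAddGroup (Sections n F V) := by
  refine topologicalAddGroup_iInf fun x₀ => topologicalAddGroup_iInf fun j => ?_
  let φ : Sections n F V →+ (localDomain n F V x₀ →ᵤ[{K | IsCompact K}]
      ContinuousMultilinearMap ℝ (fun _ : Fin j => EuclideanSpace ℝ (Fin n)) F) :=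
    (jet x₀ j).toAddMonoidHom
  exact topologicalAddGroup_induced φ

instance : ContinuousSMul ℝ (Sections n F V) := by
  refine continuousSMul_iInf fun x₀ => continuousSMul_iInf fun j => ?_
  let _ : TopologicalSpace (Sections n F V) := TopologicalSpace.induced
    (fun s => UniformOnFun.ofFun {K : Set (localDomain n F V x₀) | IsCompact K} (jet x₀ j s))
    inferInstance
  refine UniformOnFun.continuousSMul_induced_of_image_bounded ℝ _ _ _ (jet x₀ j) ⟨rfl⟩ ?_
  intro s K hK
  exact (IsCompact.image hK (continuous_jet x₀ j s)).totallyBounded.isVonNBounded ℝ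

end Jets

/-- The support of a section. -/
def sectionSupport (s : Sections n F V) : Set M := closure {x | s x ≠ 0}

variable (n F V) in
/-- The smooth sections with compact support. -/
def compactSections [T2Space M] : Submodule ℝ (Sections n F V) where
  carrier := {s | IsCompact (sectionSupport s)}
  zero_mem' := by simp [sectionSupport]
  add_mem' {s t} hs ht := by
    refine (hs.union ht).of_isClosed_subset isClosed_closure ?_
    simp only [sectionSupport, ← closure_union]
    refine closure_mono fun x hx => ?_
    by_contra h
    simp only [mem_union, mem_ofPred_eq, not_or, not_not] at h
    exact hx (by simp [h.1, h.2])
  smul_mem' c s hs := by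
    refine IsCompact.of_isClosed_subset hs isClosed_closure (closure_mono fun x hx h => hx ?_)
    simp [h]

/-- The product `θ s` of a smooth function and a smooth section. -/
def functionSmul (θ : C^∞⟮𝓡 n, M; ℝ⟯) (s : Sections n F V) : Sections n F V where
  toFun x := θ x • s x
  contMDiff_toFun := θ.contMDiff.smul_section s.contMDiff

end Sections

/-! ## Spacetimes and their causal structure -/

section Causality

variable (n : ℕ) (M : Type*) [TopologicalSpace M] [ChartedSpace (EuclideanSpace ℝ (Fin n)) M]
  [IsManifold (𝓡 n) ∞ M]

/-- A smooth Lorentzian metric (of signature `(-, +, …, +)`) together with a time orientation,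
given by a continuous timelike vector field. -/
structure LorentzianStructure where
  /-- The metric. -/
  metric (x : M) : TangentSpace (𝓡 n) x →L[ℝ] TangentSpace (𝓡 n) x →L[ℝ] ℝ
  symm (x : M) (v w : TangentSpace (𝓡 n) x) : metric x v w = metric x w v
  /-- The metric has one negative direction and is positive definite on its complement. -/
  signature (x : M) : ∃ v : TangentSpace (𝓡 n) x, metric x v v < 0 ∧
    ∀ w : TangentSpace (𝓡 n) x, metric x v w = 0 → w ≠ 0 → 0 < metric x w w
  contMDiff : ContMDiff (𝓡 n)
    ((𝓡 n).prod 𝓘(ℝ, EuclideanSpace ℝ (Fin n) →L[ℝ] EuclideanSpace ℝ (Fin n) →L[ℝ] ℝ)) ∞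
    (fun x => TotalSpace.mk' (EuclideanSpace ℝ (Fin n) →L[ℝ] EuclideanSpace ℝ (Fin n) →L[ℝ] ℝ)
      (E := fun x : M => TangentSpace (𝓡 n) x →L[ℝ] TangentSpace (𝓡 n) x →L[ℝ] ℝ) x (metric x))
  /-- The time orientation. -/
  future (x : M) : TangentSpace (𝓡 n) x
  future_timelike (x : M) : metric x (future x) (future x) < 0
  continuous_future : Continuous (fun x => (⟨x, future x⟩ : TangentBundle (𝓡 n) M))

variable {n M}

namespace LorentzianStructure

variable (g : LorentzianStructure n M)

/-- Future directed causal (i.e. nonzero, timelike or lightlike) tangent vectors. -/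
def IsFutureCausal {x : M} (v : TangentSpace (𝓡 n) x) : Prop :=
  v ≠ 0 ∧ g.metric x v v ≤ 0 ∧ g.metric x (g.future x) v < 0

/-- There is a future directed causal `C^1` curve from `p` to `q`. -/
def CausalCurveFromTo (p q : M) : Prop :=
  ∃ c : ℝ → M, ContMDiffOn 𝓘(ℝ, ℝ) (𝓡 n) 1 c (Icc 0 1) ∧ c 0 = p ∧ c 1 = q ∧
    ∀ t ∈ Icc (0 : ℝ) 1,
      g.IsFutureCausal (mfderivWithin 𝓘(ℝ, ℝ) (𝓡 n) c (Icc 0 1) t (1 : ℝ) :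
        TangentSpace (𝓡 n) (c t))

/-- The causal relation `p ≤ q`: either `p = q` or there is a future directed causal
piecewise `C^1` curve from `p` to `q`. -/
def CausallyPrecedes : M → M → Prop := Relation.ReflTransGen g.CausalCurveFromTo

/-- The causal future `J⁺(A)`. -/
def causalFuture (A : Set M) : Set M := {q | ∃ p ∈ A, g.CausallyPrecedes p q}

/-- The causal past `J⁻(A)`. -/
def causalPast (A : Set M) : Set M := {p | ∃ q ∈ A, g.CausallyPrecedes p q}

/-- Global hyperbolicity: there are no closed causal curves, and all the causal diamonds
`J⁺(p) ∩ J⁻(q)` are compact. -/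
structure GloballyHyperbolic : Prop where
  causal : ∀ p q, g.CausallyPrecedes p q → g.CausallyPrecedes q p → p = q
  isCompact_diamond : ∀ p q, IsCompact (g.causalFuture {p} ∩ g.causalPast {q})

/-- `A` meets the causal past of every compact set in a compact set. -/
def PastCompact (A : Set M) : Prop := ∀ K, IsCompact K → IsCompact (A ∩ g.causalPast K)

/-- `A` meets the causal future of every compact set in a compact set. -/
def FutureCompact (A : Set M) : Prop := ∀ K, IsCompact K → IsCompact (A ∩ g.causalFuture K)

/-- The cutoff functions `θ` (`0` in the far past, `1` in the far future): the support of `θ` is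
past compact and the support of `1 - θ` is future compact. -/
def IsTimeCutoff (θ : C^∞⟮𝓡 n, M; ℝ⟯) : Prop :=
  g.PastCompact (tsupport θ) ∧ g.FutureCompact (tsupport (1 - θ : C^∞⟮𝓡 n, M; ℝ⟯))

end LorentzianStructure

end Causality

/-! ## Linear differential operators and their Green's operators -/

section Green

variable {n : ℕ} {M : Type*} [TopologicalSpace M] [ChartedSpace (EuclideanSpace ℝ (Fin n)) M]
  [IsManifold (𝓡 n) ∞ M]
  {F : Type*} [NormedAddCommGroup F] [NormedSpace ℝ F]
  {V : M → Type*} [TopologicalSpace (TotalSpace F V)] [∀ x, AddCommGroup (V x)]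
  [∀ x, Module ℝ (V x)] [∀ x, TopologicalSpace (V x)] [FiberBundle F V] [VectorBundle ℝ F V]
  {F' : Type*} [NormedAddCommGroup F'] [NormedSpace ℝ F']
  {W : M → Type*} [TopologicalSpace (TotalSpace F' W)] [∀ x, AddCommGroup (W x)]
  [∀ x, Module ℝ (W x)] [∀ x, TopologicalSpace (W x)] [FiberBundle F' W] [VectorBundle ℝ F' W]

/-- `P` is a linear differential operator with smooth coefficients: near every point, in local
coordinates, `(P φ)(y) = ∑_{j ≤ m} a_j(y) (D^j φ(y))` with smooth coefficients `a_j`. -/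
def IsDifferentialOperator (P : Sections n F V →ₗ[ℝ] Sections n F' W) : Prop :=
  ∀ x₀ : M, ∃ (m : ℕ) (U : Set (EuclideanSpace ℝ (Fin n)))
    (a : (j : ℕ) → EuclideanSpace ℝ (Fin n) →
      ContinuousMultilinearMap ℝ (fun _ : Fin j => EuclideanSpace ℝ (Fin n)) F →L[ℝ] F'),
    IsOpen U ∧ extChartAt (𝓡 n) x₀ x₀ ∈ U ∧ U ⊆ localDomain n F V x₀ ∩ localDomain n F' W x₀ ∧
    (∀ j, ContDiffOn ℝ ∞ (a j) U) ∧
    ∀ (φ : Sections n F V), ∀ y ∈ U, localRep x₀ (P φ) y =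
      ∑ j ∈ Finset.range (m + 1), a j y (iteratedFDeriv ℝ j (localRep x₀ φ) y)

variable [T2Space M]

/-- `G` is a two-sided inverse of `P` on compactly supported sections. -/
structure IsGreenOperator (P : Sections n F V →ₗ[ℝ] Sections n F' W)
    (J : Set M → Set M) (G : compactSections n F' W →ₗ[ℝ] Sections n F V) : Prop where
  apply_left (h : compactSections n F' W) : P (G h) = h
  apply_right (φ : compactSections n F V) (h : compactSections n F' W) (hφ : P φ = h) : G h = φ
  support_subset (h : compactSections n F' W) :
    sectionSupport (G h) ⊆ J (sectionSupport (h : Sections n F' W))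

/-- `P` is a linear differential operator that has a retarded Green's operator (whose values are
supported in the causal future of the source) and an advanced one (causal past). -/
structure HasGreenOperators (g : LorentzianStructure n M)
    (P : Sections n F V →ₗ[ℝ] Sections n F' W) : Prop where
  isDifferentialOperator : IsDifferentialOperator P
  exists_retarded : ∃ G, IsGreenOperator P g.causalFuture G
  exists_advanced : ∃ G, IsGreenOperator P g.causalPast G

end Green

/-! ## Bastiani smooth maps -/

section Bastiani

variable {A B : Type*} [AddCommGroup A] [Module ℝ A] [TopologicalSpace A]
  [AddCommGroup B] [Module ℝ B] [TopologicalSpace B]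

/-- `D 0, D 1, …` are the iterated directional derivatives of `f`, all of them exist and they are
jointly continuous. Here `D m φ ![ψ₁, …, ψₘ] = f⁽ᵐ⁾(φ){ψ₁, …, ψₘ}`. -/
structure IsDerivativeSequence (f : A → B) (D : (m : ℕ) → A → (Fin m → A) → B) : Prop where
  zero (φ : A) (ψ : Fin 0 → A) : D 0 φ ψ = f φ
  succ (m : ℕ) (φ : A) (ψ : Fin m → A) (χ : A) :
    Tendsto (fun t : ℝ => t⁻¹ • (D m (φ + t • χ) ψ - D m φ ψ)) (𝓝[≠] 0)
      (𝓝 (D (m + 1) φ (Fin.snoc ψ χ)))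
  continuous (m : ℕ) : Continuous (fun p : A × (Fin m → A) => D m p.1 p.2)

/-- Bastiani smoothness. -/
def BastianiSmooth (f : A → B) : Prop := ∃ D, IsDerivativeSequence f D

/-- The directional derivative `f⁽¹⁾(φ){ψ}`. -/
def dirDeriv (f : A → B) (φ ψ : A) : B :=
  limUnder (𝓝[≠] (0 : ℝ)) (fun t : ℝ => t⁻¹ • (f (φ + t • ψ) - f φ))

theorem BastianiSmooth.tendsto_dirDeriv [T2Space B] {f : A → B} (hf : BastianiSmooth f)
    (φ ψ : A) :
    Tendsto (fun t : ℝ => t⁻¹ • (f (φ + t • ψ) - f φ)) (𝓝[≠] 0) (𝓝 (dirDeriv f φ ψ)) := by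
  obtain ⟨D, hD⟩ := hf
  have h := hD.succ 0 φ Fin.elim0 ψ
  simp only [hD.zero] at h
  exact tendsto_nhds_limUnder ⟨_, h⟩

theorem bastianiSmooth_zero : BastianiSmooth (0 : A → B) :=
  ⟨fun _ _ _ => 0, fun _ _ => rfl, fun _ _ _ _ => by simp [tendsto_const_nhds],
    fun _ => continuous_const⟩

theorem BastianiSmooth.add [ContinuousAdd B] {f f' : A → B} (hf : BastianiSmooth f)
    (hf' : BastianiSmooth f') : BastianiSmooth (f + f') := by
  obtain ⟨D, hD⟩ := hf
  obtain ⟨D', hD'⟩ := hf'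
  refine ⟨fun m φ ψ => D m φ ψ + D' m φ ψ, fun φ ψ => ?_, fun m φ ψ χ => ?_, fun m => ?_⟩
  · simp [hD.zero, hD'.zero]
  · refine ((hD.succ m φ ψ χ).add (hD'.succ m φ ψ χ)).congr fun t => ?_
    rw [← smul_add]
    congr 1
    abel
  · exact (hD.continuous m).add (hD'.continuous m)

theorem BastianiSmooth.const_smul [Module ℂ B] [SMulCommClass ℂ ℝ B] [ContinuousConstSMul ℂ B]
    (c : ℂ) {f : A → B} (hf : BastianiSmooth f) : BastianiSmooth (c • f) := by
  obtain ⟨D, hD⟩ := hf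
  refine ⟨fun m φ ψ => c • D m φ ψ, fun φ ψ => ?_, fun m φ ψ χ => ?_, fun m => ?_⟩
  · simp [hD.zero]
  · refine ((hD.succ m φ ψ χ).const_smul c).congr fun t => ?_
    rw [← smul_sub, ← smul_comm c]
  · exact (hD.continuous m).const_smul c

theorem dirDeriv_zero [T2Space B] (φ ψ : A) : dirDeriv (0 : A → B) φ ψ = 0 :=
  Tendsto.limUnder_eq (by simp)

theorem dirDeriv_add [T2Space B] [ContinuousAdd B] {f f' : A → B} (hf : BastianiSmooth f)
    (hf' : BastianiSmooth f') (φ ψ : A) :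
    dirDeriv (f + f') φ ψ = dirDeriv f φ ψ + dirDeriv f' φ ψ := by
  refine Tendsto.limUnder_eq
    (((hf.tendsto_dirDeriv φ ψ).add (hf'.tendsto_dirDeriv φ ψ)).congr fun t => ?_)
  rw [← smul_add]
  simp only [Pi.add_apply]
  congr 1
  abel

theorem dirDeriv_const_smul [T2Space B] [Module ℂ B] [SMulCommClass ℂ ℝ B]
    [ContinuousConstSMul ℂ B] (c : ℂ) {f : A → B} (hf : BastianiSmooth f) (φ ψ : A) :
    dirDeriv (c • f) φ ψ = c • dirDeriv f φ ψ := by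
  refine Tendsto.limUnder_eq (((hf.tendsto_dirDeriv φ ψ).const_smul c).congr fun t => ?_)
  simp only [Pi.smul_apply]
  rw [← smul_sub, ← smul_comm c]

end Bastiani

/-! ## Functionals, multivector fields and their supports -/

section Multivector

variable {n : ℕ} {M : Type*} [TopologicalSpace M] [ChartedSpace (EuclideanSpace ℝ (Fin n)) M]
  {F : Type*} [NormedAddCommGroup F] [NormedSpace ℝ F]
  {V : M → Type*} [TopologicalSpace (TotalSpace F V)] [∀ x, AddCommGroup (V x)]
  [∀ x, Module ℝ (V x)] [∀ x, TopologicalSpace (V x)] [FiberBundle F V] [VectorBundle ℝ F V]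
  {F' : Type*} [NormedAddCommGroup F'] [NormedSpace ℝ F']
  {W : M → Type*} [TopologicalSpace (TotalSpace F' W)] [∀ x, AddCommGroup (W x)]
  [∀ x, Module ℝ (W x)] [∀ x, TopologicalSpace (W x)] [FiberBundle F' W] [VectorBundle ℝ F' W]

/-- The spacetime support of a functional on configurations. -/
def functionalSupport {B : Type*} (X : Sections n F V → B) : Set M :=
  {x | ∃ U : Set M, IsOpen U ∧ x ∈ U ∧
    ∀ φ φ' : Sections n F V, (∀ y ∉ U, φ y = φ' y) → X φ = X φ'}ᶜ

/-- The support of a vector valued distribution `u` (given as a function on sections). -/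
def distributionSupport {B : Type*} [Zero B] (u : Sections n F V → B) : Set M :=
  {x | ∃ U : Set M, IsOpen U ∧ x ∈ U ∧
    ∀ ψ : Sections n F V, sectionSupport ψ ⊆ U → u ψ = 0}ᶜ

variable [IsManifold (𝓡 n) ∞ M] [ContMDiffVectorBundle ∞ F V (𝓡 n)]
  [ContMDiffVectorBundle ∞ F' W (𝓡 n)]

variable (n F' W) in
/-- Compactly supported antisymmetric distributions in `k` variables, acting on sections of `W`.
By the Schwartz kernel theorem, the antisymmetric elements of the strong dual of the space of
smooth sections of the `k`-fold exterior tensor power of `W` over `M ^ k` are the same thing as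
continuous alternating `k`-linear forms on the sections of `W`, with the topology of uniform
convergence on bounded sets (which is Mathlib's topology on this space). -/
abbrev AltDistribution (k : ℕ) : Type _ := Sections n F' W [⋀^Fin k]→L[ℝ] ℂ

/-- The support in `M ^ k` of a distribution in `k` variables. -/
def AltDistribution.support {k : ℕ} (u : AltDistribution n F' W k) : Set (Fin k → M) :=
  {x | ∃ U : Fin k → Set M, (∀ i, IsOpen (U i) ∧ x i ∈ U i) ∧
    ∀ h : Fin k → Sections n F' W, (∀ i, sectionSupport (h i) ⊆ U i) → u h = 0}ᶜ

/-- The spacetime support of a multivector field. A `0`-vector field is a functional; for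
`k > 0` the supports of the values `X φ` enter, projected to the first variable. -/
def multivectorSupport : {k : ℕ} → (Sections n F V → AltDistribution n F' W k) → Set M
  | 0, X => functionalSupport X
  | _ + 1, X => closure (⋃ φ, distributionSupport (dirDeriv X φ) ∪
      (fun x => x 0) '' (X φ).support)

theorem isClosed_functionalSupport {B : Type*} (X : Sections n F V → B) :
    IsClosed (functionalSupport X) := by
  refine isOpen_compl_iff.1 ?_
  rw [functionalSupport, compl_compl, isOpen_iff_mem_nhds]
  rintro x ⟨U, hU, hx, h⟩
  filter_upwards [hU.mem_nhds hx] with y hy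
  exact ⟨U, hU, hy, h⟩

theorem isClosed_multivectorSupport : {k : ℕ} → (X : Sections n F V → AltDistribution n F' W k) →
    IsClosed (multivectorSupport X)
  | 0, X => isClosed_functionalSupport X
  | _ + 1, _ => isClosed_closure

theorem multivectorSupport_zero : (k : ℕ) →
    multivectorSupport (0 : Sections n F V → AltDistribution n F' W k) = ∅
  | 0 => by
    simp only [multivectorSupport, functionalSupport, compl_empty_iff, eq_univ_iff_forall]
    exact fun x => ⟨univ, isOpen_univ, mem_univ x, fun _ _ _ => rfl⟩
  | k + 1 => by
    simp only [multivectorSupport]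
    rw [closure_empty_iff, iUnion_eq_empty]
    intro φ
    rw [union_empty_iff, image_eq_empty]
    constructor
    · simp only [distributionSupport, compl_empty_iff, eq_univ_iff_forall]
      exact fun x => ⟨univ, isOpen_univ, mem_univ x, fun ψ _ => dirDeriv_zero φ ψ⟩
    · simp only [AltDistribution.support, compl_empty_iff, eq_univ_iff_forall]
      exact fun x => ⟨fun _ => univ, fun i => ⟨isOpen_univ, mem_univ _⟩, fun h _ => rfl⟩

theorem multivectorSupport_add : {k : ℕ} → {X Y : Sections n F V → AltDistribution n F' W k} →
    BastianiSmooth X → BastianiSmooth Y →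
    multivectorSupport (X + Y) ⊆ multivectorSupport X ∪ multivectorSupport Y
  | 0, X, Y, _, _ => by
    intro x hx
    by_contra hxn
    simp only [mem_union, not_or, multivectorSupport, functionalSupport, notMem_compl_iff] at hxn
    obtain ⟨⟨U, hU, hxU, h⟩, ⟨U', hU', hxU', h'⟩⟩ := hxn
    refine hx ⟨U ∩ U', hU.inter hU', ⟨hxU, hxU'⟩, fun φ φ' hφ => ?_⟩
    simp only [Pi.add_apply]
    rw [h φ φ' fun y hy => hφ y fun hy' => hy hy'.1, h' φ φ' fun y hy => hφ y fun hy' => hy hy'.2]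
  | k + 1, X, Y, hX, hY => by
    simp only [multivectorSupport]
    rw [← closure_union]
    refine closure_mono (iUnion_subset fun φ => ?_)
    rintro x (hx | ⟨z, hz, rfl⟩)
    · by_contra hxn
      have h1 : x ∉ distributionSupport (dirDeriv X φ) := fun hh =>
        hxn (Or.inl (mem_iUnion.2 ⟨φ, Or.inl hh⟩))
      have h2 : x ∉ distributionSupport (dirDeriv Y φ) := fun hh =>
        hxn (Or.inr (mem_iUnion.2 ⟨φ, Or.inl hh⟩))
      simp only [distributionSupport, notMem_compl_iff] at h1 h2
      obtain ⟨U, hU, hxU, h⟩ := h1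
      obtain ⟨U', hU', hxU', h'⟩ := h2
      refine hx ⟨U ∩ U', hU.inter hU', ⟨hxU, hxU'⟩, fun ψ hψ => ?_⟩
      rw [dirDeriv_add hX hY, h ψ (hψ.trans inter_subset_left), h' ψ (hψ.trans inter_subset_right),
        add_zero]
    · by_contra hxn
      have h1 : z ∉ (X φ).support := fun hh =>
        hxn (Or.inl (mem_iUnion.2 ⟨φ, Or.inr ⟨z, hh, rfl⟩⟩))
      have h2 : z ∉ (Y φ).support := fun hh =>
        hxn (Or.inr (mem_iUnion.2 ⟨φ, Or.inr ⟨z, hh, rfl⟩⟩))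
      simp only [AltDistribution.support, notMem_compl_iff] at h1 h2
      obtain ⟨U, hU, h⟩ := h1
      obtain ⟨U', hU', h'⟩ := h2
      refine hz ⟨fun i => U i ∩ U' i,
        fun i => ⟨(hU i).1.inter (hU' i).1, (hU i).2, (hU' i).2⟩, fun w hw => ?_⟩
      change X φ w + Y φ w = 0
      rw [h w fun i => (hw i).trans inter_subset_left, h' w fun i => (hw i).trans inter_subset_right,
        add_zero]

theorem multivectorSupport_smul (c : ℂ) : {k : ℕ} →
    {X : Sections n F V → AltDistribution n F' W k} → BastianiSmooth X →
    multivectorSupport (c • X) ⊆ multivectorSupport X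
  | 0, X, _ => by
    intro x hx
    by_contra hxn
    simp only [multivectorSupport, functionalSupport, notMem_compl_iff] at hxn
    obtain ⟨U, hU, hxU, h⟩ := hxn
    refine hx ⟨U, hU, hxU, fun φ φ' hφ => ?_⟩
    simp only [Pi.smul_apply]
    rw [h φ φ' hφ]
  | k + 1, X, hX => by
    simp only [multivectorSupport]
    refine closure_mono (iUnion_mono fun φ => ?_)
    rintro x (hx | ⟨z, hz, rfl⟩)
    · by_contra hxn
      have h1 : x ∉ distributionSupport (dirDeriv X φ) := fun hh => hxn (Or.inl hh)
      simp only [distributionSupport, notMem_compl_iff] at h1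
      obtain ⟨U, hU, hxU, h⟩ := h1
      refine hx ⟨U, hU, hxU, fun ψ hψ => ?_⟩
      rw [dirDeriv_const_smul c hX, h ψ hψ, smul_zero]
    · by_contra hxn
      have h1 : z ∉ (X φ).support := fun hh => hxn (Or.inr ⟨z, hh, rfl⟩)
      simp only [AltDistribution.support, notMem_compl_iff] at h1
      obtain ⟨U, hU, h⟩ := h1
      refine hz ⟨U, hU, fun w hw => ?_⟩
      change c • X φ w = 0
      rw [h w hw, smul_zero]

variable (n F V F' W) in
/-- The space `𝒳ᵏ` of smooth compactly supported `k`-vector fields: Bastiani smooth maps from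
the configurations (sections of `V`) to the antisymmetric compactly supported distributions in `k`
variables. For `k = 0` this is the space `𝓕` of smooth compactly supported functionals, a number
being identified with a `0`-linear form. -/
def multivectorFields (k : ℕ) : Submodule ℂ (Sections n F V → AltDistribution n F' W k) where
  carrier := {X | BastianiSmooth X ∧ IsCompact (multivectorSupport X)}
  zero_mem' := ⟨bastianiSmooth_zero, by rw [multivectorSupport_zero]; exact isCompact_empty⟩
  add_mem' hX hY := ⟨hX.1.add hY.1, (hX.2.union hY.2).of_isClosed_subset
    (isClosed_multivectorSupport _) (multivectorSupport_add hX.1 hY.1)⟩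
  smul_mem' c _ hX := ⟨hX.1.const_smul c, hX.2.of_isClosed_subset
    (isClosed_multivectorSupport _) (multivectorSupport_smul c hX.1)⟩

/-- The space `𝓕_S` of on-shell functionals: smooth functionals on the solution space `ker P` that
are compactly supported, i.e. depend only on the restriction of a solution to a compact set. -/
def onShellFunctionals (P : Sections n F V →ₗ[ℝ] Sections n F' W) :
    Submodule ℂ (LinearMap.ker P → ℂ) where
  carrier := {f | BastianiSmooth f ∧ ∃ K : Set M, IsCompact K ∧
    ∀ φ φ' : LinearMap.ker P, (∀ x ∈ K, φ.1 x = φ'.1 x) → f φ = f φ'}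
  zero_mem' := ⟨bastianiSmooth_zero, ∅, isCompact_empty, fun _ _ _ => rfl⟩
  add_mem' := by
    rintro f f' ⟨hf, K, hK, h⟩ ⟨hf', K', hK', h'⟩
    refine ⟨hf.add hf', K ∪ K', hK.union hK', fun φ φ' hφ => ?_⟩
    simp only [Pi.add_apply]
    rw [h φ φ' fun x hx => hφ x (Or.inl hx), h' φ φ' fun x hx => hφ x (Or.inr hx)]
  smul_mem' := by
    rintro c f ⟨hf, K, hK, h⟩
    refine ⟨hf.const_smul c, K, hK, fun φ φ' hφ => ?_⟩
    simp only [Pi.smul_apply]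
    rw [h φ φ' hφ]

end Multivector

/-! ## The Koszul differential and the homotopy operator -/

section Complex

/-- The Koszul differential `(δ X)(φ) = X(φ){P φ, ⬝}`. -/
def koszulDifferential {A B : Type*} [AddCommGroup A] [Module ℝ A] [AddCommGroup B] [Module ℝ B]
    [TopologicalSpace B] (P : A →ₗ[ℝ] B) {k : ℕ} (X : A → B [⋀^Fin (k + 1)]→L[ℝ] ℂ) (φ : A) :
    B [⋀^Fin k]→L[ℝ] ℂ where
  toFun h := X φ (Fin.cons (P φ) h)
  map_update_add' := by
    intro inst h i x y
    rw [Subsingleton.elim inst (instDecidableEqFin k)]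
    simp only [Fin.cons_update, ContinuousAlternatingMap.map_update_add]
  map_update_smul' := by
    intro inst h i c x
    rw [Subsingleton.elim inst (instDecidableEqFin k)]
    simp only [Fin.cons_update, ContinuousAlternatingMap.map_update_smul]
  cont := (X φ).cont.comp (continuous_const.finCons continuous_id)
  map_eq_zero_of_eq' h i j hij hne :=
    (X φ).map_eq_zero_of_eq _ (i := i.succ) (j := j.succ) (by simpa using hij)
      (fun he => hne (Fin.succ_injective _ he))

variable {n : ℕ} {M : Type*} [TopologicalSpace M] [ChartedSpace (EuclideanSpace ℝ (Fin n)) M]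
  [IsManifold (𝓡 n) ∞ M]
  {F : Type*} [NormedAddCommGroup F] [NormedSpace ℝ F]
  {V : M → Type*} [TopologicalSpace (TotalSpace F V)] [∀ x, AddCommGroup (V x)]
  [∀ x, Module ℝ (V x)] [∀ x, TopologicalSpace (V x)] [FiberBundle F V] [VectorBundle ℝ F V]
  {F' : Type*} [NormedAddCommGroup F'] [NormedSpace ℝ F']
  {W : M → Type*} [TopologicalSpace (TotalSpace F' W)] [∀ x, AddCommGroup (W x)]
  [∀ x, Module ℝ (W x)] [∀ x, TopologicalSpace (W x)] [FiberBundle F' W] [VectorBundle ℝ F' W]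

variable (V) in
/-- The sections with past compact support. -/
def pastCompactSections (g : LorentzianStructure n M) : Set (Sections n F V) :=
  {s | g.PastCompact (sectionSupport s)}

variable (V) in
/-- The sections with future compact support. -/
def futureCompactSections (g : LorentzianStructure n M) : Set (Sections n F V) :=
  {s | g.FutureCompact (sectionSupport s)}

/-- The retarded Green's operator `Δᴿ` on sections with past compact support: the inverse of `P`
on the sections with past compact support. -/
def retarded (g : LorentzianStructure n M) (P : Sections n F V →ₗ[ℝ] Sections n F' W) :
    Sections n F' W → Sections n F V :=
  Function.invFunOn P (pastCompactSections V g)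

/-- The advanced Green's operator `Δᴬ` on sections with future compact support: the inverse of `P`
on the sections with future compact support. -/
def advanced (g : LorentzianStructure n M) (P : Sections n F V →ₗ[ℝ] Sections n F' W) :
    Sections n F' W → Sections n F V :=
  Function.invFunOn P (futureCompactSections V g)

/-- `α h = Δᴬ ((1 - θ) h) + Δᴿ (θ h)`. -/
def alpha (g : LorentzianStructure n M) (P : Sections n F V →ₗ[ℝ] Sections n F' W)
    (θ : C^∞⟮𝓡 n, M; ℝ⟯) (h : Sections n F' W) : Sections n F V :=
  advanced g P (functionSmul (1 - θ) h) + retarded g P (functionSmul θ h)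

/-- `γ_λ φ = φ + (λ - 1) α P φ`. -/
def gamma (g : LorentzianStructure n M) (P : Sections n F V →ₗ[ℝ] Sections n F' W)
    (θ : C^∞⟮𝓡 n, M; ℝ⟯) (l : ℝ) (φ : Sections n F V) : Sections n F V :=
  φ + (l - 1) • alpha g P θ (P φ)

variable [ContMDiffVectorBundle ∞ F V (𝓡 n)] [ContMDiffVectorBundle ∞ F' W (𝓡 n)]

/-- The value `(H_k Y)(φ){h₁, …, h_{k+1}}` of the homotopy operator, that is
`∑ᵢ (-1)^{i-1} ∫₀¹ Y⁽¹⁾(γ_λ φ){α hᵢ; h₁, …, ĥᵢ, …, h_{k+1}} λᵏ dλ`. -/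
def homotopyValue (g : LorentzianStructure n M) (P : Sections n F V →ₗ[ℝ] Sections n F' W)
    (θ : C^∞⟮𝓡 n, M; ℝ⟯) {k : ℕ} (Y : Sections n F V → AltDistribution n F' W k)
    (φ : Sections n F V) (h : Fin (k + 1) → Sections n F' W) : ℂ :=
  ∑ i : Fin (k + 1), (-1) ^ (i : ℕ) * ∫ l in (0 : ℝ)..1,
    dirDeriv Y (gamma g P θ l φ) (alpha g P θ (h i)) (i.removeNth h) * (l : ℂ) ^ k

end Complex

end Koszul

end

open Koszul

open scoped Uniformity

noncomputable section

namespace Koszul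

/-! The complex is contracted explicitly. A cutoff `θ` glues the advanced and retarded inverses into
a right inverse `α` of `P` on all sections. Since `P γ_λ = λ P`, the lines `λ ↦ γ_λ φ` run from a
solution `γ_0 φ` to `φ`, with velocity `α P φ`. Integrating the derivative of `λ^k X(γ_λ φ){h}` over
`[0, 1]` gives `X(φ){h}` for `k > 0`, and `X(φ) - X(γ_0 φ)` for `k = 0`, where no weight kills the
lower endpoint. In that derivative, the term differentiating `X` is the leading term of `δ H X`, and
the term differentiating `λ^k` comes from `H δ X`, whose `k` summands each return `X` by
antisymmetry. All other terms cancel (`eq_homotopySum_add`, `sub_eq_homotopySum`). As `γ_0` fixes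
solutions, `f ∘ γ_0` extends `f`, and exactness follows.

The remaining work makes the ingredients legitimate.

Causality: futures of nearby points are neighbourhoods, so compactness of diamonds upgrades to
compactness of causal hulls of compact sets (`ProperCausality.of_diamonds`). A causally convex
compact exhaustion then separates far past from far future and yields `θ`
(`LorentzianStructure.exists_isTimeCutoff`).

Green's operators: the value at `x` sees only the source in the past of `x`, which is a compact
portion when the source is past compact. Cutoffs therefore extend existence and uniqueness from
compact to past compact supports (`exists_solution`, `sectionSupport_subset_future`). The
time-reversed case is the same argument for the swapped relation.

Continuity: countably many charts already give the topology of the sections, which is complete and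
metrizable. The closed graph theorem (`sections_continuous_of_closed_graph`) then handles `P`, `θ`
and `α` without estimates.

Smoothness: the sections form a Montel space, so uniform convergence on bounded sets follows from
joint continuity on compact ones. Bastiani smoothness of form-valued maps is thereby equivalent to
having jointly continuous scalar derivatives (`IsDerivativeSequence.scalar`,
`IsScalarDerivativeSequence.bastianiSmooth`), and these are easy to compute under an integral sign.

Supports: `exists_supportedOn` converts a compact spacetime support into dependence on a compact
set, a property that `P` and `α` propagate. -/

/-! ## Proper causal relations -/

section Relations

variable {M : Type*}

/-- The future of a set with respect to a relation. -/
def relFuture (r : M → M → Prop) (A : Set M) : Set M := {q | ∃ p ∈ A, r p q}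

theorem relFuture_mono {r : M → M → Prop} {A B : Set M} (h : A ⊆ B) :
    relFuture r A ⊆ relFuture r B := fun _ ⟨p, hp, hr⟩ => ⟨p, h hp, hr⟩

variable [TopologicalSpace M]

/-- A set meeting the past of every compact set in a compact set. -/
def RelPastCompact (r : M → M → Prop) (A : Set M) : Prop :=
  ∀ K, IsCompact K → IsCompact (A ∩ relFuture (Function.swap r) K)

/-- A preorder for which the causal hulls of compact sets are compact. -/
structure ProperCausality (r : M → M → Prop) : Prop where
  refl (p : M) : r p p
  trans {p q s : M} : r p q → r q s → r p s
  isCompact_hull (K K' : Set M) : IsCompact K → IsCompact K' →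
    IsCompact (relFuture r K ∩ relFuture (Function.swap r) K')

namespace ProperCausality

variable {r : M → M → Prop}

theorem swap (h : ProperCausality r) : ProperCausality (Function.swap r) where
  refl := h.refl
  trans h1 h2 := h.trans h2 h1
  isCompact_hull K K' hK hK' := by
    rw [inter_comm]
    exact h.isCompact_hull K' K hK' hK

theorem subset_future (h : ProperCausality r) (A : Set M) : A ⊆ relFuture r A :=
  fun p hp => ⟨p, hp, h.refl p⟩

theorem future_future (h : ProperCausality r) (A : Set M) :
    relFuture r (relFuture r A) ⊆ relFuture r A :=
  fun _ ⟨_, ⟨p', hp', hr'⟩, hr⟩ => ⟨p', hp', h.trans hr' hr⟩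

/-- By transitivity, a point of `A` from which the past of `K` can be reached lies in the past of
`K` itself. Only a compact part of `A` contributes, and its hull with `K` is compact. -/
theorem isCompact_future_inter (h : ProperCausality r) {A : Set M} (hA : RelPastCompact r A)
    {K : Set M} (hK : IsCompact K) :
    IsCompact (relFuture r A ∩ relFuture (Function.swap r) K) := by
  have heq : relFuture r A ∩ relFuture (Function.swap r) K =
      relFuture r (A ∩ relFuture (Function.swap r) K) ∩ relFuture (Function.swap r) K := by
    ext x
    constructor
    · rintro ⟨⟨p, hp, hr⟩, ⟨q, hq, hr'⟩⟩
      exact ⟨⟨p, ⟨hp, q, hq, h.trans hr hr'⟩, hr⟩, ⟨q, hq, hr'⟩⟩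
    · rintro ⟨⟨p, hp, hr⟩, hx⟩
      exact ⟨⟨p, hp.1, hr⟩, hx⟩
  rw [heq]
  exact h.isCompact_hull _ _ (hA K hK) hK

theorem relPastCompact_future (h : ProperCausality r) {A : Set M} (hA : RelPastCompact r A) :
    RelPastCompact r (relFuture r A) := fun _ hK => h.isCompact_future_inter hA hK

variable [T2Space M] [LocallyCompactSpace M]

/-- Closedness is local. Inside a compact neighbourhood `N` of a limit point, the future of `A` is
contained in its compact intersection with the past of `N`. -/
theorem isClosed_future (h : ProperCausality r) {A : Set M} (hA : RelPastCompact r A) :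
    IsClosed (relFuture r A) := by
  refine isClosed_of_closure_subset fun x hx => ?_
  obtain ⟨N, hN, hxN⟩ := exists_compact_mem_nhds x
  have h1 : x ∈ closure (relFuture r A ∩ N) := by
    rw [mem_closure_iff_nhds]
    intro t ht
    obtain ⟨y, hy⟩ := mem_closure_iff_nhds.1 hx _ (inter_mem ht hxN)
    exact ⟨y, hy.1.1, hy.2, hy.1.2⟩
  have h2 : IsClosed (relFuture r A ∩ relFuture (Function.swap r) N) :=
    (h.isCompact_future_inter hA hN).isClosed
  exact (closure_minimal (inter_subset_inter_right _ (h.swap.subset_future N)) h2 h1).1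

theorem isClosed_future_of_isCompact (h : ProperCausality r) {K : Set M} (hK : IsCompact K) :
    IsClosed (relFuture r K) := by
  refine isClosed_of_closure_subset fun x hx => ?_
  obtain ⟨N, hN, hxN⟩ := exists_compact_mem_nhds x
  have h1 : x ∈ closure (relFuture r K ∩ N) := by
    rw [mem_closure_iff_nhds]
    intro t ht
    obtain ⟨y, hy⟩ := mem_closure_iff_nhds.1 hx _ (inter_mem ht hxN)
    exact ⟨y, hy.1.1, hy.2, hy.1.2⟩
  have h2 : IsClosed (relFuture r K ∩ relFuture (Function.swap r) N) :=
    (h.isCompact_hull K N hK hN).isClosed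
  exact (closure_minimal (inter_subset_inter_right _ (h.swap.subset_future N)) h2 h1).1

/-- This is an exhaustion by causally convex compact sets. Taking causal hulls preserves compactness
and is idempotent by transitivity, so each stage of an ordinary exhaustion can be replaced by a
hull. -/
theorem exists_closed_past_future [SigmaCompactSpace M] (h : ProperCausality r) :
    ∃ C : ℕ → Set M, (∀ m, IsCompact (C m)) ∧ (∀ m, C m ⊆ interior (C (m + 1))) ∧
      (⋃ m, C m = univ) ∧
      (∀ m, relFuture r (C m) ∩ relFuture (Function.swap r) (C m) ⊆ C m) := by
  classical
  set E : CompactExhaustion M := default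
  let hull : Set M → Set M := fun K => relFuture r K ∩ relFuture (Function.swap r) K
  have hhull : ∀ K, IsCompact K → IsCompact (hull K) := fun K hK => h.isCompact_hull K K hK hK
  have hsub : ∀ K, K ⊆ hull K := fun K =>
    subset_inter (h.subset_future K) (h.swap.subset_future K)
  have key : ∀ K : Set M, IsCompact K → ∃ K', IsCompact K' ∧ K ⊆ interior K' := fun K hK =>
    exists_compact_superset hK
  choose! e he1 he2 using key
  -- The part `e K` is a compact neighbourhood of the previous stage, which nests each stage in the
  -- interior of the next. The part `E (m + 1)` forces the stages to cover `M`.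
  let C : ℕ → Set M := fun m => Nat.rec (hull (E 0)) (fun m K => hull (e K ∪ E (m + 1))) m
  have hC : ∀ m, IsCompact (C m) := by
    intro m
    induction m with
    | zero => exact hhull _ (E.isCompact 0)
    | succ m ih => exact hhull _ ((he1 _ ih).union (E.isCompact _))
  refine ⟨C, hC, fun m => ?_, ?_, fun m => ?_⟩
  · exact (he2 _ (hC m)).trans (interior_mono (subset_union_left.trans (hsub _)))
  · refine eq_univ_of_forall fun x => ?_
    obtain ⟨m, hm⟩ := E.exists_mem x
    refine mem_iUnion.2 ⟨m, ?_⟩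
    cases m with
    | zero => exact hsub _ hm
    | succ m => exact hsub _ (Or.inr hm)
  · have hidem : ∀ K, relFuture r (hull K) ∩ relFuture (Function.swap r) (hull K) ⊆ hull K :=
      fun K => inter_subset_inter
        ((relFuture_mono inter_subset_left).trans (h.future_future K))
        ((relFuture_mono inter_subset_right).trans (h.swap.future_future K))
    cases m with
    | zero => exact hidem _
    | succ m => exact hidem _

/-- Disjoint closed sets separating the far past from the far future. -/
theorem exists_separating_closed [SigmaCompactSpace M] (h : ProperCausality r) :
    ∃ A B : Set M, IsClosed A ∧ IsClosed B ∧ Disjoint A B ∧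
      (∀ T, IsClosed T → Disjoint T A → RelPastCompact r T) ∧
      (∀ T, IsClosed T → Disjoint T B → RelPastCompact (Function.swap r) T) := by
  obtain ⟨C, hC, hint, hcov, hconv⟩ := h.exists_closed_past_future
  have hmono : Monotone C := monotone_nat_of_le_succ fun m => (hint m).trans interior_subset
  have hmem : ∀ K, IsCompact K → ∃ m, K ⊆ C m := by
    intro K hK
    obtain ⟨m, hm⟩ := hK.elim_directed_cover (fun m => interior (C m)) (fun _ => isOpen_interior)
      (fun x _ => by
        obtain ⟨m, hm⟩ := mem_iUnion.1 (hcov.symm ▸ mem_univ x)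
        exact mem_iUnion.2 ⟨m + 1, hint m hm⟩)
      (Monotone.directed_le fun a b hab => interior_mono (hmono hab))
    exact ⟨m, hm.trans interior_subset⟩
  -- The far future is the union of the sets `J⁺(C m) \ interior (C (m + 1))`, and the far past is
  -- its time reversal. The union is locally finite: the interior of `C (m + 1)` meets only the
  -- terms of index at most `m`.
  have hclosed : ∀ {s : M → M → Prop}, ProperCausality s →
      IsClosed (⋃ m, relFuture s (C m) \ interior (C (m + 1))) := by
    intro s hs
    refine LocallyFinite.isClosed_iUnion ?_ fun m =>
      (hs.isClosed_future_of_isCompact (hC m)).sdiff isOpen_interior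
    intro x
    obtain ⟨m, hm⟩ := mem_iUnion.1 (hcov.symm ▸ mem_univ x)
    refine ⟨interior (C (m + 1)), isOpen_interior.mem_nhds (hint m hm),
      (Set.finite_lt_nat (m + 1)).subset ?_⟩
    rintro k ⟨y, hy1, hy2⟩
    by_contra hk
    exact hy1.2 (interior_mono (hmono (by simp only [mem_ofPred_eq] at hk; omega)) hy2)
  -- A set avoiding the far past meets the past of `C m` only inside the compact set `C (m + 1)`.
  have hcompact : ∀ {s : M → M → Prop}, ProperCausality s → ∀ T, IsClosed T →
      Disjoint T (⋃ m, relFuture (Function.swap s) (C m) \ interior (C (m + 1))) →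
      RelPastCompact s T := by
    intro s hs T hT hd K hK
    obtain ⟨m, hm⟩ := hmem K hK
    refine (hC (m + 1)).of_isClosed_subset
      (hT.inter (hs.swap.isClosed_future_of_isCompact hK)) fun x hx => ?_
    by_contra hxn
    exact disjoint_left.1 hd hx.1 (mem_iUnion.2 ⟨m, relFuture_mono hm hx.2,
      fun hh => hxn (interior_subset hh)⟩)
  refine ⟨_, _, hclosed h.swap, hclosed h, ?_, hcompact h, hcompact h.swap⟩
  rw [disjoint_left]
  intro x h1 h2
  obtain ⟨a, ha⟩ := mem_iUnion.1 h1
  obtain ⟨b, hb⟩ := mem_iUnion.1 h2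
  -- A common point would lie in both the past and the future of the larger of the two stages, hence
  -- in that stage by causal convexity. It would then be interior to the following stage, which was
  -- removed.
  rcases le_total a b with hab | hab
  · exact hb.2 (hint b (hconv b ⟨hb.1, relFuture_mono (hmono hab) ha.1⟩))
  · exact ha.2 (hint a (hconv a ⟨relFuture_mono (hmono hab) hb.1, ha.1⟩))

/-- A preorder with compact diamonds, such that every point has arbitrarily close points whose
futures (pasts) are neighbourhoods of it, has compact hulls of compact sets. -/
theorem of_diamonds (refl : ∀ p, r p p) (trans : ∀ {p q s : M}, r p q → r q s → r p s)
    (hd : ∀ p q, IsCompact (relFuture r {p} ∩ relFuture (Function.swap r) {q}))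
    (h1 : ∀ x, ∀ N ∈ 𝓝 x, ∃ p ∈ N, relFuture r {p} ∈ 𝓝 x)
    (h2 : ∀ x, ∀ N ∈ 𝓝 x, ∃ p ∈ N, relFuture (Function.swap r) {p} ∈ 𝓝 x) :
    ProperCausality r := by
  -- A limit point `x` has some `q` whose past is a neighbourhood of `x`. The limit is then taken
  -- inside the compact diamond of `p` and `q`.
  have hf : ∀ p, IsClosed (relFuture r {p}) := by
    refine fun p => isClosed_of_closure_subset fun x hx => ?_
    obtain ⟨q, -, hq⟩ := h2 x univ univ_mem
    have hx' : x ∈ closure (relFuture r {p} ∩ relFuture (Function.swap r) {q}) := by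
      rw [mem_closure_iff_nhds]
      intro t ht
      obtain ⟨y, hy⟩ := mem_closure_iff_nhds.1 hx _ (inter_mem ht hq)
      exact ⟨y, hy.1.1, hy.2, hy.1.2⟩
    rw [(hd p q).isClosed.closure_eq] at hx'
    exact hx'.1
  have hp : ∀ p, IsClosed (relFuture (Function.swap r) {p}) := by
    refine fun p => isClosed_of_closure_subset fun x hx => ?_
    obtain ⟨q, -, hq⟩ := h1 x univ univ_mem
    have hx' : x ∈ closure (relFuture r {q} ∩ relFuture (Function.swap r) {p}) := by
      rw [mem_closure_iff_nhds]
      intro t ht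
      obtain ⟨y, hy⟩ := mem_closure_iff_nhds.1 hx _ (inter_mem ht hq)
      exact ⟨y, hy.1.1, hy.1.2, hy.2⟩
    rw [(hd q p).isClosed.closure_eq] at hx'
    exact hx'.2
  -- For `p` close to `x` with future a neighbourhood of `x`, the approximating pairs give points
  -- after `p` that tend to `y`, so `p` precedes `y`. Letting `p` tend to `x` uses that the past of
  -- `y` is closed.
  have hrel : IsClosed {z : M × M | r z.1 z.2} := by
    refine isClosed_of_closure_subset ?_
    rintro ⟨x, y⟩ hxy
    have hx : x ∈ closure (relFuture (Function.swap r) {y}) := by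
      rw [mem_closure_iff_nhds]
      intro N hN
      obtain ⟨p, hpN, hpx⟩ := h1 x N hN
      refine ⟨p, hpN, y, rfl, ?_⟩
      have hy : y ∈ closure (relFuture r {p}) := by
        rw [mem_closure_iff_nhds]
        intro O hO
        obtain ⟨⟨x', y'⟩, ⟨hx', hy'⟩, hr⟩ :=
          mem_closure_iff_nhds.1 hxy _ (prod_mem_nhds hpx hO)
        obtain ⟨p', rfl, hp'⟩ := hx'
        exact ⟨y', hy', p', rfl, trans hp' hr⟩
      rw [(hf p).closure_eq] at hy
      obtain ⟨p', rfl, hp'⟩ := hy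
      exact hp'
    rw [(hp y).closure_eq] at hx
    obtain ⟨y', rfl, hy'⟩ := hx
    exact hy'
  -- Projection along a compact factor is a closed map.
  have hfK : ∀ K, IsCompact K → IsClosed (relFuture r K) := by
    intro K hK
    have := isCompact_iff_compactSpace.1 hK
    have hc : IsClosed {z : K × M | r z.1 z.2} := hrel.preimage
      ((continuous_subtype_val.comp continuous_fst).prodMk continuous_snd)
    convert isClosedMap_snd_of_compactSpace _ hc
    ext x
    simp [relFuture]
  have hpK : ∀ K, IsCompact K → IsClosed (relFuture (Function.swap r) K) := by
    intro K hK
    have := isCompact_iff_compactSpace.1 hK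
    have hc : IsClosed {z : K × M | r z.2 z.1} := hrel.preimage
      (continuous_snd.prodMk (continuous_subtype_val.comp continuous_fst))
    convert isClosedMap_snd_of_compactSpace _ hc
    ext x
    simp [relFuture, Function.swap]
  refine ⟨refl, trans, fun K K' hK hK' => ?_⟩
  choose p _ hpx using fun x => h1 x univ univ_mem
  choose q _ hqx using fun x => h2 x univ univ_mem
  obtain ⟨s, -, hs⟩ := hK.elim_nhds_subcover (fun x => relFuture r {p x}) fun x _ => hpx x
  obtain ⟨s', -, hs'⟩ := hK'.elim_nhds_subcover (fun x => relFuture (Function.swap r) {q x})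
    fun x _ => hqx x
  -- The hull is closed and is covered by the finitely many diamonds spanned by points just before
  -- `K` and points just after `K'`.
  refine IsCompact.of_isClosed_subset (s.isCompact_biUnion fun x _ =>
    s'.isCompact_biUnion fun y _ => hd (p x) (q y)) ((hfK K hK).inter (hpK K' hK')) ?_
  rintro z ⟨⟨a, ha, haz⟩, ⟨b, hb, hbz⟩⟩
  obtain ⟨x, hx, p', rfl, hp'⟩ := mem_iUnion₂.1 (hs ha)
  obtain ⟨y, hy, q', rfl, hq'⟩ := mem_iUnion₂.1 (hs' hb)
  exact mem_iUnion₂.2 ⟨x, hx, mem_iUnion₂.2 ⟨y, hy, ⟨_, rfl, trans hp' haz⟩,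
    ⟨_, rfl, trans hbz hq'⟩⟩⟩

end ProperCausality

end Relations

/-! ## Local causality of Lorentzian metrics -/

section Lorentz

variable {n : ℕ} {M : Type*} [TopologicalSpace M] [ChartedSpace (EuclideanSpace ℝ (Fin n)) M]
  [IsManifold (𝓡 n) ∞ M]

namespace LorentzianStructure

variable (g : LorentzianStructure n M)

/-- Continuity is treated as differentiability of class `C⁰`, so that the bundle rule for applying a
section of bilinear forms becomes available. -/
theorem continuousOn_metric {X : Type*} [NormedAddCommGroup X] [NormedSpace ℝ X] {s : Set X}
    {b : X → M} {v w : ∀ y, TangentSpace (𝓡 n) (b y)}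
    (hv : ContinuousOn (fun y => (⟨b y, v y⟩ : TangentBundle (𝓡 n) M)) s)
    (hw : ContinuousOn (fun y => (⟨b y, w y⟩ : TangentBundle (𝓡 n) M)) s) :
    ContinuousOn (fun y => g.metric (b y) (v y) (w y)) s := by
  have hb : ContinuousOn b s := (FiberBundle.continuous_proj _ _).comp_continuousOn hv
  have hm := g.contMDiff.continuous.comp_continuousOn hb
  rw [← contMDiffOn_zero_iff (I := 𝓘(ℝ, X)) (I' := 𝓘(ℝ, ℝ))]
  rw [← contMDiffOn_zero_iff (I := 𝓘(ℝ, X)) (I' := (𝓡 n).tangent)] at hv hw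
  rw [← contMDiffOn_zero_iff (I := 𝓘(ℝ, X)) (I' := ((𝓡 n).prod
    𝓘(ℝ, EuclideanSpace ℝ (Fin n) →L[ℝ] EuclideanSpace ℝ (Fin n) →L[ℝ] ℝ)))] at hm
  intro x hx
  have : ContMDiffWithinAt 𝓘(ℝ, X) ((𝓡 n).prod 𝓘(ℝ)) 0
      (fun m ↦ TotalSpace.mk' ℝ (E := Bundle.Trivial M ℝ) (b m) (g.metric (b m) (v m) (w m)))
      s x := by
    apply ContMDiffWithinAt.clm_bundle_apply₂ (F₁ := EuclideanSpace ℝ (Fin n))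
      (F₂ := EuclideanSpace ℝ (Fin n))
    · exact hm x hx
    · exact hv x hx
    · exact hw x hx
  simp only [contMDiffWithinAt_totalSpace] at this
  exact this.2

/-- The velocity of the curve which is a straight line in the preferred chart at `x`. -/
def lineVelocity (x : M) (z : EuclideanSpace ℝ (Fin n) × EuclideanSpace ℝ (Fin n)) :
    TangentSpace (𝓡 n) ((extChartAt (𝓡 n) x).symm z.1) :=
  mfderivWithin 𝓘(ℝ, EuclideanSpace ℝ (Fin n)) (𝓡 n) (extChartAt (𝓡 n) x).symm
    (extChartAt (𝓡 n) x).target z.1 z.2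

theorem lineVelocity_smul (x : M) (y : EuclideanSpace ℝ (Fin n)) (c : ℝ)
    (w : EuclideanSpace ℝ (Fin n)) : lineVelocity x (y, c • w) = c • lineVelocity x (y, w) :=
  ContinuousLinearMap.map_smul (mfderivWithin 𝓘(ℝ, EuclideanSpace ℝ (Fin n)) (𝓡 n)
    (extChartAt (𝓡 n) x).symm (extChartAt (𝓡 n) x).target y) c w

theorem isFutureCausal_of_neg {x : M} {v : TangentSpace (𝓡 n) x} (h : g.metric x v v < 0)
    (h' : g.metric x (g.future x) v < 0) : g.IsFutureCausal v := by
  refine ⟨?_, h.le, h'⟩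
  rintro rfl
  rw [map_zero] at h'
  exact lt_irrefl _ h'

variable {g} in
theorem IsFutureCausal.smul {x : M} {v : TangentSpace (𝓡 n) x} (h : g.IsFutureCausal v) {c : ℝ}
    (hc : 0 < c) : g.IsFutureCausal (c • v) := by
  refine ⟨smul_ne_zero hc.ne' h.1, ?_, ?_⟩
  · rw [map_smul, map_smul]
    exact mul_nonpos_of_nonneg_of_nonpos hc.le (mul_nonpos_of_nonneg_of_nonpos hc.le h.2.1)
  · rw [map_smul]
    exact mul_neg_of_pos_of_neg hc h.2.2

theorem continuousOn_lineVelocity (x : M) :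
    ContinuousOn (fun z => (⟨(extChartAt (𝓡 n) x).symm z.1, lineVelocity x z⟩ :
      TangentBundle (𝓡 n) M)) ((extChartAt (𝓡 n) x).target ×ˢ univ) := by
  have h1 : ContMDiffOn 𝓘(ℝ, EuclideanSpace ℝ (Fin n)) (𝓡 n) ∞ (extChartAt (𝓡 n) x).symm
    (extChartAt (𝓡 n) x).target := contMDiffOn_extChartAt_symm x
  have h2 := h1.continuousOn_tangentMapWithin (mod_cast le_top)
    (isOpen_extChartAt_target x).uniqueMDiffOn
  have h3 : Continuous fun z : EuclideanSpace ℝ (Fin n) × EuclideanSpace ℝ (Fin n) =>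
      (⟨z.1, z.2⟩ : TangentBundle 𝓘(ℝ, EuclideanSpace ℝ (Fin n)) (EuclideanSpace ℝ (Fin n))) :=
    (tangentBundleModelSpaceHomeomorph
      (𝓘(ℝ, EuclideanSpace ℝ (Fin n)))).symm.continuous
  exact h2.comp h3.continuousOn fun z hz => hz.1

/-- The derivative of the inverse chart is invertible. The equality is stated in the total space
because the two base points are equal without being definitionally so. -/
theorem exists_lineVelocity_eq (x : M) (v : TangentSpace (𝓡 n) x) :
    ∃ w, (⟨(extChartAt (𝓡 n) x).symm (extChartAt (𝓡 n) x x),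
      lineVelocity x (extChartAt (𝓡 n) x x, w)⟩ : TangentBundle (𝓡 n) M) = ⟨x, v⟩ := by
  have h1 := (isInvertible_mfderivWithin_extChartAt_symm (I := 𝓡 n)
    (mem_extChartAt_target (I := 𝓡 n) x))
  have h2 : mfderivWithin 𝓘(ℝ, EuclideanSpace ℝ (Fin n)) (𝓡 n) (extChartAt (𝓡 n) x).symm
      (range (𝓡 n)) (extChartAt (𝓡 n) x x) = mfderivWithin 𝓘(ℝ, EuclideanSpace ℝ (Fin n)) (𝓡 n)
      (extChartAt (𝓡 n) x).symm (extChartAt (𝓡 n) x).target (extChartAt (𝓡 n) x x) := by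
    have hr : range (𝓡 n) = univ := by simp
    rw [hr, mfderivWithin_univ, mfderivWithin_of_isOpen (isOpen_extChartAt_target x)
      (mem_extChartAt_target x)]
  obtain ⟨e, he⟩ := h1
  have hx : (extChartAt (𝓡 n) x).symm (extChartAt (𝓡 n) x x) = x := extChartAt_to_inv x
  have key : ∀ (y : M) (hy : y = x) (L : EuclideanSpace ℝ (Fin n) ≃L[ℝ] TangentSpace (𝓡 n) y),
      ∃ w, (⟨y, L w⟩ : TangentBundle (𝓡 n) M) = ⟨x, v⟩ := by
    rintro y rfl L
    exact ⟨L.symm v, by simp⟩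
  obtain ⟨w, hw⟩ := key _ hx e
  refine ⟨w, ?_⟩
  rw [← hw]
  congr 1
  exact DFunLike.congr_fun (h2.symm.trans he.symm) w

theorem causalCurve_of_line (x : M) {a b : EuclideanSpace ℝ (Fin n)}
    (hseg : ∀ t ∈ Icc (0 : ℝ) 1, a + t • (b - a) ∈ (extChartAt (𝓡 n) x).target ∧
      g.IsFutureCausal (lineVelocity x (a + t • (b - a), b - a))) :
    g.CausalCurveFromTo ((extChartAt (𝓡 n) x).symm a) ((extChartAt (𝓡 n) x).symm b) := by
  have hopen := isOpen_extChartAt_target (I := 𝓡 n) x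
  have h1 : ContMDiffOn 𝓘(ℝ, EuclideanSpace ℝ (Fin n)) (𝓡 n) ∞ (extChartAt (𝓡 n) x).symm
    (extChartAt (𝓡 n) x).target := contMDiffOn_extChartAt_symm x
  have hline : ∀ t : ℝ, HasFDerivAt (fun t : ℝ => a + t • (b - a))
      ((ContinuousLinearMap.id ℝ ℝ).smulRight (b - a)) t := fun t =>
    ((hasFDerivAt_id t).smul_const (b - a)).const_add a
  have hline' : ContDiff ℝ 1 (fun t : ℝ => a + t • (b - a)) := by fun_prop
  refine ⟨fun t => (extChartAt (𝓡 n) x).symm (a + t • (b - a)), ?_, by simp, by simp, ?_⟩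
  · exact (h1.of_le (mod_cast le_top)).comp hline'.contMDiff.contMDiffOn
      fun t ht => (hseg t ht).1
  · intro t ht
    obtain ⟨ht1, ht2⟩ := hseg t ht
    have hd : MDifferentiableAt 𝓘(ℝ, EuclideanSpace ℝ (Fin n)) (𝓡 n) (extChartAt (𝓡 n) x).symm
        (a + t • (b - a)) :=
      ((h1.contMDiffAt (hopen.mem_nhds ht1)).mdifferentiableAt (by simp))
    have hc := (hd.hasMFDerivAt.comp_hasMFDerivWithinAt (s := Icc (0 : ℝ) 1) t
      (hline t).hasMFDerivAt.hasMFDerivWithinAt).mfderivWithin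
        ((uniqueDiffOn_Icc zero_lt_one).uniqueMDiffOn t ht)
    change g.IsFutureCausal (mfderivWithin 𝓘(ℝ, ℝ) (𝓡 n)
      ((extChartAt (𝓡 n) x).symm ∘ fun t : ℝ => a + t • (b - a)) (Icc 0 1) t (1 : ℝ))
    rw [hc]
    have hv : lineVelocity x (a + t • (b - a), b - a) =
        mfderiv 𝓘(ℝ, EuclideanSpace ℝ (Fin n)) (𝓡 n) (extChartAt (𝓡 n) x).symm
          (a + t • (b - a)) (b - a) := by
      simp only [lineVelocity]
      rw [mfderivWithin_of_isOpen hopen ht1]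
    rw [hv] at ht2
    change g.IsFutureCausal (mfderiv 𝓘(ℝ, EuclideanSpace ℝ (Fin n)) (𝓡 n)
      (extChartAt (𝓡 n) x).symm (a + t • (b - a)) ((1 : ℝ) • (b - a)))
    rw [one_smul]
    exact ht2

/-- Let `T` be the time orientation at `x` in coordinates. Being timelike and future directed is an
open condition, so one `δ` serves all base points within `δ` of the chart point of `x` and all
directions within `δ` of `T`. Positive scaling preserves the cone, which gives the homogeneous bound
with `ε`, and convexity keeps the segment in the ball. -/
theorem exists_causalCurve_ball (x : M) : ∃ T : EuclideanSpace ℝ (Fin n), ∃ δ > 0,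
    Metric.ball (extChartAt (𝓡 n) x x) δ ⊆ (extChartAt (𝓡 n) x).target ∧
    ∀ a ∈ Metric.ball (extChartAt (𝓡 n) x x) δ, ∀ b ∈ Metric.ball (extChartAt (𝓡 n) x x) δ,
      ∀ ε > 0, ‖(b - a) - ε • T‖ < ε * δ →
      g.CausalCurveFromTo ((extChartAt (𝓡 n) x).symm a) ((extChartAt (𝓡 n) x).symm b) := by
  set y₀ := extChartAt (𝓡 n) x x with hy₀
  have hopen := isOpen_extChartAt_target (I := 𝓡 n) x
  obtain ⟨T, hT⟩ := exists_lineVelocity_eq x (g.future x)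
  have hy₀t : y₀ ∈ (extChartAt (𝓡 n) x).target := mem_extChartAt_target x
  have hS : IsOpen ((extChartAt (𝓡 n) x).target ×ˢ (univ : Set (EuclideanSpace ℝ (Fin n)))) :=
    hopen.prod isOpen_univ
  have hfut : ContinuousOn (fun z : EuclideanSpace ℝ (Fin n) × EuclideanSpace ℝ (Fin n) =>
      (⟨(extChartAt (𝓡 n) x).symm z.1, g.future _⟩ : TangentBundle (𝓡 n) M))
      ((extChartAt (𝓡 n) x).target ×ˢ univ) :=
    g.continuous_future.comp_continuousOn
      ((continuousOn_extChartAt_symm x).comp continuous_fst.continuousOn fun z hz => hz.1)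
  have hmem : (y₀, T) ∈ (extChartAt (𝓡 n) x).target ×ˢ
      (univ : Set (EuclideanSpace ℝ (Fin n))) := ⟨hy₀t, mem_univ T⟩
  have hQ := (g.continuousOn_metric (continuousOn_lineVelocity x)
    (continuousOn_lineVelocity x)).continuousAt (hS.mem_nhds hmem)
  have hR := (g.continuousOn_metric hfut
    (continuousOn_lineVelocity x)).continuousAt (hS.mem_nhds hmem)
  have hval : ∀ z : TangentBundle (𝓡 n) M, z = ⟨x, g.future x⟩ →
      g.metric z.1 z.2 z.2 < 0 ∧ g.metric z.1 (g.future z.1) z.2 < 0 := by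
    rintro z rfl
    exact ⟨g.future_timelike x, g.future_timelike x⟩
  obtain ⟨hQ0, hR0⟩ := hval _ hT
  have hev := (hQ.eventually (Iio_mem_nhds hQ0)).and ((hR.eventually (Iio_mem_nhds hR0)).and
    (hS.mem_nhds hmem))
  obtain ⟨δ, hδ, hball⟩ := Metric.eventually_nhds_iff_ball.1 hev
  refine ⟨T, δ, hδ, fun y hy => ?_, fun a ha b hb ε hε hab => ?_⟩
  · refine (hball (y, T) ?_).2.2.1
    rw [← ball_prod_same]
    exact ⟨hy, Metric.mem_ball_self hδ⟩
  · refine g.causalCurve_of_line x fun t ht => ?_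
    have hmem : a + t • (b - a) ∈ Metric.ball y₀ δ := by
      have := (convex_ball y₀ δ).add_smul_sub_mem ha hb ht
      exact this
    have hw : ε⁻¹ • (b - a) ∈ Metric.ball T δ := by
      rw [mem_ball_iff_norm]
      have : ε⁻¹ • (b - a) - T = ε⁻¹ • ((b - a) - ε • T) := by
        rw [smul_sub ε⁻¹ (b - a), smul_smul, inv_mul_cancel₀ hε.ne', one_smul]
      rw [this, norm_smul, norm_inv, Real.norm_of_nonneg hε.le, inv_mul_lt_iff₀ hε]
      exact hab
    have hz := hball (a + t • (b - a), ε⁻¹ • (b - a)) (by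
      rw [← ball_prod_same]
      exact ⟨hmem, hw⟩)
    have hsc : lineVelocity x (a + t • (b - a), b - a) =
        ε • lineVelocity x (a + t • (b - a), ε⁻¹ • (b - a)) := by
      have h := lineVelocity_smul x (a + t • (b - a)) ε (ε⁻¹ • (b - a))
      rwa [smul_smul, mul_inv_cancel₀ hε.ne', one_smul] at h
    refine ⟨hz.2.2.1, ?_⟩
    rw [hsc]
    exact (g.isFutureCausal_of_neg hz.1 hz.2.1).smul hε

/-- The causal future of a nearby point is a neighbourhood of the given point, and dually. -/
theorem exists_future_past_mem_nhds (x : M) {N : Set M} (hN : N ∈ 𝓝 x) :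
    (∃ p ∈ N, relFuture g.CausallyPrecedes {p} ∈ 𝓝 x) ∧
      ∃ p ∈ N, relFuture (Function.swap g.CausallyPrecedes) {p} ∈ 𝓝 x := by
  obtain ⟨T, δ, hδ, hsub, hcurve⟩ := g.exists_causalCurve_ball x
  set y₀ := extChartAt (𝓡 n) x x with hy₀
  have hN' : (extChartAt (𝓡 n) x).symm ⁻¹' N ∈ 𝓝 y₀ := by
    have h := (continuousOn_extChartAt_symm (I := 𝓡 n) x).continuousAt
      ((isOpen_extChartAt_target x).mem_nhds (mem_extChartAt_target x))
    refine h.preimage_mem_nhds ?_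
    rwa [extChartAt_to_inv x]
  have hlim : ∀ s : ℝ, Tendsto (fun ε : ℝ => y₀ + (s * ε) • T) (𝓝[>] 0) (𝓝 y₀) := by
    intro s
    have : Continuous fun ε : ℝ => y₀ + (s * ε) • T := by fun_prop
    have h := (this.tendsto 0).mono_left (nhdsWithin_le_nhds (s := Ioi (0 : ℝ)))
    simpa using h
  have hnear : ∀ ε > 0, {q | ∃ z ∈ Metric.ball y₀ δ, ‖z - y₀‖ < ε * δ ∧
      (extChartAt (𝓡 n) x).symm z = q} ∈ 𝓝 x := by
    intro ε hε
    have h1 : (extChartAt (𝓡 n) x) ⁻¹' (Metric.ball y₀ δ ∩ Metric.ball y₀ (ε * δ)) ∈ 𝓝 x :=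
      (continuousAt_extChartAt x).preimage_mem_nhds
        (inter_mem (Metric.ball_mem_nhds _ hδ) (Metric.ball_mem_nhds _ (by positivity)))
    filter_upwards [h1, extChartAt_source_mem_nhds (I := 𝓡 n) x] with q hq hqs
    exact ⟨_, hq.1, mem_ball_iff_norm.1 hq.2, (extChartAt (𝓡 n) x).left_inv hqs⟩
  constructor
  -- The point `p` is the chart point moved by `-ε T`. Its displacement to a nearby `z` differs from
  -- `ε T` exactly by `z - y₀`, so every `z` within `ε δ` is reached.
  · obtain ⟨ε, ⟨h1, h2⟩, hε⟩ := (((hlim (-1)).eventually (inter_mem hN'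
      (Metric.ball_mem_nhds y₀ hδ))).and self_mem_nhdsWithin).exists
    refine ⟨_, h1, ?_⟩
    filter_upwards [hnear ε hε]
    rintro q ⟨z, hz, hzε, rfl⟩
    refine ⟨_, rfl, Relation.ReflTransGen.single (hcurve _ h2 _ hz ε hε ?_)⟩
    have h3 : z - (y₀ + (-1 * ε) • T) - ε • T = z - y₀ := by module
    rwa [h3]
  · obtain ⟨ε, ⟨h1, h2⟩, hε⟩ := (((hlim 1).eventually (inter_mem hN'
      (Metric.ball_mem_nhds y₀ hδ))).and self_mem_nhdsWithin).exists
    refine ⟨_, h1, ?_⟩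
    filter_upwards [hnear ε hε]
    rintro q ⟨z, hz, hzε, rfl⟩
    refine ⟨_, rfl, Relation.ReflTransGen.single (hcurve _ hz _ h2 ε hε ?_)⟩
    rw [← norm_neg] at hzε
    have h3 : y₀ + (1 * ε) • T - z - ε • T = -(z - y₀) := by module
    rwa [h3]

theorem properCausality [T2Space M] [LocallyCompactSpace M] (hg : g.GloballyHyperbolic) :
    ProperCausality g.CausallyPrecedes :=
  ProperCausality.of_diamonds (fun _ => Relation.ReflTransGen.refl)
    (fun h1 h2 => Relation.ReflTransGen.trans h1 h2) hg.isCompact_diamond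
    (fun x _ hN => (g.exists_future_past_mem_nhds x hN).1)
    (fun x _ hN => (g.exists_future_past_mem_nhds x hN).2)

/-- A smooth Urysohn function vanishing near the far past and equal to `1` near the far future
works, because its support and that of its complement then avoid the respective sets. -/
theorem exists_isTimeCutoff [T2Space M] [SecondCountableTopology M]
    (hg : g.GloballyHyperbolic) : ∃ θ, g.IsTimeCutoff θ := by
  have : LocallyCompactSpace M := ChartedSpace.locallyCompactSpace (EuclideanSpace ℝ (Fin n)) M
  obtain ⟨A, B, hA, hB, hAB, h1, h2⟩ := (g.properCausality hg).exists_separating_closed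
  obtain ⟨θ, hθA, hθB, -⟩ := exists_contMDiffMap_zero_one_nhds_of_isClosed (𝓡 n) (n := ⊤) hA hB hAB
  refine ⟨θ, h1 _ (isClosed_tsupport _) ?_, h2 _ (isClosed_tsupport _) ?_⟩
  · rw [disjoint_right]
    intro x hx
    rw [notMem_tsupport_iff_eventuallyEq]
    exact eventually_nhdsSet_iff_forall.1 hθA x hx
  · rw [disjoint_right]
    intro x hx
    rw [notMem_tsupport_iff_eventuallyEq]
    filter_upwards [eventually_nhdsSet_iff_forall.1 hθB x hx] with y hy
    change 1 - θ y = 0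
    rw [hy, sub_self]

end LorentzianStructure

end Lorentz

/-! ## The closed graph theorem -/

section ClosedGraph

variable {E F : Type*} [AddCommGroup E] [Module ℝ E] [TopologicalSpace E]
  [IsTopologicalAddGroup E] [ContinuousSMul ℝ E]
  [AddCommGroup F] [Module ℝ F]

/-- This is the Baire category half of the closed graph theorem: multiples of one closed set exhaust
`E`, so that set has interior points, and differences move the interior to the origin. -/
theorem closure_preimage_mem_nhds_zero [BaireSpace E] [TopologicalSpace F]
    [IsTopologicalAddGroup F] [ContinuousSMul ℝ F] (T : E →ₗ[ℝ] F) {V : Set F}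
    (hV : V ∈ 𝓝 (0 : F)) : closure (T ⁻¹' V) ∈ 𝓝 (0 : E) := by
  obtain ⟨W, hW, hWV⟩ : ∃ W ∈ 𝓝 (0 : F), ∀ v ∈ W, ∀ w ∈ W, v - w ∈ V := by
    have h : Tendsto (fun p : F × F => p.1 - p.2) (𝓝 0 ×ˢ 𝓝 0) (𝓝 0) := by
      rw [← nhds_prod_eq]
      exact (continuous_sub.tendsto' _ _ (by simp))
    obtain ⟨W, hW, hs⟩ := mem_prod_same_iff.1 (h hV)
    exact ⟨W, hW, fun v hv w hw => hs (mk_mem_prod hv hw)⟩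
  have hcov : ⋃ m : ℕ, (fun x : E => (m + 1 : ℝ)⁻¹ • x) ⁻¹' closure (T ⁻¹' W) = univ := by
    refine eq_univ_of_forall fun x => ?_
    have h : Tendsto (fun m : ℕ => (m + 1 : ℝ)⁻¹ • T x) atTop (𝓝 0) := by
      have h1 : Tendsto (fun m : ℕ => (m + 1 : ℝ)⁻¹) atTop (𝓝 0) := by
        simpa using tendsto_one_div_add_atTop_nhds_zero_nat (𝕜 := ℝ)
      simpa using h1.smul_const (T x)
    obtain ⟨m, hm⟩ := (h.eventually hW).exists
    refine mem_iUnion.2 ⟨m, subset_closure ?_⟩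
    change T ((m + 1 : ℝ)⁻¹ • x) ∈ W
    rw [map_smul]
    exact hm
  obtain ⟨m, y, hy⟩ := nonempty_interior_of_iUnion_of_closed
    (fun m : ℕ => isClosed_closure.preimage (continuous_const_smul _)) hcov
  have hy' := mem_interior_iff_mem_nhds.1 hy
  have h0 : Tendsto (fun z : E => y + (m + 1 : ℝ) • z) (𝓝 0) (𝓝 y) := by
    have : Continuous fun z : E => y + (m + 1 : ℝ) • z := by fun_prop
    exact this.tendsto' _ _ (by simp)
  filter_upwards [h0 hy'] with z hz
  have h1 : (m + 1 : ℝ)⁻¹ • (y + (m + 1 : ℝ) • z) ∈ closure (T ⁻¹' W) := hz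
  have h2 : (m + 1 : ℝ)⁻¹ • y ∈ closure (T ⁻¹' W) :=
    mem_of_mem_nhds (x := y) hy'
  have hm : (m + 1 : ℝ) ≠ 0 := by positivity
  rw [smul_add, smul_smul, inv_mul_cancel₀ hm, one_smul] at h1
  have h3 := map_mem_closure₂ continuous_sub h1 h2 (u := T ⁻¹' V) fun a ha b hb => by
    simp only [mem_preimage, map_sub]
    exact hWV _ ha _ hb
  simpa using h3

/-- A closed graph theorem for completely metrizable topological vector spaces. -/
theorem continuous_of_seq_closed_graph [BaireSpace E] [FirstCountableTopology E]
    [UniformSpace F] [IsUniformAddGroup F] [ContinuousSMul ℝ F] [CompleteSpace F]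
    [FirstCountableTopology F] (T : E →ₗ[ℝ] F)
    (hT : ∀ (u : ℕ → E) (x : E) (y : F), Tendsto u atTop (𝓝 x) →
      Tendsto (fun m => T (u m)) atTop (𝓝 y) → y = T x) : Continuous T := by
  refine continuous_of_continuousAt_zero T ?_
  rw [ContinuousAt, map_zero]
  intro V hV
  obtain ⟨V', hV', hV'c, hV'V⟩ := exists_mem_nhds_isClosed_subset hV
  obtain ⟨B₀, hB₀, hB₀add⟩ := IsTopologicalAddGroup.exists_antitone_basis_nhds_zero F
  obtain ⟨U, hU, -⟩ := IsTopologicalAddGroup.exists_antitone_basis_nhds_zero E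
  obtain ⟨N, hN⟩ := hB₀.mem_iff.1 hV'
  -- The index shift puts `B 0` inside `V'`. The property `B (m + 1) + B (m + 1) ⊆ B m` makes the
  -- tails of the series below stay in `B m`.
  set B : ℕ → Set F := fun m => B₀ (N + m) with hBdef
  have hB : ∀ m, B m ∈ 𝓝 (0 : F) := fun m => hB₀.mem _
  have hBadd : ∀ m, ∀ v ∈ B (m + 1), ∀ w ∈ B (m + 1), v + w ∈ B m :=
    fun m v hv w hw => hB₀add (N + m) (add_mem_add hv hw)
  change T ⁻¹' V ∈ 𝓝 0
  refine mem_of_superset (closure_preimage_mem_nhds_zero T (hB 1)) fun x hx => hV'V ?_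
  -- Successive approximation: a piece `a` with small image is split off, leaving a remainder that
  -- is small in `E` and can be approximated again at the next scale.
  have step : ∀ m : ℕ, ∀ z ∈ closure (T ⁻¹' B (m + 1)), ∃ a, T a ∈ B (m + 1) ∧
      z - a ∈ closure (T ⁻¹' B (m + 2)) ∧ z - a ∈ U m := by
    intro m z hz
    have h0 : Tendsto (fun a : E => z - a) (𝓝 z) (𝓝 0) := by
      have : Continuous fun a : E => z - a := by fun_prop
      exact this.tendsto' _ _ (by simp)
    obtain ⟨a, ha, haT⟩ := mem_closure_iff_nhds.1 hz _
      (h0 (inter_mem (closure_preimage_mem_nhds_zero T (hB (m + 2))) (hU.mem m)))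
    exact ⟨a, haT, ha.1, ha.2⟩
  choose! a ha1 ha2 ha3 using step
  let r : ℕ → E := fun m => Nat.rec x (fun m z => z - a m z) m
  have hr : ∀ m, r m ∈ closure (T ⁻¹' B (m + 1)) := by
    intro m
    induction m with
    | zero => exact hx
    | succ m ih => exact ha2 m _ ih
  have hrsum : ∀ m, ∑ i ∈ Finset.range m, a i (r i) = x - r m := by
    intro m
    induction m with
    | zero => simp [r]
    | succ m ih =>
      rw [Finset.sum_range_succ, ih]
      change _ = x - (r m - a m (r m))
      abel
  have hr0 : Tendsto r atTop (𝓝 0) := by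
    rw [← tendsto_add_atTop_iff_nat 1]
    exact hU.tendsto fun m => ha3 m _ (hr m)
  have hsum : ∀ d m, ∑ i ∈ Finset.range d, T (a (m + i) (r (m + i))) ∈ B m := by
    intro d
    induction d with
    | zero => exact fun m => mem_of_mem_nhds (hB m)
    | succ d ih =>
      intro m
      rw [Finset.sum_range_succ']
      refine hBadd m _ ?_ _ (ha1 m _ (hr m))
      have := ih (m + 1)
      simpa only [add_assoc, add_comm 1] using this
  set S : ℕ → F := fun m => ∑ i ∈ Finset.range m, T (a i (r i)) with hS
  have hSdiff : ∀ m d, S (m + d) - S m ∈ B m := by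
    intro m d
    rw [hS]
    simp only [Finset.sum_range_add, add_sub_cancel_left]
    exact hsum d m
  have hcauchy : CauchySeq S := by
    rw [hB₀.toHasBasis.uniformity_of_nhds_zero_swapped.cauchySeq_iff']
    intro i _
    refine ⟨i, fun m hm => ?_⟩
    obtain ⟨d, rfl⟩ := Nat.exists_eq_add_of_le hm
    have h1 : S (i + d) - S i ∈ B₀ i := hB₀.antitone (Nat.le_add_left i N) (hSdiff i d)
    exact h1
  obtain ⟨y, hy⟩ := cauchySeq_tendsto_of_complete hcauchy
  have hyV : y ∈ V' := hV'c.mem_of_tendsto hy (Eventually.of_forall fun m => hN (by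
    have := hSdiff 0 m
    simpa [hS, hBdef] using this))
  have hlim : Tendsto (fun m => x - r m) atTop (𝓝 x) := by
    simpa using tendsto_const_nhds.sub hr0
  -- The partial sums tend to `x` and their images tend to `y` in `V'`. The closed graph forces `y =
  -- T x`.
  have := hT _ x y hlim (hy.congr fun m => by rw [← hrsum, map_sum])
  change T x ∈ V'
  rwa [← this]

end ClosedGraph

/-! ## Limits of smooth functions -/

/-- At each order, locally uniform convergence of the next derivative permits exchanging limit and
differentiation, so the limits `G` are the successive derivatives of `G · 0`. This is the analytic
core of completeness of the space of sections. -/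
theorem hasFTaylorSeriesUpToOn_of_tendstoLocallyUniformlyOn {E F : Type*} [NormedAddCommGroup E]
    [NormedSpace ℝ E] [NormedAddCommGroup F] [NormedSpace ℝ F] {Ω : Set E} (hΩ : IsOpen Ω)
    {f : ℕ → E → F} (hf : ∀ m, ContDiffOn ℝ ∞ (f m) Ω) {G : E → FormalMultilinearSeries ℝ E F}
    (hG : ∀ j, TendstoLocallyUniformlyOn (fun m y => iteratedFDeriv ℝ j (f m) y)
      (fun y => G y j) atTop Ω) :
    HasFTaylorSeriesUpToOn ∞ (fun y => (G y 0).curry0) G Ω := by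
  have hd : ∀ j, ∀ x ∈ Ω, HasFDerivAt (fun y => G y j) (G x (j + 1)).curryLeft x := by
    intro j x hx
    refine hasFDerivAt_of_tendstoLocallyUniformlyOn (l := atTop)
      (f := fun m y => iteratedFDeriv ℝ j (f m) y)
      (f' := fun m y => (iteratedFDeriv ℝ (j + 1) (f m) y).curryLeft)
      (g' := fun y => (G y (j + 1)).curryLeft) hΩ ?_ ?_ ?_ hx
    · exact (continuousMultilinearCurryLeftEquiv ℝ (fun _ : Fin (j + 1) => E)
        F).isometry.uniformContinuous.comp_tendstoLocallyUniformlyOn (hG (j + 1))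
    · intro m y hy
      have h1 : DifferentiableAt ℝ (iteratedFDeriv ℝ j (f m)) y :=
        (((hf m).contDiffAt (hΩ.mem_nhds hy)).iteratedFDeriv_right (m := 1) (i := j)
          (mod_cast le_top)).differentiableAt (by simp)
      have h2 := h1.hasFDerivAt
      rwa [fderiv_iteratedFDeriv] at h2
    · exact fun y hy => (hG j).tendsto_at hy
  exact ⟨fun _ _ => rfl, fun j _ x hx => (hd j x hx).hasFDerivWithinAt,
    fun j _ x hx => (hd j x hx).continuousAt.continuousWithinAt⟩

/-! ## The sections form a Fréchet space -/

section Frechet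

variable (n : ℕ) {M : Type*} [TopologicalSpace M] [ChartedSpace (EuclideanSpace ℝ (Fin n)) M]
  [IsManifold (𝓡 n) ∞ M]
  (F : Type*) [NormedAddCommGroup F] [NormedSpace ℝ F]
  (V : M → Type*) [TopologicalSpace (TotalSpace F V)] [∀ x, AddCommGroup (V x)]
  [∀ x, Module ℝ (V x)] [∀ x, TopologicalSpace (V x)] [FiberBundle F V] [VectorBundle ℝ F V]
  [ContMDiffVectorBundle ∞ F V (𝓡 n)]

/-- The target of the map collecting the jets of a section in the charts at the points of `S`. -/
abbrev JetSpace (S : Set M) : Type _ :=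
  (p : S × ℕ) → (localDomain n F V p.1.1 →ᵤ[{K | IsCompact K}]
    ContinuousMultilinearMap ℝ (fun _ : Fin p.2 => EuclideanSpace ℝ (Fin n)) F)

/-- All the jets of a section in the charts at the points of `S`. -/
def jetMap (S : Set M) : Sections n F V →ₗ[ℝ] JetSpace n F V S where
  toFun s p := UniformOnFun.ofFun {K | IsCompact K} (jet p.1.1 p.2 s)
  map_add' s t := by
    funext p
    rw [map_add]
    rfl
  map_smul' c s := by
    funext p
    rw [map_smul]
    rfl

/-- The smooth sections with the uniform structure given by the charts at the points of `S`. -/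
def ChartSections (_S : Set M) : Type _ := Sections n F V

namespace ChartSections

variable (S : Set M)

instance : AddCommGroup (ChartSections n F V S) := inferInstanceAs (AddCommGroup (Sections n F V))

instance : Module ℝ (ChartSections n F V S) := inferInstanceAs (Module ℝ (Sections n F V))

/-- The jets as a map on `ChartSections`. -/
def toJets : ChartSections n F V S →ₗ[ℝ] JetSpace n F V S := jetMap n F V S

instance : UniformSpace (ChartSections n F V S) :=
  UniformSpace.comap (toJets n F V S) inferInstance

instance : IsUniformAddGroup (ChartSections n F V S) :=
  IsUniformAddGroup.comap (toJets n F V S)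

theorem isUniformInducing_toJets : IsUniformInducing (toJets n F V S) := ⟨rfl⟩

theorem topology_eq : (inferInstance : TopologicalSpace (ChartSections n F V S)) =
    ⨅ (p : S × ℕ), TopologicalSpace.induced
      (fun s => UniformOnFun.ofFun {K : Set (localDomain n F V p.1.1) | IsCompact K}
        (jet p.1.1 p.2 s)) inferInstance := by
  change TopologicalSpace.induced (toJets n F V S) Pi.topologicalSpace = _
  simp only [Pi.topologicalSpace, induced_iInf, induced_compose]
  rfl

instance : ContinuousSMul ℝ (ChartSections n F V S) := by
  have h : @ContinuousSMul ℝ (Sections n F V) _ _ (⨅ (p : S × ℕ), TopologicalSpace.induced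
      (fun s => UniformOnFun.ofFun {K : Set (localDomain n F V p.1.1) | IsCompact K}
        (jet p.1.1 p.2 s)) inferInstance) := by
    refine continuousSMul_iInf fun p => ?_
    let _ : TopologicalSpace (Sections n F V) := TopologicalSpace.induced
      (fun s => UniformOnFun.ofFun {K : Set (localDomain n F V p.1.1) | IsCompact K}
        (jet p.1.1 p.2 s)) inferInstance
    refine UniformOnFun.continuousSMul_induced_of_image_bounded ℝ _ _ _ (jet p.1.1 p.2) ⟨rfl⟩ ?_
    intro s K hK
    exact (IsCompact.image hK (continuous_jet p.1.1 p.2 s)).totallyBounded.isVonNBounded ℝ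
  exact Eq.mpr (congrArg (fun τ => @ContinuousSMul ℝ (Sections n F V) _ _ τ)
    (topology_eq n F V S)) h

instance (x₀ : M) : LocallyCompactSpace (localDomain n F V x₀) :=
  (isOpen_localDomain n F V x₀).locallyCompactSpace

instance isCountablyGenerated_uniformOnFun (x₀ : M) {B : Type*} [UniformSpace B]
    [(𝓤 B).IsCountablyGenerated] :
    (𝓤 (localDomain n F V x₀ →ᵤ[{K | IsCompact K}] B)).IsCountablyGenerated := by
  let E : CompactExhaustion (localDomain n F V x₀) := default
  exact UniformOnFun.isCountablyGenerated_uniformity {K | IsCompact K} (t := E)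
    E.isCompact (fun _ _ h => E.subset h) fun K hK => E.exists_superset_of_isCompact hK

instance isCountablyGenerated_uniformity [Countable S] :
    (𝓤 (ChartSections n F V S)).IsCountablyGenerated :=
  Filter.comap.isCountablyGenerated _ _

variable {n F V S}

theorem continuous_localRep (x₀ : S) {y : EuclideanSpace ℝ (Fin n)}
    (hy : y ∈ localDomain n F V x₀.1) :
    Continuous fun s : ChartSections n F V S => localRep x₀.1 (s : Sections n F V) y := by
  have h1 : Continuous fun s : ChartSections n F V S => toJets n F V S s (x₀, 0) :=
    (continuous_apply (x₀, 0)).comp (isUniformInducing_toJets n F V S).isInducing.continuous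
  have h2 := (UniformOnFun.uniformContinuous_eval_of_mem
    (ContinuousMultilinearMap ℝ (fun _ : Fin 0 => EuclideanSpace ℝ (Fin n)) F)
    {K : Set (localDomain n F V x₀.1) | IsCompact K} (mem_singleton (⟨y, hy⟩ :
      localDomain n F V x₀.1)) isCompact_singleton).continuous.comp h1
  have h3 : Continuous fun T : ContinuousMultilinearMap ℝ
      (fun _ : Fin 0 => EuclideanSpace ℝ (Fin n)) F => T ![] := continuous_eval_const _
  exact h3.comp h2

/-- The charts and trivializations at the points of `S` cover `M`. -/
def Covers (n : ℕ) {M : Type*} [TopologicalSpace M] [ChartedSpace (EuclideanSpace ℝ (Fin n)) M]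
    (F : Type*) [NormedAddCommGroup F] [NormedSpace ℝ F]
    (V : M → Type*) [TopologicalSpace (TotalSpace F V)] [∀ x, AddCommGroup (V x)]
    [∀ x, Module ℝ (V x)] [∀ x, TopologicalSpace (V x)] [FiberBundle F V]
    (S : Set M) : Prop :=
  ∀ x, ∃ x₀ ∈ S, x ∈ (chartAt (EuclideanSpace ℝ (Fin n)) x₀).source ∧
    x ∈ (trivializationAt F V x₀).baseSet

theorem mem_localDomain {x x₀ : M} (h : x ∈ (chartAt (EuclideanSpace ℝ (Fin n)) x₀).source)
    (h' : x ∈ (trivializationAt F V x₀).baseSet) :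
    extChartAt (𝓡 n) x₀ x ∈ localDomain n F V x₀ := by
  have hs : x ∈ (extChartAt (𝓡 n) x₀).source := by rwa [extChartAt_source]
  refine ⟨(extChartAt (𝓡 n) x₀).map_source hs, ?_⟩
  rwa [mem_preimage, (extChartAt (𝓡 n) x₀).left_inv hs]

theorem localRep_extChartAt {x x₀ : M}
    (h : x ∈ (chartAt (EuclideanSpace ℝ (Fin n)) x₀).source) (s : Sections n F V) :
    localRep x₀ s (extChartAt (𝓡 n) x₀ x) = (trivializationAt F V x₀ ⟨x, s x⟩).2 := by
  have hs : x ∈ (extChartAt (𝓡 n) x₀).source := by rwa [extChartAt_source]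
  rw [localRep, (extChartAt (𝓡 n) x₀).left_inv hs]

theorem eq_of_trivialization_eq {x x₀ : M} (h' : x ∈ (trivializationAt F V x₀).baseSet)
    {v w : V x} (h : (trivializationAt F V x₀ ⟨x, v⟩).2 = (trivializationAt F V x₀ ⟨x, w⟩).2) :
    v = w := by
  rw [← (trivializationAt F V x₀).symm_apply_apply_mk h' v, h,
    (trivializationAt F V x₀).symm_apply_apply_mk h' w]

theorem ext_of_localRep (hS : Covers n F V S) {s t : Sections n F V}
    (h : ∀ x₀ ∈ S, ∀ y ∈ localDomain n F V x₀, localRep x₀ s y = localRep x₀ t y) : s = t := by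
  refine ContMDiffSection.ext fun x => ?_
  obtain ⟨x₀, hx₀, hx, hx'⟩ := hS x
  have h1 := h x₀ hx₀ _ (mem_localDomain hx hx')
  rw [localRep_extChartAt hx, localRep_extChartAt hx] at h1
  exact eq_of_trivialization_eq hx' h1

theorem t2Space (hS : Covers n F V S) : T2Space (ChartSections n F V S) := by
  refine T2Space.of_injective_continuous (f := fun (s : ChartSections n F V S)
    (p : (x₀ : S) × localDomain n F V x₀.1) => localRep p.1.1 (s : Sections n F V) p.2.1) ?_ ?_
  · exact fun s t hst => ext_of_localRep hS fun x₀ hx₀ y hy =>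
      congrFun hst ⟨⟨x₀, hx₀⟩, ⟨y, hy⟩⟩
  · exact continuous_pi fun p => continuous_localRep p.1 p.2.2

variable (n F V S) in
-- Countability of `S` makes the jet space first countable, so sequences suffice. Limits of jets are
-- jets of local limits, and these glue to a section because the transition maps are continuous.
theorem isClosed_range_toJets [Countable S] (hS : Covers n F V S) :
    IsClosed (range (toJets n F V S)) := by
  have hcg : (𝓤 (JetSpace n F V S)).IsCountablyGenerated := inferInstance
  have hfc : FirstCountableTopology (JetSpace n F V S) :=
    @UniformSpace.firstCountableTopology _ _ hcg
  have hfu : FrechetUrysohnSpace (JetSpace n F V S) :=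
    @FirstCountableTopology.frechetUrysohnSpace _ _ hfc
  have hss : SequentialSpace (JetSpace n F V S) :=
    @FrechetUrysohnSpace.to_sequentialSpace _ _ hfu
  refine @IsSeqClosed.isClosed _ _ hss _ ?_
  intro u G hu hG
  have hu' : ∀ m, ∃ s : Sections n F V, toJets n F V S s = u m := hu
  choose s hs using hu'
  obtain rfl : (fun m => toJets n F V S (s m)) = u := funext hs
  rw [tendsto_pi_nhds] at hG
  -- The limit jets are extended by zero outside the chart domain; all later statements are
  -- restricted to that domain.
  let G' : S → EuclideanSpace ℝ (Fin n) → FormalMultilinearSeries ℝ (EuclideanSpace ℝ (Fin n)) F :=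
    fun x₀ y j => open Classical in
      if hy : y ∈ localDomain n F V x₀.1 then UniformOnFun.toFun _ (G (x₀, j)) ⟨y, hy⟩ else 0
  have hG' : ∀ (x₀ : S) j, TendstoLocallyUniformlyOn
      (fun m y => iteratedFDeriv ℝ j (localRep x₀.1 (s m)) y)
      (fun y => G' x₀ y j) atTop (localDomain n F V x₀.1) := by
    intro x₀ j
    rw [tendstoLocallyUniformlyOn_iff_forall_isCompact (isOpen_localDomain n F V x₀.1)]
    intro K hK hKc U hU
    have h := UniformOnFun.tendsto_iff_tendstoUniformlyOn.1 (hG (x₀, j)) (Subtype.val ⁻¹' K)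
      ((Topology.IsInducing.subtypeVal.isCompact_preimage_iff (by
        rwa [Subtype.range_coe])).2 hKc) U hU
    filter_upwards [h] with m hm y hy
    have h1 := hm ⟨y, hK hy⟩ hy
    have h2 : G' x₀ y j = UniformOnFun.toFun _ (G (x₀, j)) ⟨y, hK hy⟩ := dif_pos (hK hy)
    change (G' x₀ y j, _) ∈ U
    rw [h2]
    exact h1
  have hT : ∀ x₀ : S, HasFTaylorSeriesUpToOn ∞ (fun y => (G' x₀ y 0).curry0) (G' x₀)
      (localDomain n F V x₀.1) := fun x₀ =>
    hasFTaylorSeriesUpToOn_of_tendstoLocallyUniformlyOn (isOpen_localDomain n F V x₀.1)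
      (fun m => contDiffOn_localRep x₀.1 (s m)) (hG' x₀)
  set f : S → EuclideanSpace ℝ (Fin n) → F := fun x₀ y => (G' x₀ y 0).curry0 with hf
  have hlim : ∀ (x₀ : S), ∀ y ∈ localDomain n F V x₀.1,
      Tendsto (fun m => localRep x₀.1 (s m) y) atTop (𝓝 (f x₀ y)) := by
    intro x₀ y hy
    have h3 : Continuous fun T : ContinuousMultilinearMap ℝ
      (fun _ : Fin 0 => EuclideanSpace ℝ (Fin n)) F => T 0 := continuous_eval_const _
    exact (h3.tendsto _).comp ((hG' x₀ 0).tendsto_at hy)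
  choose c hcS hc hc' using hS
  let v : ∀ x, V x := fun x => (trivializationAt F V (c x)).symm x
    (f ⟨c x, hcS x⟩ (extChartAt (𝓡 n) (c x) x))
  -- The section was defined through one chosen chart at each point. Uniqueness of limits shows that
  -- every other chart of `S` sees the same value.
  have hv : ∀ (x₀ : S) (x : M), x ∈ (chartAt (EuclideanSpace ℝ (Fin n)) x₀.1).source →
      x ∈ (trivializationAt F V x₀.1).baseSet →
      (trivializationAt F V x₀.1 ⟨x, v x⟩).2 = f x₀ (extChartAt (𝓡 n) x₀.1 x) := by
    intro x₀ x h h'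
    have hmem : x ∈ (trivializationAt F V (c x)).baseSet ∩ (trivializationAt F V x₀.1).baseSet :=
      ⟨hc' x, h'⟩
    have h1 := hlim ⟨c x, hcS x⟩ _ (mem_localDomain (hc x) (hc' x))
    have h2 := hlim x₀ _ (mem_localDomain h h')
    have h3 := (((trivializationAt F V (c x)).coordChangeL ℝ (trivializationAt F V x₀.1)
      x).continuous.tendsto _).comp h1
    refine tendsto_nhds_unique ?_ h2
    rw [Trivialization.coordChangeL_apply _ _ hmem] at h3
    refine h3.congr fun m => ?_
    rw [Function.comp_apply, Trivialization.coordChangeL_apply _ _ hmem,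
      localRep_extChartAt (hc x), localRep_extChartAt h,
      (trivializationAt F V (c x)).symm_apply_apply_mk (hc' x)]
  have hsmooth : ContMDiff (𝓡 n) ((𝓡 n).prod 𝓘(ℝ, F)) ∞
      (fun x => TotalSpace.mk' F x (v x)) := by
    intro x
    rw [(trivializationAt F V (c x)).contMDiffAt_section_iff (hc' x)]
    have h1 : ContMDiffAt 𝓘(ℝ, EuclideanSpace ℝ (Fin n)) 𝓘(ℝ, F) ∞ (f ⟨c x, hcS x⟩)
        (extChartAt (𝓡 n) (c x) x) :=
      ((hT ⟨c x, hcS x⟩).contDiffOn.contDiffAt ((isOpen_localDomain n F V (c x)).mem_nhds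
        (mem_localDomain (hc x) (hc' x)))).contMDiffAt
    have h2 : ContMDiffAt (𝓡 n) 𝓘(ℝ, EuclideanSpace ℝ (Fin n)) ∞ (extChartAt (𝓡 n) (c x)) x :=
      contMDiffAt_extChartAt' (hc x)
    refine (h1.comp x h2).congr_of_eventuallyEq ?_
    filter_upwards [(chartAt (EuclideanSpace ℝ (Fin n)) (c x)).open_source.mem_nhds (hc x),
      (trivializationAt F V (c x)).open_baseSet.mem_nhds (hc' x)] with z hz hz'
    exact hv ⟨c x, hcS x⟩ z hz hz'
  refine ⟨(⟨v, hsmooth⟩ : Sections n F V), ?_⟩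
  funext p
  refine (UniformOnFun.toFun {K | IsCompact K}).injective ?_
  funext y
  have hrep : localRep p.1.1 (⟨v, hsmooth⟩ : Sections n F V) =ᶠ[𝓝 (y : EuclideanSpace ℝ (Fin n))]
      f p.1 := by
    filter_upwards [(isOpen_localDomain n F V p.1.1).mem_nhds y.2] with z hz
    have hzs : (extChartAt (𝓡 n) p.1.1).symm z ∈
        (chartAt (EuclideanSpace ℝ (Fin n)) p.1.1).source := by
      rw [← extChartAt_source (𝓡 n)]
      exact (extChartAt (𝓡 n) p.1.1).map_target hz.1
    have := hv p.1 _ hzs hz.2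
    rw [(extChartAt (𝓡 n) p.1.1).right_inv hz.1] at this
    exact this
  change iteratedFDeriv ℝ p.2 (localRep p.1.1 (⟨v, hsmooth⟩ : Sections n F V)) y = _
  rw [(hrep.iteratedFDeriv ℝ p.2).self_of_nhds,
    ← iteratedFDerivWithin_of_isOpen p.2 (isOpen_localDomain n F V p.1.1) y.2,
    ← (hT p.1).eq_iteratedFDerivWithin_of_uniqueDiffOn (mod_cast le_top)
      (isOpen_localDomain n F V p.1.1).uniqueDiffOn y.2]
  exact dif_pos y.2

theorem completeSpace [CompleteSpace F] [Countable S] (hS : Covers n F V S) :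
    CompleteSpace (ChartSections n F V S) := by
  rw [completeSpace_iff_isComplete_range (isUniformInducing_toJets n F V S)]
  exact (isClosed_range_toJets n F V S hS).isComplete

variable (n F V) in
theorem exists_countable_covers [SecondCountableTopology M] :
    ∃ S : Set M, S.Countable ∧ Covers n F V S := by
  obtain ⟨S, hS, hcov⟩ := TopologicalSpace.countable_cover_nhds (α := M)
    (f := fun x => (chartAt (EuclideanSpace ℝ (Fin n)) x).source ∩
      (trivializationAt F V x).baseSet) fun x =>
    inter_mem (chart_source_mem_nhds _ x) ((trivializationAt F V x).open_baseSet.mem_nhds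
      (FiberBundle.mem_baseSet_trivializationAt F V x))
  refine ⟨S, hS, fun x => ?_⟩
  obtain ⟨x₀, hx₀, h⟩ := mem_iUnion₂.1 (hcov.symm ▸ mem_univ x)
  exact ⟨x₀, hx₀, h⟩

end ChartSections

end Frechet

/-! ### Countably many charts determine the topology of sections; Montel property. -/

section FrechetSections

variable {n : ℕ} {M : Type*} [TopologicalSpace M] [ChartedSpace (EuclideanSpace ℝ (Fin n)) M]
  [IsManifold (𝓡 n) ∞ M]
  {F : Type*} [NormedAddCommGroup F] [NormedSpace ℝ F]
  {V : M → Type*} [TopologicalSpace (TotalSpace F V)] [∀ x, AddCommGroup (V x)]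
  [∀ x, Module ℝ (V x)] [∀ x, TopologicalSpace (V x)] [FiberBundle F V] [VectorBundle ℝ F V]
  [ContMDiffVectorBundle ∞ F V (𝓡 n)]
  {F' : Type*} [NormedAddCommGroup F'] [NormedSpace ℝ F']
  {W : M → Type*} [TopologicalSpace (TotalSpace F' W)] [∀ x, AddCommGroup (W x)]
  [∀ x, Module ℝ (W x)] [∀ x, TopologicalSpace (W x)] [FiberBundle F' W] [VectorBundle ℝ F' W]
  [ContMDiffVectorBundle ∞ F' W (𝓡 n)]

theorem continuous_localRep (x₀ : M) {y : EuclideanSpace ℝ (Fin n)}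
    (hy : y ∈ localDomain n F V x₀) : Continuous fun s : Sections n F V => localRep x₀ s y := by
  have h1 : Continuous fun s : Sections n F V =>
      UniformOnFun.ofFun {K : Set (localDomain n F V x₀) | IsCompact K} (jet x₀ 0 s) :=
    continuous_iInf_dom (i := x₀) (continuous_iInf_dom (i := 0) continuous_induced_dom)
  have h2 := (UniformOnFun.uniformContinuous_eval_of_mem
    (ContinuousMultilinearMap ℝ (fun _ : Fin 0 => EuclideanSpace ℝ (Fin n)) F)
    {K : Set (localDomain n F V x₀) | IsCompact K} (mem_singleton (⟨y, hy⟩ :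
      localDomain n F V x₀)) isCompact_singleton).continuous.comp h1
  have h3 : Continuous fun T : ContinuousMultilinearMap ℝ
      (fun _ : Fin 0 => EuclideanSpace ℝ (Fin n)) F => T ![] := continuous_eval_const _
  exact h3.comp h2

theorem chartSections_topology_ge (S : Set M) : sectionsTopology ≤
    (inferInstance : TopologicalSpace (ChartSections n F V S)) := by
  rw [ChartSections.topology_eq]
  exact le_iInf fun p => (iInf_le _ p.1.1).trans (iInf_le _ p.2)

/-- Both topologies are complete and metrizable, and point evaluations are continuous for both, so
the identity has closed graph and is continuous. This replaces estimates for coordinate changes, and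
adding one chart at a time gives equality with the topology defined by all charts. -/
theorem chartSections_topology_le_insert [CompleteSpace F] {S : Set M} [Countable S]
    (hS : ChartSections.Covers n F V S) (x₁ : M) :
    (inferInstance : TopologicalSpace (ChartSections n F V S)) ≤
      (inferInstance : TopologicalSpace (ChartSections n F V (insert x₁ S))) := by
  have hS' : ChartSections.Covers n F V (insert x₁ S) := fun x => by
    obtain ⟨x₀, h, h'⟩ := hS x
    exact ⟨x₀, Or.inr h, h'⟩
  have hc1 : Countable ↑(insert x₁ S) := (Set.countable_coe_iff.1 ‹_›).insert x₁
  have := ChartSections.completeSpace hS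
  have := ChartSections.completeSpace hS'
  have := ChartSections.isCountablyGenerated_uniformity n F V S
  have := ChartSections.isCountablyGenerated_uniformity n F V (insert x₁ S)
  have : FirstCountableTopology (ChartSections n F V S) := UniformSpace.firstCountableTopology _
  have : FirstCountableTopology (ChartSections n F V (insert x₁ S)) :=
    UniformSpace.firstCountableTopology _
  have : BaireSpace (ChartSections n F V S) :=
    have : TopologicalSpace.IsCompletelyPseudoMetrizableSpace (ChartSections n F V S) :=
      inferInstance
    inferInstance
  let T : ChartSections n F V S →ₗ[ℝ] ChartSections n F V (insert x₁ S) :=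
    (LinearMap.id : Sections n F V →ₗ[ℝ] Sections n F V)
  have hT : Continuous T := by
    refine continuous_of_seq_closed_graph T fun u s t hs ht => ?_
    refine ChartSections.ext_of_localRep hS fun x₀ hx₀ y hy => ?_
    exact tendsto_nhds_unique
      (((ChartSections.continuous_localRep (S := insert x₁ S) ⟨x₀, Or.inr hx₀⟩ hy).tendsto _).comp
        ht) (((ChartSections.continuous_localRep (S := S) ⟨x₀, hx₀⟩ hy).tendsto _).comp hs)
  exact continuous_id_iff_le.1 hT

theorem chartSections_topology_eq [CompleteSpace F] {S : Set M} [Countable S]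
    (hS : ChartSections.Covers n F V S) :
    (inferInstance : TopologicalSpace (ChartSections n F V S)) = sectionsTopology := by
  refine le_antisymm (le_iInf fun x₁ => le_iInf fun j => ?_) (chartSections_topology_ge S)
  refine (chartSections_topology_le_insert hS x₁).trans ?_
  rw [ChartSections.topology_eq]
  exact iInf_le _ (⟨⟨x₁, mem_insert x₁ S⟩, j⟩ : ↑(insert x₁ S) × ℕ)

section SecondCountable

variable [SecondCountableTopology M]

instance [CompleteSpace F] : FirstCountableTopology (Sections n F V) := by
  obtain ⟨S, hSc, hS⟩ := ChartSections.exists_countable_covers n F V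
  have := hSc.to_subtype
  have := ChartSections.isCountablyGenerated_uniformity n F V S
  have h : FirstCountableTopology (ChartSections n F V S) := UniformSpace.firstCountableTopology _
  have h' := chartSections_topology_eq hS
  exact Eq.mp (congrArg (fun τ => @FirstCountableTopology (Sections n F V) τ) h') h

instance [CompleteSpace F] : T2Space (Sections n F V) := by
  obtain ⟨S, hSc, hS⟩ := ChartSections.exists_countable_covers n F V
  have := hSc.to_subtype
  have h := ChartSections.t2Space hS
  have h' := chartSections_topology_eq hS
  exact Eq.mp (congrArg (fun τ => @T2Space (Sections n F V) τ) h') h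

/-- The closed graph theorem for linear maps between spaces of smooth sections. -/
theorem sections_continuous_of_closed_graph [CompleteSpace F] [CompleteSpace F']
    (T : Sections n F V →ₗ[ℝ] Sections n F' W)
    (hT : ∀ (u : ℕ → Sections n F V) (s : Sections n F V) (t : Sections n F' W),
      Tendsto u atTop (𝓝 s) → Tendsto (fun m => T (u m)) atTop (𝓝 t) → t = T s) :
    Continuous T := by
  obtain ⟨S, hSc, hS⟩ := ChartSections.exists_countable_covers n F V
  obtain ⟨S', hSc', hS'⟩ := ChartSections.exists_countable_covers n F' W
  have := hSc.to_subtype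
  have := hSc'.to_subtype
  have h1 := chartSections_topology_eq hS
  have h2 := chartSections_topology_eq hS'
  have := ChartSections.completeSpace hS
  have := ChartSections.completeSpace hS'
  have := ChartSections.isCountablyGenerated_uniformity n F V S
  have := ChartSections.isCountablyGenerated_uniformity n F' W S'
  have : FirstCountableTopology (ChartSections n F V S) := UniformSpace.firstCountableTopology _
  have : FirstCountableTopology (ChartSections n F' W S') := UniformSpace.firstCountableTopology _
  have : BaireSpace (ChartSections n F V S) :=
    have : TopologicalSpace.IsCompletelyPseudoMetrizableSpace (ChartSections n F V S) :=
      inferInstance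
    inferInstance
  let T' : ChartSections n F V S →ₗ[ℝ] ChartSections n F' W S' := T
  have hT' : Continuous T' := by
    refine continuous_of_seq_closed_graph T' fun u s t hs ht => hT u s t ?_ ?_
    · exact Eq.mp (congrArg (fun τ => Tendsto u atTop (@nhds (Sections n F V) τ s)) h1) hs
    · exact Eq.mp (congrArg (fun τ => Tendsto (fun m => T (u m)) atTop
        (@nhds (Sections n F' W) τ t)) h2) ht
  have h3 := Eq.mp (congrArg (fun τ => @Continuous (Sections n F V) (Sections n F' W) τ
    (inferInstance : TopologicalSpace (ChartSections n F' W S')) T) h1) hT'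
  exact Eq.mp (congrArg (fun τ => @Continuous (Sections n F V) (Sections n F' W) _ τ T) h2) h3

end SecondCountable

/-! ### Bounded sets of sections -/

theorem exists_bound_jet {B : Set (Sections n F V)} (hB : Bornology.IsVonNBounded ℝ B) (x₀ : M)
    (j : ℕ) {K : Set (localDomain n F V x₀)} (hK : IsCompact K) :
    ∃ R, ∀ s ∈ B, ∀ y ∈ K, ‖jet x₀ j s y‖ ≤ R := by
  have h1 : Continuous fun s : Sections n F V =>
      UniformOnFun.ofFun {K : Set (localDomain n F V x₀) | IsCompact K} (jet x₀ j s) :=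
    continuous_iInf_dom (i := x₀) (continuous_iInf_dom (i := j) continuous_induced_dom)
  have h2 : {s : Sections n F V | ∀ y ∈ K, ‖jet x₀ j s y‖ < 1} ∈ 𝓝 (0 : Sections n F V) := by
    have h3 := (h1.tendsto 0) (UniformOnFun.gen_mem_nhds _ {K | IsCompact K} _ hK
      (Metric.dist_mem_uniformity zero_lt_one))
    refine mem_of_superset h3 fun s hs y hy => ?_
    have h4 := hs y hy
    simp only [map_zero] at h4
    change dist (0 : ContinuousMultilinearMap ℝ (fun _ : Fin j => EuclideanSpace ℝ (Fin n)) F)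
      (jet x₀ j s y) < 1 at h4
    rwa [dist_zero_left] at h4
  obtain ⟨r, hr⟩ := (hB h2).exists_pos
  refine ⟨r, fun s hs y hy => ?_⟩
  obtain ⟨v, hv, rfl⟩ := hr.2 r (by rw [Real.norm_of_nonneg hr.1.le]) hs
  have h5 := hv y hy
  change ‖jet x₀ j (r • v) y‖ ≤ r
  rw [map_smul, Pi.smul_apply, norm_smul, Real.norm_of_nonneg hr.1.le]
  exact (mul_le_mul_of_nonneg_left h5.le hr.1.le).trans (mul_one r).le

/-- The bound on the jets of order `j + 1` over a closed ball is a common Lipschitz constant for the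
jets of order `j`. -/
theorem equicontinuous_jet {B : Set (Sections n F V)} (hB : Bornology.IsVonNBounded ℝ B) (x₀ : M)
    (j : ℕ) : Equicontinuous fun (s : B) => jet x₀ j (s : Sections n F V) := by
  intro y₀
  obtain ⟨ρ, hρ, hball⟩ := Metric.nhds_basis_closedBall.mem_iff.1
    ((isOpen_localDomain n F V x₀).mem_nhds y₀.2)
  obtain ⟨R, hR⟩ := exists_bound_jet hB x₀ (j + 1) (K := Subtype.val ⁻¹'
    Metric.closedBall (y₀ : EuclideanSpace ℝ (Fin n)) ρ)
    ((Topology.IsInducing.subtypeVal.isCompact_preimage_iff (by rwa [Subtype.range_coe])).2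
      (isCompact_closedBall _ _))
  have hlip : ∀ (s : B) (y : localDomain n F V x₀), (y : EuclideanSpace ℝ (Fin n)) ∈
      Metric.closedBall (y₀ : EuclideanSpace ℝ (Fin n)) ρ →
      ‖jet x₀ j (s : Sections n F V) y - jet x₀ j (s : Sections n F V) y₀‖ ≤
        R * ‖(y : EuclideanSpace ℝ (Fin n)) - y₀‖ := by
    intro s y hy
    refine (convex_closedBall (y₀ : EuclideanSpace ℝ (Fin n)) ρ).norm_image_sub_le_of_norm_fderiv_le
      (𝕜 := ℝ) (f := iteratedFDeriv ℝ j (localRep x₀ (s : Sections n F V))) (C := R) ?_ ?_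
      (Metric.mem_closedBall_self hρ.le) hy
    · intro z hz
      exact ((contDiffAt_localRep x₀ (s : Sections n F V) (hball hz)).iteratedFDeriv_right (m := 1)
        (i := j) (mod_cast le_top)).differentiableAt (by simp)
    · intro z hz
      rw [norm_fderiv_iteratedFDeriv]
      exact hR s s.2 ⟨z, hball hz⟩ hz
  rw [Metric.equicontinuousAt_iff_right]
  intro ε hε
  have hcont : Continuous fun y : localDomain n F V x₀ =>
      R * ‖(y : EuclideanSpace ℝ (Fin n)) - y₀‖ := by fun_prop
  have h0 : Tendsto (fun y : localDomain n F V x₀ => R * ‖(y : EuclideanSpace ℝ (Fin n)) - y₀‖)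
      (𝓝 y₀) (𝓝 0) := hcont.tendsto' _ _ (by simp)
  filter_upwards [continuous_subtype_val.continuousAt.eventually (Metric.closedBall_mem_nhds
    (y₀ : EuclideanSpace ℝ (Fin n)) hρ), h0.eventually (Iio_mem_nhds hε)] with y hy hy' s
  rw [dist_comm, dist_eq_norm]
  exact (hlip s y hy).trans_lt hy'

instance finiteDimensional_continuousMultilinearMap {ι E : Type*} [Fintype ι]
    [NormedAddCommGroup E] [NormedSpace ℝ E] [FiniteDimensional ℝ E] [FiniteDimensional ℝ F] :
    FiniteDimensional ℝ (ContinuousMultilinearMap ℝ (fun _ : ι => E) F) :=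
  Module.Finite.of_injective
    (ContinuousMultilinearMap.toMultilinearMapLinear : _ →ₗ[ℝ] MultilinearMap ℝ (fun _ : ι => E) F)
    ContinuousMultilinearMap.toMultilinearMap_injective

/-- This is an Ascoli argument. On an equicontinuous family the uniformities of compact and of
pointwise convergence agree. The pointwise values lie in balls of finite-dimensional spaces, so
Tychonoff applies. -/
theorem totallyBounded_chartSections [FiniteDimensional ℝ F] {B : Set (Sections n F V)}
    (hB : Bornology.IsVonNBounded ℝ B) (S : Set M) :
    TotallyBounded (α := ChartSections n F V S) B := by
  let Φ : B → ChartSections n F V S := fun s => (s : Sections n F V)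
  let Ψ : B → (p : S × ℕ) → (⋃₀ {K : Set (localDomain n F V p.1.1) | IsCompact K}) →
      ContinuousMultilinearMap ℝ (fun _ : Fin p.2 => EuclideanSpace ℝ (Fin n)) F :=
    fun s p y => jet p.1.1 p.2 (s : Sections n F V) y
  have hΨ : UniformSpace.comap Φ inferInstance = UniformSpace.comap Ψ inferInstance := by
    change UniformSpace.comap Φ (UniformSpace.comap _ (Pi.uniformSpace _)) =
      UniformSpace.comap Ψ (Pi.uniformSpace _)
    rw [← UniformSpace.comap_comap, Pi.uniformSpace_eq, Pi.uniformSpace_eq, UniformSpace.comap_iInf,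
      UniformSpace.comap_iInf]
    refine iInf_congr fun p => ?_
    rw [← UniformSpace.comap_comap, ← UniformSpace.comap_comap]
    exact EquicontinuousOn.comap_uniformOnFun_eq
      (F := fun s : B => jet p.1.1 p.2 (s : Sections n F V)) (fun K hK => hK)
      fun K _ => (equicontinuous_jet hB p.1.1 p.2).equicontinuousOn K
  have hrange : TotallyBounded (range Ψ) := by
    choose R hR using fun (p : S × ℕ) (y : localDomain n F V p.1.1) =>
      exists_bound_jet hB p.1.1 p.2 (isCompact_singleton (x := y))
    have hc : IsCompact (univ.pi fun p : S × ℕ => univ.pi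
        fun y : (⋃₀ {K : Set (localDomain n F V p.1.1) | IsCompact K}) =>
          Metric.closedBall (0 : ContinuousMultilinearMap ℝ
            (fun _ : Fin p.2 => EuclideanSpace ℝ (Fin n)) F) (R p y)) :=
      isCompact_univ_pi fun p => isCompact_univ_pi fun y => by
        have := FiniteDimensional.proper ℝ (ContinuousMultilinearMap ℝ
            (fun _ : Fin p.2 => EuclideanSpace ℝ (Fin n)) F)
        exact isCompact_closedBall _ _
    refine hc.totallyBounded.subset ?_
    rintro _ ⟨s, rfl⟩ p - y -
    exact mem_closedBall_zero_iff.2 (hR p y s s.2 y rfl)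
  let _ : UniformSpace B := UniformSpace.comap Φ inferInstance
  have h1 : IsUniformInducing Φ := ⟨rfl⟩
  have h2 : IsUniformInducing Ψ := ⟨congrArg (fun u : UniformSpace B => u.uniformity) hΨ.symm⟩
  rw [← image_univ, totallyBounded_image_iff h2] at hrange
  have h3 := (totallyBounded_image_iff h1).2 hrange
  rw [image_univ] at h3
  have h4 : @LE.le (Set (ChartSections n F V S)) _ B (range Φ) := fun s hs => ⟨⟨s, hs⟩, rfl⟩
  exact TotallyBounded.subset (α := ChartSections n F V S) h4 h3

/-- This is where finite rank matters: bounded sets of arguments can be replaced by compact ones, on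
which joint continuity yields uniform convergence. -/
instance [SecondCountableTopology M] [FiniteDimensional ℝ F] : MontelSpace ℝ (Sections n F V) where
  heine_borel B hBc hB := by
    have := FiniteDimensional.complete ℝ F
    obtain ⟨S, hSc, hS⟩ := ChartSections.exists_countable_covers n F V
    have := hSc.to_subtype
    have h1 := chartSections_topology_eq hS
    have := ChartSections.completeSpace hS
    have hB' : TotallyBounded (α := ChartSections n F V S) B := totallyBounded_chartSections hB S
    have h2 : IsCompact (@closure (ChartSections n F V S) _ B) :=
      isCompact_iff_totallyBounded_isComplete.2 ⟨hB'.closure, isClosed_closure.isComplete⟩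
    have h3 : @IsCompact (Sections n F V) sectionsTopology
        (@closure (Sections n F V) sectionsTopology B) :=
      Eq.mp (congrArg (fun τ : TopologicalSpace (Sections n F V) =>
        @IsCompact (Sections n F V) τ (@closure (Sections n F V) τ B)) h1) h2
    rwa [hBc.closure_eq] at h3

/-! ### Evaluation at points -/

/-- The value of a section at a point, in the preferred trivialization. -/
def evalAt (x : M) (s : Sections n F V) : F := (trivializationAt F V x ⟨x, s x⟩).2

theorem evalAt_eq_localRep (x : M) (s : Sections n F V) :
    evalAt x s = localRep x s (extChartAt (𝓡 n) x x) :=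
  (ChartSections.localRep_extChartAt (mem_chart_source _ x) s).symm

theorem continuous_evalAt (x : M) : Continuous (evalAt x : Sections n F V → F) := by
  rw [show (evalAt x : Sections n F V → F) = _ from funext (evalAt_eq_localRep x)]
  exact continuous_localRep x (ChartSections.mem_localDomain (mem_chart_source _ x)
    (FiberBundle.mem_baseSet_trivializationAt F V x))

theorem evalAt_inj {x : M} {s t : Sections n F V} : evalAt x s = evalAt x t ↔ s x = t x :=
  ⟨fun h => ChartSections.eq_of_trivialization_eq
    (FiberBundle.mem_baseSet_trivializationAt F V x) h, fun h => by rw [evalAt, h, evalAt]⟩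

theorem isClosed_eqOn_sections (A : Set M) (s : Sections n F V) :
    IsClosed {t : Sections n F V | ∀ x ∈ A, t x = s x} := by
  have h : {t : Sections n F V | ∀ x ∈ A, t x = s x} =
      ⋂ x ∈ A, {t : Sections n F V | evalAt x t = evalAt x s} := by
    ext t
    simp [evalAt_inj]
  rw [h]
  exact isClosed_biInter fun x _ => isClosed_eq (continuous_evalAt x) continuous_const

end FrechetSections

/-! ## Bastiani calculus for maps with values in alternating forms -/

section ScalarCalculus

variable {A : Type*} [AddCommGroup A] [Module ℝ A] [TopologicalSpace A]
  [IsTopologicalAddGroup A] [ContinuousSMul ℝ A]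

theorem hasDerivAt_line {G : A → ℂ} {φ χ : A} {d : ℂ} {s : ℝ}
    (h : Tendsto (fun t : ℝ => t⁻¹ • (G (φ + s • χ + t • χ) - G (φ + s • χ))) (𝓝[≠] 0) (𝓝 d)) :
    HasDerivAt (fun t : ℝ => G (φ + t • χ)) d s := by
  rw [hasDerivAt_iff_tendsto_slope_zero]
  refine h.congr fun t => ?_
  rw [add_smul, add_assoc]

variable {G : A → ℂ} {dG : A → A → ℂ}

theorem dirDeriv_scalar_smul
    (hd : ∀ φ χ, Tendsto (fun t : ℝ => t⁻¹ • (G (φ + t • χ) - G φ)) (𝓝[≠] 0) (𝓝 (dG φ χ)))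
    (φ : A) (c : ℝ) (χ : A) : dG φ (c • χ) = c • dG φ χ := by
  have h1 : HasDerivAt (fun t : ℝ => G (φ + t • (c • χ))) (dG φ (c • χ)) 0 :=
    hasDerivAt_line (by simpa using hd φ (c • χ))
  have h2 : HasDerivAt (fun t : ℝ => G (φ + t • χ)) (dG φ χ) (c * 0) :=
    hasDerivAt_line (by simpa using hd φ χ)
  have h3 := HasDerivAt.scomp (0 : ℝ) h2 ((hasDerivAt_id (0 : ℝ)).const_mul c)
  rw [mul_one] at h3
  refine h1.unique (h3.congr_of_eventuallyEq (Eventually.of_forall fun t => ?_))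
  simp [smul_smul, mul_comm]

theorem sub_eq_integral_line
    (hd : ∀ φ χ, Tendsto (fun t : ℝ => t⁻¹ • (G (φ + t • χ) - G φ)) (𝓝[≠] 0) (𝓝 (dG φ χ)))
    (hc : Continuous fun p : A × A => dG p.1 p.2) (φ χ : A) :
    G (φ + χ) - G φ = ∫ s in (0 : ℝ)..1, dG (φ + s • χ) χ := by
  have h1 : ∀ s ∈ uIcc (0 : ℝ) 1, HasDerivAt (fun t : ℝ => G (φ + t • χ)) (dG (φ + s • χ) χ) s :=
    fun s _ => hasDerivAt_line (hd (φ + s • χ) χ)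
  have h2 : Continuous fun s : ℝ => dG (φ + s • χ) χ :=
    hc.comp (f := fun s : ℝ => (φ + s • χ, χ)) (by fun_prop)
  rw [intervalIntegral.integral_eq_sub_of_hasDerivAt h1 (h2.intervalIntegrable 0 1)]
  simp

/-- The increment along `ψ + χ` is split at `φ + t ψ`. The second part is `t` times an average of
`dG · χ` near `φ`, which tends to `dG φ χ` by joint continuity. -/
theorem dirDeriv_scalar_add
    (hd : ∀ φ χ, Tendsto (fun t : ℝ => t⁻¹ • (G (φ + t • χ) - G φ)) (𝓝[≠] 0) (𝓝 (dG φ χ)))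
    (hc : Continuous fun p : A × A => dG p.1 p.2) (φ ψ χ : A) :
    dG φ (ψ + χ) = dG φ ψ + dG φ χ := by
  have hcont : Continuous fun t : ℝ => ∫ s in (0 : ℝ)..1, dG (φ + t • ψ + s • (t • χ)) χ := by
    refine intervalIntegral.continuous_parametric_intervalIntegral_of_continuous' ?_ 0 1
    exact hc.comp (f := fun p : ℝ × ℝ => (φ + p.1 • ψ + p.2 • (p.1 • χ), χ)) (by fun_prop)
  have h1 : Tendsto (fun t : ℝ => ∫ s in (0 : ℝ)..1, dG (φ + t • ψ + s • (t • χ)) χ) (𝓝[≠] 0)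
      (𝓝 (dG φ χ)) :=
    (hcont.tendsto' 0 _ (by simp)).mono_left nhdsWithin_le_nhds
  refine tendsto_nhds_unique (hd φ (ψ + χ)) (((hd φ ψ).add h1).congr' ?_)
  filter_upwards [self_mem_nhdsWithin] with t ht
  have h2 := sub_eq_integral_line hd hc (φ + t • ψ) (t • χ)
  simp only [dirDeriv_scalar_smul hd, intervalIntegral.integral_smul] at h2
  have h3 : ∫ s in (0 : ℝ)..1, dG (φ + t • ψ + s • t • χ) χ =
      t⁻¹ • (G (φ + t • ψ + t • χ) - G (φ + t • ψ)) := by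
    rw [h2, smul_smul, inv_mul_cancel₀ ht, one_smul]
  rw [h3, ← smul_add]
  congr 1
  rw [smul_add, add_assoc]
  ring

end ScalarCalculus

/-! ### Alternating forms under uniform convergence on bounded sets. -/

section AlternatingForms

variable {B : Type*} [AddCommGroup B] [Module ℝ B] [TopologicalSpace B]
  [IsTopologicalAddGroup B] [ContinuousSMul ℝ B] {k : ℕ}

theorem tendsto_alternating_iff {ι : Type*} {l : Filter ι} {T : ι → B [⋀^Fin k]→L[ℝ] ℂ}
    {T₀ : B [⋀^Fin k]→L[ℝ] ℂ} : Tendsto T l (𝓝 T₀) ↔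
      ∀ S : Set (Fin k → B), Bornology.IsVonNBounded ℝ S →
        TendstoUniformlyOn (fun i h => T i h) T₀ l S := by
  rw [ContinuousAlternatingMap.isEmbedding_toContinuousMultilinearMap.tendsto_nhds_iff,
    ContinuousMultilinearMap.isEmbedding_toUniformOnFun.tendsto_nhds_iff,
    UniformOnFun.tendsto_iff_tendstoUniformlyOn]
  rfl

theorem exists_isCompact_superset_of_isVonNBounded [T1Space B] [MontelSpace ℝ B] {S : Set (Fin k → B)}
    (hS : Bornology.IsVonNBounded ℝ S) : ∃ C, IsCompact C ∧ S ⊆ C := by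
  refine ⟨univ.pi fun i => closure (Function.eval i '' S), isCompact_univ_pi fun i => ?_, ?_⟩
  · refine MontelSpace.isCompact_of_isClosed_of_isVonNBounded ℝ isClosed_closure ?_
    exact (Bornology.isVonNBounded_pi_iff.1 hS i).closure
  · exact fun h hh i _ => subset_closure ⟨h, hh, rfl⟩

/-- Bounded sets of arguments lie in compact sets, over which a jointly continuous function varies
uniformly with its parameter. -/
theorem tendsto_alternating_of_continuous [T1Space B] [MontelSpace ℝ B] {X : Type*} [TopologicalSpace X]
    {d : X → (Fin k → B) → ℂ} (hd : Continuous fun p : X × (Fin k → B) => d p.1 p.2)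
    {x₀ : X} {l : Filter X} (hl : l ≤ 𝓝 x₀) {T : X → B [⋀^Fin k]→L[ℝ] ℂ}
    {T₀ : B [⋀^Fin k]→L[ℝ] ℂ} (hT : ∀ᶠ x in l, ∀ h, T x h = d x h) (hT₀ : ∀ h, T₀ h = d x₀ h) :
    Tendsto T l (𝓝 T₀) := by
  rw [tendsto_alternating_iff]
  intro S hS
  obtain ⟨C, hC, hSC⟩ := exists_isCompact_superset_of_isVonNBounded hS
  intro u hu
  obtain ⟨v, hv, hvu⟩ := hC.mem_uniformity_of_prod (f := d) (s := univ) (q := x₀)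
    hd.continuousOn (mem_univ x₀) (symm_le_uniformity hu)
  rw [nhdsWithin_univ] at hv
  filter_upwards [hl hv, hT] with x hx hTx h hh
  rw [hT₀ h, hTx h]
  exact hvu x hx h (hSC hh)

/-- First countability reduces the claim to sequences. A convergent sequence of arguments is
bounded, so convergence of the forms is uniform along it. -/
theorem continuous_alternating_eval [FirstCountableTopology B] {X : Type*} [TopologicalSpace X]
    [FirstCountableTopology X] {T : X → B [⋀^Fin k]→L[ℝ] ℂ} (hT : Continuous T) :
    Continuous fun p : X × (Fin k → B) => T p.1 p.2 := by
  rw [← continuousOn_univ, continuousOn_univ, continuous_iff_seqContinuous]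
  intro u p hu
  have h1 : Tendsto (fun m => T (u m).1) atTop (𝓝 (T p.1)) :=
    (hT.tendsto _).comp ((continuous_fst.tendsto _).comp hu)
  have h2 : Tendsto (fun m => (u m).2) atTop (𝓝 p.2) := (continuous_snd.tendsto _).comp hu
  have h3 := tendsto_alternating_iff.1 h1 _ (h2.isVonNBounded_range ℝ)
  have h4 : Tendsto (fun m => T p.1 (u m).2) atTop (𝓝 (T p.1 p.2)) :=
    ((T p.1).cont.tendsto _).comp h2
  rw [Metric.tendsto_atTop] at h4 ⊢
  intro ε hε
  obtain ⟨N, hN⟩ := h4 (ε / 2) (half_pos hε)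
  obtain ⟨N', hN'⟩ := eventually_atTop.1 (Metric.tendstoUniformlyOn_iff.1 h3 (ε / 2) (half_pos hε))
  refine ⟨max N N', fun m hm => ?_⟩
  have h5 := hN m (le_of_max_le_left hm)
  have h6 := hN' m (le_of_max_le_right hm) (u m).2 ⟨m, rfl⟩
  rw [dist_comm] at h6
  calc dist (T (u m).1 (u m).2) (T p.1 p.2)
      ≤ dist (T (u m).1 (u m).2) (T p.1 (u m).2) + dist (T p.1 (u m).2) (T p.1 p.2) :=
        dist_triangle _ _ _
    _ < ε / 2 + ε / 2 := add_lt_add h6 h5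
    _ = ε := add_halves ε

/-- The algebraic identities survive pointwise limits. Continuity of the limit does not, and is
therefore supplied separately. -/
theorem exists_alternating_of_tendsto {ι : Type*} {l : Filter ι} [l.NeBot]
    {L : ι → B [⋀^Fin k]→L[ℝ] ℂ} {d : (Fin k → B) → ℂ} (hd : Continuous d)
    (h : ∀ v, Tendsto (fun i => L i v) l (𝓝 (d v))) :
    ∃ T : B [⋀^Fin k]→L[ℝ] ℂ, ∀ v, T v = d v := by
  refine ⟨⟨⟨⟨d, ?_, ?_⟩, hd⟩, ?_⟩, fun v => rfl⟩
  · intro inst v i x y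
    refine tendsto_nhds_unique (h _) (((h _).add (h _)).congr fun j => ?_)
    exact ((L j).map_update_add v i x y).symm
  · intro inst v i c x
    refine tendsto_nhds_unique (h _) (((h _).const_smul c).congr fun j => ?_)
    exact ((L j).map_update_smul v i c x).symm
  · intro v i j hij hne
    refine tendsto_nhds_unique (h v) ((tendsto_const_nhds (x := (0 : ℂ))).congr fun m => ?_)
    exact ((L m).map_eq_zero_of_eq v hij hne).symm

variable {A : Type*} [AddCommGroup A] [Module ℝ A] [TopologicalSpace A]
  [IsTopologicalAddGroup A] [ContinuousSMul ℝ A]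

theorem continuous_snoc_right {X : Type*} [TopologicalSpace X] {m : ℕ} (ψ : Fin m → X) :
    Continuous fun χ : X => (Fin.snoc ψ χ : Fin (m + 1) → X) :=
  Continuous.finSnoc (A := fun _ => X) continuous_const continuous_id

theorem continuous_cons_left {X : Type*} [TopologicalSpace X] {m : ℕ} (ψ : Fin m → X) :
    Continuous fun χ : X => (Fin.cons χ ψ : Fin (m + 1) → X) :=
  Continuous.finCons (A := fun _ => X) continuous_id continuous_const

theorem cons_eq_snoc_fin_zero {X : Type*} (ψ : Fin 0 → X) (χ : X) :
    (Fin.cons χ ψ : Fin (0 + 1) → X) = Fin.snoc ψ χ := by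
  funext i
  obtain rfl : i = 0 := Fin.fin_one_eq_zero i
  simp [Fin.snoc]

/-- The iterated directional derivatives of a form-valued map, evaluated on the arguments of the
form and jointly continuous in all the variables. -/
structure IsScalarDerivativeSequence (f : A → B [⋀^Fin k]→L[ℝ] ℂ)
    (D : (m : ℕ) → A → (Fin m → A) → (Fin k → B) → ℂ) : Prop where
  zero (φ : A) (ψ : Fin 0 → A) (h : Fin k → B) : D 0 φ ψ h = f φ h
  succ (m : ℕ) (φ : A) (ψ : Fin m → A) (χ : A) (h : Fin k → B) :
    Tendsto (fun t : ℝ => t⁻¹ • (D m (φ + t • χ) ψ h - D m φ ψ h)) (𝓝[≠] 0)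
      (𝓝 (D (m + 1) φ (Fin.snoc ψ χ) h))
  continuous (m : ℕ) :
    Continuous (fun p : A × (Fin m → A) × (Fin k → B) => D m p.1 p.2.1 p.2.2)

theorem IsDerivativeSequence.scalar [FirstCountableTopology A] [FirstCountableTopology B]
    {f : A → B [⋀^Fin k]→L[ℝ] ℂ} {D : (m : ℕ) → A → (Fin m → A) → B [⋀^Fin k]→L[ℝ] ℂ}
    (hD : IsDerivativeSequence f D) :
    IsScalarDerivativeSequence f fun m φ ψ h => D m φ ψ h where
  zero φ ψ h := by rw [hD.zero]
  succ m φ ψ χ h := ((continuous_eval_const h).tendsto _).comp (hD.succ m φ ψ χ)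
  continuous m := (continuous_alternating_eval (hD.continuous m)).comp
    (f := fun p : A × (Fin m → A) × (Fin k → B) => ((p.1, p.2.1), p.2.2)) (by fun_prop)

namespace IsScalarDerivativeSequence

variable {f : A → B [⋀^Fin k]→L[ℝ] ℂ} {D : (m : ℕ) → A → (Fin m → A) → (Fin k → B) → ℂ}

theorem exists_alternating (hD : IsScalarDerivativeSequence f D) (m : ℕ) (φ : A)
    (ψ : Fin m → A) : ∃ T : B [⋀^Fin k]→L[ℝ] ℂ, ∀ h, T h = D m φ ψ h := by
  induction m generalizing φ with
  | zero => exact ⟨f φ, fun h => (hD.zero φ ψ h).symm⟩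
  | succ m ih =>
    choose T hT using fun φ => ih φ (Fin.init ψ)
    have hs := hD.succ m φ (Fin.init ψ) (ψ (Fin.last m))
    rw [Fin.snoc_init_self] at hs
    refine exists_alternating_of_tendsto (l := 𝓝[≠] (0 : ℝ))
      (L := fun t => t⁻¹ • (T (φ + t • ψ (Fin.last m)) - T φ)) ?_ fun h => ?_
    · exact (hD.continuous (m + 1)).comp (f := fun h : Fin k → B => (φ, ψ, h)) (by fun_prop)
    · refine (hs h).congr fun t => ?_
      rw [← hT, ← hT]
      rfl

theorem sub_eq_integral (hD : IsScalarDerivativeSequence f D) (m : ℕ) (φ χ : A) (ψ : Fin m → A)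
    (h : Fin k → B) : D m (φ + χ) ψ h - D m φ ψ h =
      ∫ s in (0 : ℝ)..1, D (m + 1) (φ + s • χ) (Fin.snoc ψ χ) h := by
  refine sub_eq_integral_line (G := fun φ => D m φ ψ h)
    (dG := fun φ χ => D (m + 1) φ (Fin.snoc ψ χ) h) (fun φ χ => hD.succ m φ ψ χ h) ?_ φ χ
  exact (hD.continuous (m + 1)).comp (f := fun p : A × A =>
    (p.1, (Fin.snoc ψ p.2 : Fin (m + 1) → A), h))
    (continuous_fst.prodMk (((continuous_snoc_right ψ).comp continuous_snd).prodMk continuous_const))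

theorem last_smul (hD : IsScalarDerivativeSequence f D) (m : ℕ) (φ χ : A) (ψ : Fin m → A)
    (h : Fin k → B) (c : ℝ) :
    D (m + 1) φ (Fin.snoc ψ (c • χ)) h = c • D (m + 1) φ (Fin.snoc ψ χ) h :=
  dirDeriv_scalar_smul (G := fun φ => D m φ ψ h)
    (dG := fun φ χ => D (m + 1) φ (Fin.snoc ψ χ) h) (fun φ χ => hD.succ m φ ψ χ h) φ c χ

theorem last_add (hD : IsScalarDerivativeSequence f D) (m : ℕ) (φ χ χ' : A) (ψ : Fin m → A)
    (h : Fin k → B) : D (m + 1) φ (Fin.snoc ψ (χ + χ')) h =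
      D (m + 1) φ (Fin.snoc ψ χ) h + D (m + 1) φ (Fin.snoc ψ χ') h := by
  refine dirDeriv_scalar_add (G := fun φ => D m φ ψ h)
    (dG := fun φ χ => D (m + 1) φ (Fin.snoc ψ χ) h) (fun φ χ => hD.succ m φ ψ χ h) ?_ φ χ χ'
  exact (hD.continuous (m + 1)).comp (f := fun p : A × A =>
    (p.1, (Fin.snoc ψ p.2 : Fin (m + 1) → A), h))
    (continuous_fst.prodMk (((continuous_snoc_right ψ).comp continuous_snd).prodMk continuous_const))

/-- Joint continuity of the evaluated derivatives implies Bastiani smoothness with respect to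
uniform convergence on bounded sets, since bounded sets are relatively compact. -/
theorem bastianiSmooth [T1Space B] [MontelSpace ℝ B] (hD : IsScalarDerivativeSequence f D) :
    BastianiSmooth f := by
  choose T hT using hD.exists_alternating
  refine ⟨T, fun φ ψ => ContinuousAlternatingMap.ext fun h => ?_, fun m φ ψ χ => ?_, fun m => ?_⟩
  · rw [hT, hD.zero]
  -- The difference quotient is written as an average of the next derivative. This expression also
  -- makes sense at `t = 0`, where it is the derivative, and is jointly continuous in `t` and `h`.
  · let d : ℝ → (Fin k → B) → ℂ := fun t h =>
      ∫ s in (0 : ℝ)..1, D (m + 1) (φ + s • (t • χ)) (Fin.snoc ψ χ) h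
    have hd : Continuous fun p : ℝ × (Fin k → B) => d p.1 p.2 := by
      refine intervalIntegral.continuous_parametric_intervalIntegral_of_continuous' ?_ 0 1
      exact (hD.continuous (m + 1)).comp (f := fun p : (ℝ × (Fin k → B)) × ℝ =>
        (φ + p.2 • (p.1.1 • χ), (Fin.snoc ψ χ : Fin (m + 1) → A), p.1.2)) (by fun_prop)
    refine tendsto_alternating_of_continuous hd (x₀ := 0) nhdsWithin_le_nhds ?_ fun h => ?_
    · filter_upwards [self_mem_nhdsWithin] with t ht h
      change t⁻¹ • (T m (φ + t • χ) ψ h - T m φ ψ h) = d t h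
      rw [hT, hT, hD.sub_eq_integral]
      simp only [hD.last_smul, intervalIntegral.integral_smul]
      rw [smul_smul, inv_mul_cancel₀ ht, one_smul]
    · simp [d, hT]
  · refine continuous_iff_continuousAt.2 fun p => ?_
    exact tendsto_alternating_of_continuous
      (d := fun (p : A × (Fin m → A)) h => D m p.1 p.2 h)
      ((hD.continuous m).comp (f := fun q : (A × (Fin m → A)) × (Fin k → B) =>
        (q.1.1, q.1.2, q.2)) (by fun_prop)) le_rfl
      (Eventually.of_forall fun x h => hT m x.1 x.2 h) fun h => hT m p.1 p.2 h

/-- Linearity in the first direction is needed because `α (h i)` occupies that slot in the homotopy.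
It is inherited through the later derivatives by peeling off the last direction, which avoids
proving symmetry of the higher derivatives. -/
theorem first_smul (hD : IsScalarDerivativeSequence f D) (m : ℕ) (φ χ : A) (ψ : Fin m → A)
    (h : Fin k → B) (c : ℝ) : D (m + 1) φ (Fin.cons (c • χ) ψ : Fin (m + 1) → A) h =
      c • D (m + 1) φ (Fin.cons χ ψ : Fin (m + 1) → A) h := by
  induction m generalizing φ with
  | zero =>
    rw [cons_eq_snoc_fin_zero, cons_eq_snoc_fin_zero, hD.last_smul]
  | succ m ih =>
    rw [← Fin.snoc_init_self ψ, Fin.cons_snoc_eq_snoc_cons, Fin.cons_snoc_eq_snoc_cons]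
    refine tendsto_nhds_unique (hD.succ _ φ _ _ h) (((hD.succ _ φ _ _ h).const_smul c).congr
      fun t => ?_)
    rw [ih, ih, ← smul_sub, smul_comm]

theorem first_add (hD : IsScalarDerivativeSequence f D) (m : ℕ) (φ χ χ' : A) (ψ : Fin m → A)
    (h : Fin k → B) : D (m + 1) φ (Fin.cons (χ + χ') ψ : Fin (m + 1) → A) h =
      D (m + 1) φ (Fin.cons χ ψ : Fin (m + 1) → A) h +
        D (m + 1) φ (Fin.cons χ' ψ : Fin (m + 1) → A) h := by
  induction m generalizing φ with
  | zero =>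
    rw [cons_eq_snoc_fin_zero, cons_eq_snoc_fin_zero, cons_eq_snoc_fin_zero, hD.last_add]
  | succ m ih =>
    rw [← Fin.snoc_init_self ψ, Fin.cons_snoc_eq_snoc_cons, Fin.cons_snoc_eq_snoc_cons,
      Fin.cons_snoc_eq_snoc_cons]
    refine tendsto_nhds_unique (hD.succ _ φ _ _ h)
      (((hD.succ _ φ _ _ h).add (hD.succ _ φ _ _ h)).congr fun t => ?_)
    rw [ih, ih, ← smul_add]
    congr 1
    ring

end IsScalarDerivativeSequence

theorem IsDerivativeSequence.dirDeriv_eq {C : Type*} [AddCommGroup C] [Module ℝ C]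
    [TopologicalSpace C] [T2Space C] {f : A → C} {D : (m : ℕ) → A → (Fin m → A) → C}
    (hD : IsDerivativeSequence f D) (φ χ : A) :
    dirDeriv f φ χ = D 1 φ (Fin.cons χ Fin.elim0) := by
  refine Tendsto.limUnder_eq ?_
  have h := hD.succ 0 φ Fin.elim0 χ
  simp only [hD.zero] at h
  rwa [← cons_eq_snoc_fin_zero] at h

end AlternatingForms

/-! ## Locality and continuity of differential operators -/

section Locality

variable {n : ℕ} {M : Type*} [TopologicalSpace M] [ChartedSpace (EuclideanSpace ℝ (Fin n)) M]
  [IsManifold (𝓡 n) ∞ M]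
  {F : Type*} [NormedAddCommGroup F] [NormedSpace ℝ F]
  {V : M → Type*} [TopologicalSpace (TotalSpace F V)] [∀ x, AddCommGroup (V x)]
  [∀ x, Module ℝ (V x)] [∀ x, TopologicalSpace (V x)] [FiberBundle F V] [VectorBundle ℝ F V]
  [ContMDiffVectorBundle ∞ F V (𝓡 n)]
  {F' : Type*} [NormedAddCommGroup F'] [NormedSpace ℝ F']
  {W : M → Type*} [TopologicalSpace (TotalSpace F' W)] [∀ x, AddCommGroup (W x)]
  [∀ x, Module ℝ (W x)] [∀ x, TopologicalSpace (W x)] [FiberBundle F' W] [VectorBundle ℝ F' W]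
  [ContMDiffVectorBundle ∞ F' W (𝓡 n)]

theorem notMem_sectionSupport_iff {s : Sections n F V} {x : M} :
    x ∉ sectionSupport s ↔ ∀ᶠ z in 𝓝 x, s z = 0 := by
  rw [sectionSupport, mem_closure_iff_frequently, not_frequently]
  simp

theorem apply_eq_zero_of_notMem_sectionSupport {s : Sections n F V} {x : M}
    (h : x ∉ sectionSupport s) : s x = 0 :=
  (notMem_sectionSupport_iff.1 h).self_of_nhds

theorem eq_zero_of_sectionSupport_eq_empty {s : Sections n F V} (h : sectionSupport s = ∅) :
    s = 0 :=
  ContMDiffSection.ext fun x => apply_eq_zero_of_notMem_sectionSupport (by simp [h])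

theorem sectionSupport_functionSmul_subset_left (θ : C^∞⟮𝓡 n, M; ℝ⟯) (s : Sections n F V) :
    sectionSupport (functionSmul θ s) ⊆ tsupport θ :=
  closure_mono fun x hx h => hx (by simp [functionSmul, h])

theorem sectionSupport_functionSmul_subset_right (θ : C^∞⟮𝓡 n, M; ℝ⟯) (s : Sections n F V) :
    sectionSupport (functionSmul θ s) ⊆ sectionSupport s :=
  closure_mono fun x hx h => hx (by simp [functionSmul, h])

theorem evalAt_functionSmul (θ : C^∞⟮𝓡 n, M; ℝ⟯) (s : Sections n F V) (x : M) :
    evalAt x (functionSmul θ s) = θ x • evalAt x s :=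
  ((trivializationAt F V x).linear ℝ
    (FiberBundle.mem_baseSet_trivializationAt F V x)).map_smul _ _

theorem localRep_eventuallyEq {x : M} {φ φ' : Sections n F V}
    (h : ∀ᶠ z in 𝓝 x, φ z = φ' z) :
    localRep x φ =ᶠ[𝓝 (extChartAt (𝓡 n) x x)] localRep x φ' := by
  have h1 := (continuousAt_extChartAt_symm (I := 𝓡 n) x).eventually
    (p := fun z => φ z = φ' z) (by simpa using h)
  filter_upwards [h1] with y hy
  rw [localRep, hy, localRep]

theorem continuous_jet_apply (x₀ : M) (j : ℕ) (y : localDomain n F V x₀) :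
    Continuous fun s : Sections n F V => jet x₀ j s y := by
  have h1 : Continuous fun s : Sections n F V =>
      UniformOnFun.ofFun {K : Set (localDomain n F V x₀) | IsCompact K} (jet x₀ j s) :=
    continuous_iInf_dom (i := x₀) (continuous_iInf_dom (i := j) continuous_induced_dom)
  have h2 := (UniformOnFun.uniformContinuous_eval_of_mem
    (ContinuousMultilinearMap ℝ (fun _ : Fin j => EuclideanSpace ℝ (Fin n)) F)
    {K : Set (localDomain n F V x₀) | IsCompact K} (mem_singleton y) isCompact_singleton).continuous
  exact h2.comp h1

theorem eq_of_tendsto_evalAt {u : ℕ → Sections n F V} {s t : Sections n F V}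
    (h : Tendsto u atTop (𝓝 t))
    (h' : ∀ x, Tendsto (fun m => evalAt x (u m)) atTop (𝓝 (evalAt x s))) : t = s :=
  ContMDiffSection.ext fun x => evalAt_inj.1
    (tendsto_nhds_unique (((continuous_evalAt x).tendsto t).comp h) (h' x))

variable {P : Sections n F V →ₗ[ℝ] Sections n F' W}

namespace IsDifferentialOperator

theorem apply_eq_of_eventuallyEq (hP : IsDifferentialOperator P) {x : M} {φ φ' : Sections n F V}
    (h : ∀ᶠ z in 𝓝 x, φ z = φ' z) : P φ x = P φ' x := by
  rw [← evalAt_inj, evalAt_eq_localRep, evalAt_eq_localRep]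
  obtain ⟨m, U, a, -, hxU, -, -, h1⟩ := hP x
  rw [h1 _ _ hxU, h1 _ _ hxU]
  refine Finset.sum_congr rfl fun j _ => ?_
  rw [((localRep_eventuallyEq h).iteratedFDeriv ℝ j).self_of_nhds]

theorem sectionSupport_subset (hP : IsDifferentialOperator P) (φ : Sections n F V) :
    sectionSupport (P φ) ⊆ sectionSupport φ := by
  refine closure_minimal (fun x hx => ?_) isClosed_closure
  by_contra h
  refine hx ?_
  rw [hP.apply_eq_of_eventuallyEq (φ' := 0) (notMem_sectionSupport_iff.1 h), map_zero]
  rfl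

/-- By the closed graph theorem it suffices to identify the limit pointwise, and the value at a
point is a finite sum of continuous functions of jets. -/
theorem continuous [SecondCountableTopology M] [CompleteSpace F] [CompleteSpace F']
    (hP : IsDifferentialOperator P) : Continuous P := by
  refine sections_continuous_of_closed_graph P fun u s t hu ht => ?_
  refine eq_of_tendsto_evalAt ht fun x => ?_
  obtain ⟨m, U, a, -, hxU, hU, -, h1⟩ := hP x
  simp only [evalAt_eq_localRep, h1 _ _ hxU]
  refine tendsto_finsetSum _ fun j _ => ((a j _).continuous.tendsto _).comp ?_
  exact ((continuous_jet_apply x j ⟨_, (hU hxU).1⟩).tendsto s).comp hu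

end IsDifferentialOperator

variable (V) in
/-- Multiplication by a smooth function as a linear map. -/
def functionSmulLinear (θ : C^∞⟮𝓡 n, M; ℝ⟯) : Sections n F V →ₗ[ℝ] Sections n F V where
  toFun := functionSmul θ
  map_add' _ _ := ContMDiffSection.ext fun _ => smul_add _ _ _
  map_smul' _ _ := ContMDiffSection.ext fun _ => smul_comm _ _ _

theorem continuous_functionSmul [SecondCountableTopology M] [CompleteSpace F]
    (θ : C^∞⟮𝓡 n, M; ℝ⟯) : Continuous (functionSmul θ : Sections n F V → Sections n F V) := by
  refine sections_continuous_of_closed_graph (functionSmulLinear V θ) fun u s t hu ht => ?_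
  refine eq_of_tendsto_evalAt ht fun x => ?_
  change Tendsto (fun m => evalAt x (functionSmul θ (u m))) atTop
    (𝓝 (evalAt x (functionSmul θ s)))
  simp only [evalAt_functionSmul]
  exact (((continuous_evalAt x).tendsto s).comp hu).const_smul _

theorem exists_cutoff [T2Space M] [SecondCountableTopology M] {K : Set M} (hK : IsCompact K) :
    ∃ χ : C^∞⟮𝓡 n, M; ℝ⟯, (∀ᶠ x in 𝓝ˢ K, χ x = 1) ∧ IsCompact (tsupport χ) := by
  have : LocallyCompactSpace M := ChartedSpace.locallyCompactSpace (EuclideanSpace ℝ (Fin n)) M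
  obtain ⟨K', hK', hKK'⟩ := exists_compact_superset hK
  obtain ⟨χ, h1, h0, -⟩ := exists_contMDiffMap_one_nhds_of_subset_interior (𝓡 n) (n := ⊤)
    hK.isClosed hKK'
  refine ⟨χ, h1, hK'.of_isClosed_subset (isClosed_tsupport _) ?_⟩
  exact closure_minimal (fun x hx => by_contra fun h => hx (h0 x h)) hK'.isClosed

end Locality

/-! ## Inverses on sections with past compact support -/

section Green

variable {n : ℕ} {M : Type*} [TopologicalSpace M] [ChartedSpace (EuclideanSpace ℝ (Fin n)) M]
  [IsManifold (𝓡 n) ∞ M]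
  {F : Type*} [NormedAddCommGroup F] [NormedSpace ℝ F]
  {V : M → Type*} [TopologicalSpace (TotalSpace F V)] [∀ x, AddCommGroup (V x)]
  [∀ x, Module ℝ (V x)] [∀ x, TopologicalSpace (V x)] [FiberBundle F V] [VectorBundle ℝ F V]
  [ContMDiffVectorBundle ∞ F V (𝓡 n)]
  {F' : Type*} [NormedAddCommGroup F'] [NormedSpace ℝ F']
  {W : M → Type*} [TopologicalSpace (TotalSpace F' W)] [∀ x, AddCommGroup (W x)]
  [∀ x, Module ℝ (W x)] [∀ x, TopologicalSpace (W x)] [FiberBundle F' W] [VectorBundle ℝ F' W]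
  [ContMDiffVectorBundle ∞ F' W (𝓡 n)]
  [T2Space M] [SecondCountableTopology M] {r : M → M → Prop}
  {P : Sections n F V →ₗ[ℝ] Sections n F' W} {G : compactSections n F' W →ₗ[ℝ] Sections n F V}

theorem RelPastCompact.mono {A B : Set M} (hA : RelPastCompact r A) (hB : IsClosed B)
    (h : B ⊆ A) : RelPastCompact r B := fun K hK => by
  rw [← inter_eq_self_of_subset_left h, inter_assoc]
  exact (hA K hK).inter_left hB

theorem RelPastCompact.union {A B : Set M} (hA : RelPastCompact r A) (hB : RelPastCompact r B) :
    RelPastCompact r (A ∪ B) := fun K hK => by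
  rw [union_inter_distrib_right]
  exact (hA K hK).union (hB K hK)

/-- The product of a section and a compactly supported function. -/
def cutoffSmul (χ : C^∞⟮𝓡 n, M; ℝ⟯) (hχ : IsCompact (tsupport χ)) (s : Sections n F V) :
    compactSections n F V :=
  ⟨functionSmul χ s, hχ.of_isClosed_subset isClosed_closure
    (sectionSupport_functionSmul_subset_left χ s)⟩

theorem functionSmul_eventuallyEq {χ : C^∞⟮𝓡 n, M; ℝ⟯} {x : M} (h : ∀ᶠ z in 𝓝 x, χ z = 1)
    (s : Sections n F V) : ∀ᶠ z in 𝓝 x, functionSmul χ s z = s z := by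
  filter_upwards [h] with z hz
  change χ z • s z = s z
  rw [hz, one_smul]

/-- To see `φ` at `x`, cut it off by `χ` equal to `1` near the compact part of its support before
`x`. The compactly supported `χ φ` is recovered by `G` from `P (χ φ)`, so `x` lies after some source
point `p`. Near `p` the cutoff is `1`, hence `p` belongs to the support of `P φ`. Uniqueness is a
consequence. -/
theorem sectionSupport_subset_future (hr : ProperCausality r) (hP : IsDifferentialOperator P)
    (hG : IsGreenOperator P (relFuture r) G) {φ : Sections n F V}
    (hφ : RelPastCompact r (sectionSupport φ)) :
    sectionSupport φ ⊆ relFuture r (sectionSupport (P φ)) := by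
  have : LocallyCompactSpace M := ChartedSpace.locallyCompactSpace (EuclideanSpace ℝ (Fin n)) M
  have hP' := hP.sectionSupport_subset φ
  refine closure_minimal (fun x hx => ?_) (hr.isClosed_future (hφ.mono isClosed_closure hP'))
  obtain ⟨χ, h1, hχ⟩ := exists_cutoff (n := n) (hφ {x} isCompact_singleton)
  rw [eventually_nhdsSet_iff_forall] at h1
  have hxK : x ∈ sectionSupport φ ∩ relFuture (Function.swap r) {x} :=
    ⟨subset_closure hx, x, rfl, hr.refl x⟩
  have hψ := hG.apply_right (cutoffSmul χ hχ φ) ⟨P (functionSmul χ φ),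
    (cutoffSmul χ hχ φ).2.of_isClosed_subset isClosed_closure (hP.sectionSupport_subset _)⟩ rfl
  have hx' : x ∈ sectionSupport (functionSmul χ φ) := subset_closure (by
    rw [mem_ofPred_eq, (functionSmul_eventuallyEq (h1 x hxK) φ).self_of_nhds]
    exact hx)
  have h2 := hG.support_subset ⟨P (functionSmul χ φ),
    (cutoffSmul χ hχ φ).2.of_isClosed_subset isClosed_closure (hP.sectionSupport_subset _)⟩
  rw [hψ] at h2
  obtain ⟨p, hp, hpx⟩ := h2 hx'
  have hpK : p ∈ sectionSupport φ ∩ relFuture (Function.swap r) {x} :=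
    ⟨sectionSupport_functionSmul_subset_right χ φ (hP.sectionSupport_subset _ hp), x, rfl, hpx⟩
  refine ⟨p, by_contra fun h => ?_, hpx⟩
  refine notMem_sectionSupport_iff.2 ?_ hp
  filter_upwards [notMem_sectionSupport_iff.1 h, eventually_eventually_nhds.2
    (functionSmul_eventuallyEq (h1 p hpK) φ)] with z hz hz'
  rw [← hz]
  exact hP.apply_eq_of_eventuallyEq hz'

/-- The two truncated sources differ only away from the past of `x`, so the support property makes
the difference of the solutions vanish at `x`. -/
theorem green_eq_of_cutoff (hG : IsGreenOperator P (relFuture r) G) {h : Sections n F' W}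
    {χ χ' : C^∞⟮𝓡 n, M; ℝ⟯} (hχ : IsCompact (tsupport χ)) (hχ' : IsCompact (tsupport χ')) {x : M}
    (h1 : ∀ p ∈ sectionSupport h, r p x → ∀ᶠ z in 𝓝 p, χ z = 1)
    (h1' : ∀ p ∈ sectionSupport h, r p x → ∀ᶠ z in 𝓝 p, χ' z = 1) :
    G (cutoffSmul χ hχ h) x = G (cutoffSmul χ' hχ' h) x := by
  have h2 : G (cutoffSmul χ hχ h - cutoffSmul χ' hχ' h) x = 0 := by
    refine apply_eq_zero_of_notMem_sectionSupport fun hx => ?_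
    obtain ⟨p, hp, hpx⟩ := hG.support_subset _ hx
    refine notMem_sectionSupport_iff.2 ?_ hp
    by_cases hph : p ∈ sectionSupport h
    · filter_upwards [functionSmul_eventuallyEq (h1 p hph hpx) h,
        functionSmul_eventuallyEq (h1' p hph hpx) h] with z hz hz'
      change functionSmul χ h z - functionSmul χ' h z = 0
      rw [hz, hz', sub_self]
    · filter_upwards [notMem_sectionSupport_iff.1 hph] with z hz
      change χ z • h z - χ' z • h z = 0
      simp [hz]
  rw [map_sub] at h2
  exact sub_eq_zero.1 h2

/-- The solution is defined point by point, with a cutoff adapted to each point. On a neighbourhood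
of `x` the cutoff of `x` serves all points, so smoothness and the equation are inherited locally. -/
theorem exists_solution (hr : ProperCausality r) (hP : IsDifferentialOperator P)
    (hG : IsGreenOperator P (relFuture r) G) {h : Sections n F' W}
    (hh : RelPastCompact r (sectionSupport h)) :
    ∃ φ : Sections n F V, RelPastCompact r (sectionSupport φ) ∧ P φ = h := by
  have : LocallyCompactSpace M := ChartedSpace.locallyCompactSpace (EuclideanSpace ℝ (Fin n)) M
  choose N hN hxN using fun x : M => exists_compact_mem_nhds x
  -- The cutoff is `1` near the source in the past of the whole neighbourhood `N x`, not merely of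
  -- `x`.
  choose χ h1 hχ using fun x => exists_cutoff (n := n) (hh (N x) (hN x))
  simp only [eventually_nhdsSet_iff_forall] at h1
  have key : ∀ x, ∀ y ∈ N x, G (cutoffSmul (χ y) (hχ y) h) y = G (cutoffSmul (χ x) (hχ x) h) y :=
    fun x y hy => green_eq_of_cutoff hG _ _
      (fun p hp hpy => h1 y p ⟨hp, y, mem_of_mem_nhds (hxN y), hpy⟩)
      (fun p hp hpy => h1 x p ⟨hp, y, hy, hpy⟩)
  let φ : Sections n F V := ⟨fun x => G (cutoffSmul (χ x) (hχ x) h) x, fun x => by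
    refine ((G (cutoffSmul (χ x) (hχ x) h)).contMDiff x).congr_of_eventuallyEq ?_
    filter_upwards [hxN x] with y hy
    rw [key x y hy]⟩
  have hsupp : sectionSupport φ ⊆ relFuture r (sectionSupport h) := by
    refine closure_minimal (fun x hx => ?_) (hr.isClosed_future hh)
    obtain ⟨p, hp, hpx⟩ := hG.support_subset _ (subset_closure hx)
    exact ⟨p, sectionSupport_functionSmul_subset_right _ _ hp, hpx⟩
  refine ⟨φ, (hr.relPastCompact_future hh).mono isClosed_closure hsupp,
    ContMDiffSection.ext fun x => ?_⟩
  have h2 : ∀ᶠ y in 𝓝 x, φ y = G (cutoffSmul (χ x) (hχ x) h) y := by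
    filter_upwards [hxN x] with y hy using key x y hy
  rw [hP.apply_eq_of_eventuallyEq h2, hG.apply_left]
  by_cases hxh : x ∈ sectionSupport h
  · exact (functionSmul_eventuallyEq
      (h1 x x ⟨hxh, x, mem_of_mem_nhds (hxN x), hr.refl x⟩) h).self_of_nhds
  · change χ x x • h x = h x
    rw [apply_eq_zero_of_notMem_sectionSupport hxh, smul_zero]

theorem sectionSupport_add_subset (s t : Sections n F V) :
    sectionSupport (s + t) ⊆ sectionSupport s ∪ sectionSupport t := by
  intro x hx
  by_contra h
  rw [mem_union, not_or] at h
  refine notMem_sectionSupport_iff.2 ?_ hx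
  filter_upwards [notMem_sectionSupport_iff.1 h.1, notMem_sectionSupport_iff.1 h.2] with z hz hz'
  change s z + t z = 0
  rw [hz, hz', add_zero]

theorem sectionSupport_smul_subset (c : ℝ) (s : Sections n F V) :
    sectionSupport (c • s) ⊆ sectionSupport s :=
  closure_mono fun x hx h => hx (by simp [h])

theorem green_injOn (hr : ProperCausality r) (hP : IsDifferentialOperator P)
    (hG : IsGreenOperator P (relFuture r) G) :
    InjOn P {s : Sections n F V | RelPastCompact r (sectionSupport s)} := by
  intro s hs t ht hst
  have h1 : RelPastCompact r (sectionSupport (s + (-1 : ℝ) • t)) :=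
    (RelPastCompact.union hs ht).mono isClosed_closure ((sectionSupport_add_subset _ _).trans
      (union_subset_union_right _ (sectionSupport_smul_subset _ _)))
  have h2 := sectionSupport_subset_future hr hP hG h1
  rw [map_add, map_smul, hst] at h2
  have h3 : sectionSupport (P t + (-1 : ℝ) • P t) = ∅ := by
    simp [sectionSupport]
  rw [h3] at h2
  have h4 : s + (-1 : ℝ) • t = 0 := eq_zero_of_sectionSupport_eq_empty
    (eq_empty_of_subset_empty (h2.trans (by rintro x ⟨p, hp, -⟩; exact hp)))
  rw [neg_one_smul] at h4
  exact add_neg_eq_zero.1 h4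

theorem green_bijOn (hr : ProperCausality r) (hP : IsDifferentialOperator P)
    (hG : IsGreenOperator P (relFuture r) G) :
    BijOn P {s : Sections n F V | RelPastCompact r (sectionSupport s)}
      {s : Sections n F' W | RelPastCompact r (sectionSupport s)} :=
  ⟨fun _ hs => RelPastCompact.mono hs isClosed_closure (hP.sectionSupport_subset _),
    green_injOn hr hP hG, fun _ hh => exists_solution hr hP hG hh⟩

variable (r P) in
/-- The inverse of `P` on the sections with past compact support. -/
def greenInverse : Sections n F' W → Sections n F V :=
  Function.invFunOn P {s : Sections n F V | RelPastCompact r (sectionSupport s)}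

theorem greenInverse_spec (hr : ProperCausality r) (hP : IsDifferentialOperator P)
    (hG : IsGreenOperator P (relFuture r) G) {h : Sections n F' W}
    (hh : RelPastCompact r (sectionSupport h)) :
    RelPastCompact r (sectionSupport (greenInverse r P h)) ∧ P (greenInverse r P h) = h :=
  Function.invFunOn_pos (exists_solution hr hP hG hh)

theorem sectionSupport_greenInverse_subset (hr : ProperCausality r)
    (hP : IsDifferentialOperator P) (hG : IsGreenOperator P (relFuture r) G)
    {h : Sections n F' W} (hh : RelPastCompact r (sectionSupport h)) :
    sectionSupport (greenInverse r P h) ⊆ relFuture r (sectionSupport h) := by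
  obtain ⟨h1, h2⟩ := greenInverse_spec hr hP hG hh
  simpa only [h2] using sectionSupport_subset_future hr hP hG h1

theorem greenInverse_eq (hr : ProperCausality r) (hP : IsDifferentialOperator P)
    (hG : IsGreenOperator P (relFuture r) G) {h : Sections n F' W} {φ : Sections n F V}
    (hφ : RelPastCompact r (sectionSupport φ)) (h1 : P φ = h) : greenInverse r P h = φ := by
  have hh : RelPastCompact r (sectionSupport h) := h1 ▸
    hφ.mono isClosed_closure (hP.sectionSupport_subset φ)
  obtain ⟨h2, h3⟩ := greenInverse_spec hr hP hG hh
  exact green_injOn hr hP hG h2 hφ (h3.trans h1.symm)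

/-- All values are supported in the future of the support of `θ`, a closed past compact set. A limit
of values is thus supported there too and solves the limiting equation, so uniqueness gives the
closed graph. -/
theorem exists_continuous_green [CompleteSpace F] [CompleteSpace F'] (hr : ProperCausality r)
    (hP : IsDifferentialOperator P) (hG : IsGreenOperator P (relFuture r) G)
    {θ : C^∞⟮𝓡 n, M; ℝ⟯} (hθ : RelPastCompact r (tsupport θ)) :
    ∃ T : Sections n F' W →L[ℝ] Sections n F V,
      (∀ h, T h = greenInverse r P (functionSmul θ h)) ∧
      (∀ h, P (T h) = functionSmul θ h) ∧
      ∀ K, IsCompact K → ∃ K', IsCompact K' ∧ ∀ h, (∀ x ∈ K', h x = 0) → ∀ x ∈ K, T h x = 0 := by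
  have : LocallyCompactSpace M := ChartedSpace.locallyCompactSpace (EuclideanSpace ℝ (Fin n)) M
  have hθ' : ∀ h : Sections n F' W, RelPastCompact r (sectionSupport (functionSmul θ h)) :=
    fun h => hθ.mono isClosed_closure (sectionSupport_functionSmul_subset_left θ h)
  let S := fun h : Sections n F' W => greenInverse r P (functionSmul θ h)
  have hS : ∀ h, RelPastCompact r (sectionSupport (S h)) ∧ P (S h) = functionSmul θ h :=
    fun h => greenInverse_spec hr hP hG (hθ' h)
  have hsupp : ∀ h, sectionSupport (S h) ⊆ relFuture r (sectionSupport (functionSmul θ h)) :=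
    fun h => sectionSupport_greenInverse_subset hr hP hG (hθ' h)
  let T : Sections n F' W →ₗ[ℝ] Sections n F V :=
    { toFun := S
      map_add' := fun s t => greenInverse_eq hr hP hG
        (((hS s).1.union (hS t).1).mono isClosed_closure (sectionSupport_add_subset _ _))
        (by rw [map_add, (hS s).2, (hS t).2]; exact ((functionSmulLinear W θ).map_add s t).symm)
      map_smul' := fun c s => greenInverse_eq hr hP hG
        ((hS s).1.mono isClosed_closure (sectionSupport_smul_subset _ _))
        (by rw [map_smul, (hS s).2]; exact ((functionSmulLinear W θ).map_smul c s).symm) }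
  have hC := hr.isClosed_future hθ
  have hT : Continuous T := by
    refine sections_continuous_of_closed_graph T fun u s t hu ht => ?_
    have h1 : ∀ x ∈ (relFuture r (tsupport θ))ᶜ, t x = (0 : Sections n F V) x := by
      refine (isClosed_eqOn_sections (relFuture r (tsupport θ))ᶜ (0 : Sections n F V)).mem_of_tendsto
        ht (Eventually.of_forall fun m x hx => ?_)
      exact apply_eq_zero_of_notMem_sectionSupport fun hx' =>
        hx (relFuture_mono (sectionSupport_functionSmul_subset_left θ _) (hsupp _ hx'))
    have h2 : sectionSupport t ⊆ relFuture r (tsupport θ) :=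
      closure_minimal (fun x hx => by_contra fun hx' => hx (h1 x hx')) hC
    refine (greenInverse_eq hr hP hG
      ((hr.relPastCompact_future hθ).mono isClosed_closure h2) ?_).symm
    refine tendsto_nhds_unique ((hP.continuous.tendsto t).comp ht)
      ((((continuous_functionSmul θ).tendsto s).comp hu).congr fun m => ?_)
    exact (hS (u m)).2.symm
  refine ⟨⟨T, hT⟩, fun h => rfl, fun h => (hS h).2, fun K hK => ?_⟩
  -- Only the source in the compact intersection of the support of `θ` with the past of `K`
  -- influences `K`; a neighbourhood is taken so that vanishing on `K'` excludes support points.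
  obtain ⟨K', hK', hKK'⟩ := exists_compact_superset (hθ K hK)
  refine ⟨K', hK', fun h hh x hx => apply_eq_zero_of_notMem_sectionSupport fun hxs => ?_⟩
  obtain ⟨p, hp, hpx⟩ := hsupp h hxs
  have hpK := hKK' ⟨sectionSupport_functionSmul_subset_left θ h hp, x, hx, hpx⟩
  refine notMem_sectionSupport_iff.2 ?_ hp
  filter_upwards [mem_interior_iff_mem_nhds.1 hpK] with z hz
  change θ z • h z = 0
  rw [hh z hz, smul_zero]

end Green

/-! ## Supports of multivector fields -/

section Localization

variable {n : ℕ} {M : Type*} [TopologicalSpace M] [ChartedSpace (EuclideanSpace ℝ (Fin n)) M]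
  [IsManifold (𝓡 n) ∞ M]
  {F : Type*} [NormedAddCommGroup F] [NormedSpace ℝ F]
  {V : M → Type*} [TopologicalSpace (TotalSpace F V)] [∀ x, AddCommGroup (V x)]
  [∀ x, Module ℝ (V x)] [∀ x, TopologicalSpace (V x)] [FiberBundle F V] [VectorBundle ℝ F V]
  [ContMDiffVectorBundle ∞ F V (𝓡 n)]
  {F' : Type*} [NormedAddCommGroup F'] [NormedSpace ℝ F']
  {W : M → Type*} [TopologicalSpace (TotalSpace F' W)] [∀ x, AddCommGroup (W x)]
  [∀ x, Module ℝ (W x)] [∀ x, TopologicalSpace (W x)] [FiberBundle F' W] [VectorBundle ℝ F' W]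
  [ContMDiffVectorBundle ∞ F' W (𝓡 n)]

theorem tendsto_sections_iff {ι : Type*} {l : Filter ι} {u : ι → Sections n F V}
    {s : Sections n F V} : Tendsto u l (𝓝 s) ↔ ∀ (x₀ : M) (j : ℕ) (K : Set (localDomain n F V x₀)),
      IsCompact K → TendstoUniformlyOn (fun i => jet x₀ j (u i)) (jet x₀ j s) l K := by
  rw [nhds_iInf, tendsto_iInf]
  refine forall_congr' fun x₀ => ?_
  rw [nhds_iInf, tendsto_iInf]
  refine forall_congr' fun j => ?_
  rw [nhds_induced, tendsto_comap_iff, UniformOnFun.tendsto_iff_tendstoUniformlyOn]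
  rfl

theorem jet_eq_of_eventuallyEq {x₀ : M} {j : ℕ} {y : localDomain n F V x₀} {s t : Sections n F V}
    (h : ∀ᶠ z in 𝓝 ((extChartAt (𝓡 n) x₀).symm y), s z = t z) : jet x₀ j s y = jet x₀ j t y := by
  have h1 := (continuousAt_extChartAt_symm'' (I := 𝓡 n) y.2.1).eventually h
  have h2 : localRep x₀ s =ᶠ[𝓝 (y : EuclideanSpace ℝ (Fin n))] localRep x₀ t := by
    filter_upwards [h1] with z hz
    rw [localRep, hz, localRep]
  exact (h2.iteratedFDeriv ℝ j).self_of_nhds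

theorem exists_cutoff_sequence (n : ℕ) (M : Type*) [TopologicalSpace M]
    [ChartedSpace (EuclideanSpace ℝ (Fin n)) M] [IsManifold (𝓡 n) ∞ M] [T2Space M]
    [SecondCountableTopology M] : ∃ χ : ℕ → C^∞⟮𝓡 n, M; ℝ⟯, (∀ m, IsCompact (tsupport (χ m))) ∧
      ∀ K : Set M, IsCompact K → ∀ᶠ m in atTop, ∀ᶠ x in 𝓝ˢ K, χ m x = 1 := by
  have : LocallyCompactSpace M := ChartedSpace.locallyCompactSpace (EuclideanSpace ℝ (Fin n)) M
  let E : CompactExhaustion M := default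
  choose χ h1 h2 using fun m => exists_cutoff (n := n) (E.isCompact m)
  refine ⟨χ, h2, fun K hK => ?_⟩
  obtain ⟨m₀, hm₀⟩ := E.exists_superset_of_isCompact hK
  filter_upwards [eventually_ge_atTop m₀] with m hm
  exact (h1 m).filter_mono (nhdsSet_mono (hm₀.trans (E.subset hm)))

variable [T2Space M] [SecondCountableTopology M]

theorem tendsto_functionSmul {χ : ℕ → C^∞⟮𝓡 n, M; ℝ⟯}
    (hχ : ∀ K : Set M, IsCompact K → ∀ᶠ m in atTop, ∀ᶠ x in 𝓝ˢ K, χ m x = 1)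
    (s : Sections n F V) : Tendsto (fun m => functionSmul (χ m) s) atTop (𝓝 s) := by
  refine tendsto_sections_iff.2 fun x₀ j K hK => ?_
  have hL : IsCompact ((fun y : localDomain n F V x₀ => (extChartAt (𝓡 n) x₀).symm y) '' K) := by
    refine hK.image_of_continuousOn (Continuous.continuousOn ?_)
    exact ((continuousOn_extChartAt_symm x₀).mono inter_subset_left).domRestrict
  intro u hu
  filter_upwards [hχ _ hL] with m hm y hy
  rw [eventually_nhdsSet_iff_forall] at hm
  have h1 := jet_eq_of_eventuallyEq (j := j) (y := y)
    (functionSmul_eventuallyEq (hm _ ⟨y, hy, rfl⟩) s)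
  rw [h1]
  exact refl_mem_uniformity hu

theorem exists_split {U U' : Set M} (hU : IsOpen U) (hU' : IsOpen U') {s : Sections n F V}
    (hs : sectionSupport s ⊆ U ∪ U') : ∃ t t' : Sections n F V, t + t' = s ∧
      sectionSupport t ⊆ U ∧ sectionSupport t' ⊆ U' := by
  have : LocallyCompactSpace M := ChartedSpace.locallyCompactSpace (EuclideanSpace ℝ (Fin n)) M
  have hd : Disjoint (sectionSupport s \ U) (sectionSupport s \ U') := by
    rw [disjoint_left]
    rintro x ⟨hx, h1⟩ ⟨-, h2⟩
    exact (hs hx).elim h1 h2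
  obtain ⟨χ, h0, h1, -⟩ := exists_contMDiffMap_zero_one_nhds_of_isClosed (𝓡 n) (n := ⊤)
    (isClosed_closure.sdiff hU) (isClosed_closure.sdiff hU') hd
  rw [eventually_nhdsSet_iff_forall] at h0 h1
  refine ⟨functionSmul χ s, functionSmul (1 - χ) s, ContMDiffSection.ext fun x => ?_,
    fun x hx => ?_, fun x hx => ?_⟩
  · change χ x • s x + (1 - χ x) • s x = s x
    rw [← add_smul]
    simp
  · by_contra hxU
    refine notMem_sectionSupport_iff.2 ?_ hx
    filter_upwards [h0 x ⟨sectionSupport_functionSmul_subset_right χ s hx, hxU⟩] with z hz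
    change χ z • s z = 0
    rw [hz, zero_smul]
  · by_contra hxU
    refine notMem_sectionSupport_iff.2 ?_ hx
    filter_upwards [h1 x ⟨sectionSupport_functionSmul_subset_right _ s hx, hxU⟩] with z hz
    change (1 - χ z) • s z = 0
    rw [hz, sub_self, zero_smul]

/-- This is a partition of unity argument for an arbitrary additive condition `Q`. It applies both
to the kernel of a distribution and to the increments that leave a nonlinear functional unchanged.
-/
theorem mem_of_locally_of_isCompact {Q : Set (Sections n F V)} (h0 : (0 : Sections n F V) ∈ Q)
    (hadd : ∀ s ∈ Q, ∀ t ∈ Q, s + t ∈ Q) {C : Set M} (hC : IsCompact C)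
    (hloc : ∀ x ∈ C, ∃ U, IsOpen U ∧ x ∈ U ∧
      ∀ s : Sections n F V, sectionSupport s ⊆ U → s ∈ Q)
    {s : Sections n F V} (hs : sectionSupport s ⊆ C) : s ∈ Q := by
  obtain ⟨U, -, hCU, h⟩ : ∃ U : Set M, IsOpen U ∧ C ⊆ U ∧
      ∀ s : Sections n F V, sectionSupport s ⊆ U → s ∈ Q := by
    refine hC.induction_on (p := fun C => ∃ U : Set M, IsOpen U ∧ C ⊆ U ∧
      ∀ s : Sections n F V, sectionSupport s ⊆ U → s ∈ Q) ?_ ?_ ?_ fun x hx => ?_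
    · refine ⟨∅, isOpen_empty, subset_rfl, fun s hs => ?_⟩
      rwa [eq_zero_of_sectionSupport_eq_empty (subset_empty_iff.1 hs)]
    · rintro A B hAB ⟨U, hU, hBU, h⟩
      exact ⟨U, hU, hAB.trans hBU, h⟩
    · rintro A B ⟨U, hU, hAU, h⟩ ⟨U', hU', hBU', h'⟩
      refine ⟨U ∪ U', hU.union hU', union_subset_union hAU hBU', fun s hs => ?_⟩
      obtain ⟨t, t', rfl, ht, ht'⟩ := exists_split hU hU' hs
      exact hadd t (h t ht) t' (h' t' ht')
    · obtain ⟨U, hU, hxU, h⟩ := hloc x hx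
      exact ⟨U, mem_nhdsWithin_of_mem_nhds (hU.mem_nhds hxU), U, hU, subset_rfl, h⟩
  exact h s (hs.trans hCU)

theorem mem_of_locally_of_isClosed {Q : Set (Sections n F V)} (hQ : IsClosed Q)
    (h0 : (0 : Sections n F V) ∈ Q) (hadd : ∀ s ∈ Q, ∀ t ∈ Q, s + t ∈ Q) {C : Set M}
    (hC : IsClosed C) (hloc : ∀ x ∈ C, ∃ U, IsOpen U ∧ x ∈ U ∧
      ∀ s : Sections n F V, sectionSupport s ⊆ U → s ∈ Q)
    {s : Sections n F V} (hs : sectionSupport s ⊆ C) : s ∈ Q := by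
  obtain ⟨χ, h1, h2⟩ := exists_cutoff_sequence n M
  refine hQ.mem_of_tendsto (tendsto_functionSmul h2 s) (Eventually.of_forall fun m => ?_)
  refine mem_of_locally_of_isCompact h0 hadd ((h1 m).inter_right hC)
    (fun x hx => hloc x hx.2) ?_
  exact subset_inter (sectionSupport_functionSmul_subset_left _ s)
    ((sectionSupport_functionSmul_subset_right _ s).trans hs)

/-- A Lebesgue number `ε` ensures that each product of `ε`-balls centred in the sets `C i` lies in
one box on which `u` vanishes. Multilinearity then allows localization of one argument at a time. -/
theorem alternating_eq_zero_of_locally_of_isCompact {k : ℕ} (u : AltDistribution n F V k)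
    {C : Fin k → Set M} (hC : ∀ i, IsCompact (C i))
    (hloc : ∀ z : Fin k → M, (∀ i, z i ∈ C i) → z ∉ u.support) {h : Fin k → Sections n F V}
    (hh : ∀ i, sectionSupport (h i) ⊆ C i) : u h = 0 := by
  have : LocallyCompactSpace M := ChartedSpace.locallyCompactSpace (EuclideanSpace ℝ (Fin n)) M
  let _ := TopologicalSpace.metrizableSpaceMetric M
  choose! U hU hUz using fun z (hz : ∀ i, z i ∈ C i) => notMem_compl_iff.1 (hloc z hz)
  obtain ⟨ε, hε, hball⟩ := lebesgue_number_lemma_of_metric (isCompact_univ_pi hC)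
    (c := fun z : univ.pi C => univ.pi (U z.1))
    (fun z => isOpen_set_pi finite_univ fun i _ => (hU z.1 (fun i => z.2 i trivial) i).1)
    (fun z hz => mem_iUnion.2 ⟨⟨z, hz⟩, fun i _ => (hU z (fun i => hz i trivial) i).2⟩)
  -- The slots in `J` are those not yet localized to a small ball.
  have key : ∀ (J : Finset (Fin k)) (h : Fin k → Sections n F V),
      (∀ i ∈ J, sectionSupport (h i) ⊆ C i) →
      (∀ i ∉ J, ∃ z ∈ C i, sectionSupport (h i) ⊆ Metric.ball z ε) → u h = 0 := by
    intro J
    induction J using Finset.induction_on with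
    | empty =>
      intro h _ h2
      choose z hz hzs using fun i => h2 i (Finset.notMem_empty i)
      obtain ⟨w, hw⟩ := hball z (fun i _ => hz i)
      refine hUz w.1 (fun i => w.2 i trivial) h fun i x hx => ?_
      have hx' : Function.update z i x ∈ Metric.ball z ε := by
        rw [Metric.mem_ball, dist_pi_lt_iff hε]
        intro j
        by_cases hj : j = i
        · subst hj
          simpa using hzs j hx
        · simpa [hj] using hε
      simpa using hw hx' i trivial
    | insert a J ha ih =>
      intro h h1 h2
      have h3 : h a ∈ {d : Sections n F V | u (Function.update h a d) = 0} := by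
        refine mem_of_locally_of_isCompact (Q := {d | u (Function.update h a d) = 0})
          (u.map_update_zero h a) (fun s hs t ht => ?_) (hC a)
          (fun x hx => ⟨Metric.ball x ε, Metric.isOpen_ball, Metric.mem_ball_self hε,
            fun s hs => ih _ (fun i hi => ?_) fun i hi => ?_⟩) (h1 a (Finset.mem_insert_self a J))
        · rw [mem_ofPred_eq] at hs ht ⊢
          rw [u.map_update_add, hs, ht, add_zero]
        · rw [Function.update_of_ne (ne_of_mem_of_not_mem hi ha)]
          exact h1 i (Finset.mem_insert_of_mem hi)
        · by_cases hia : i = a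
          · subst hia
            exact ⟨x, hx, by simpa using hs⟩
          · rw [Function.update_of_ne hia]
            exact h2 i (by simp [hia, hi])
      simpa using h3
  exact key Finset.univ h (fun i _ => hh i) (fun i hi => absurd (Finset.mem_univ i) hi)

theorem alternating_eq_zero_of_locally {k : ℕ} (u : AltDistribution n F V k)
    {C : Fin k → Set M} (hC : ∀ i, IsClosed (C i))
    (hloc : ∀ z : Fin k → M, (∀ i, z i ∈ C i) → z ∉ u.support) {h : Fin k → Sections n F V}
    (hh : ∀ i, sectionSupport (h i) ⊆ C i) : u h = 0 := by
  obtain ⟨χ, h1, h2⟩ := exists_cutoff_sequence n M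
  have h3 : Tendsto (fun m i => functionSmul (χ m) (h i)) atTop (𝓝 h) :=
    tendsto_pi_nhds.2 fun i => tendsto_functionSmul h2 (h i)
  refine tendsto_nhds_unique ((u.cont.tendsto h).comp h3)
    ((tendsto_const_nhds (x := (0 : ℂ))).congr fun m => ?_)
  refine (alternating_eq_zero_of_locally_of_isCompact u (fun i => (h1 m).inter_right (hC i))
    (fun z hz => hloc z fun i => (hz i).2) fun i => ?_).symm
  exact subset_inter (sectionSupport_functionSmul_subset_left _ _)
    ((sectionSupport_functionSmul_subset_right _ _).trans (hh i))

end Localization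

/-! ### From compact spacetime support to dependence on a compact set. -/

section Support

variable {n : ℕ} {M : Type*} [TopologicalSpace M] [ChartedSpace (EuclideanSpace ℝ (Fin n)) M]
  [IsManifold (𝓡 n) ∞ M]
  {F : Type*} [NormedAddCommGroup F] [NormedSpace ℝ F]
  {V : M → Type*} [TopologicalSpace (TotalSpace F V)] [∀ x, AddCommGroup (V x)]
  [∀ x, Module ℝ (V x)] [∀ x, TopologicalSpace (V x)] [FiberBundle F V] [VectorBundle ℝ F V]
  [ContMDiffVectorBundle ∞ F V (𝓡 n)]
  {F' : Type*} [NormedAddCommGroup F'] [NormedSpace ℝ F']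
  {W : M → Type*} [TopologicalSpace (TotalSpace F' W)] [∀ x, AddCommGroup (W x)]
  [∀ x, Module ℝ (W x)] [∀ x, TopologicalSpace (W x)] [FiberBundle F' W] [VectorBundle ℝ F' W]
  [ContMDiffVectorBundle ∞ F' W (𝓡 n)]

/-- The multivector field `X` and its values depend only on what happens in `K`. -/
structure SupportedOn {k : ℕ} (X : Sections n F V → AltDistribution n F' W k) (K : Set M) :
    Prop where
  congr (φ φ' : Sections n F V) : (∀ x ∈ K, φ x = φ' x) → X φ = X φ'
  eq_zero (φ : Sections n F V) (h : Fin k → Sections n F' W) (i : Fin k) :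
    (∀ x ∈ K, h i x = 0) → X φ h = 0

theorem dirDeriv_eq_zero_of_forall {A B : Type*} [AddCommGroup A] [Module ℝ A]
    [AddCommGroup B] [Module ℝ B] [TopologicalSpace B] [T2Space B] {f : A → B} {φ ψ : A}
    (h : ∀ t : ℝ, f (φ + t • ψ) = f φ) : dirDeriv f φ ψ = 0 :=
  Tendsto.limUnder_eq (by simp [h])

variable [T2Space M] {k : ℕ} {X : Sections n F V → AltDistribution n F' W k} {K : Set M}

theorem SupportedOn.multivectorSupport_subset (hX : SupportedOn X K) (hK : IsCompact K) :
    multivectorSupport X ⊆ K := by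
  cases k with
  | zero =>
    intro x hx
    by_contra hxK
    exact hx ⟨Kᶜ, hK.isClosed.isOpen_compl, hxK, fun φ φ' hφ =>
      hX.congr φ φ' fun y hy => hφ y fun hy' => hy' hy⟩
  | succ k =>
    refine closure_minimal (iUnion_subset fun φ => ?_) hK.isClosed
    rintro x (hx | ⟨z, hz, rfl⟩)
    · by_contra hxK
      refine hx ⟨Kᶜ, hK.isClosed.isOpen_compl, hxK, fun ψ hψ => ?_⟩
      refine dirDeriv_eq_zero_of_forall fun t => hX.congr _ _ fun y hy => ?_
      have h1 : ψ y = 0 := apply_eq_zero_of_notMem_sectionSupport fun hy' => hψ hy' hy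
      change φ y + t • ψ y = φ y
      rw [h1, smul_zero, add_zero]
    · by_contra hxK
      refine hz ⟨fun i => if i = 0 then Kᶜ else univ, fun i => ?_, fun h hh => ?_⟩
      · by_cases hi : i = 0
        · subst hi
          simpa using ⟨hK.isClosed, hxK⟩
        · simp [hi]
      · refine hX.eq_zero φ h 0 fun y hy => apply_eq_zero_of_notMem_sectionSupport fun hy' => ?_
        simpa [hy] using hh 0 hy'

theorem SupportedOn.isCompact_multivectorSupport (hX : SupportedOn X K) (hK : IsCompact K) :
    IsCompact (multivectorSupport X) :=
  hK.of_isClosed_subset (isClosed_multivectorSupport X) (hX.multivectorSupport_subset hK)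

theorem sectionSupport_subset_of_eq_zero {s : Sections n F V} (h : ∀ x ∈ K, s x = 0) :
    sectionSupport s ⊆ (interior K)ᶜ :=
  closure_minimal (fun x hx hxK => hx (h x (interior_subset hxK))) isOpen_interior.isClosed_compl

/-- A compact neighbourhood `K` of the support works: a section vanishing on `K` is supported off
the interior of `K`, where the local conditions defining the support hold, and these globalize. -/
theorem exists_supportedOn [SecondCountableTopology M] [CompleteSpace F] [CompleteSpace F']
    (hX : BastianiSmooth X) (hc : IsCompact (multivectorSupport X)) :
    ∃ K, IsCompact K ∧ SupportedOn X K := by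
  have : LocallyCompactSpace M := ChartedSpace.locallyCompactSpace (EuclideanSpace ℝ (Fin n)) M
  obtain ⟨K, hK, hSK⟩ := exists_compact_superset hc
  refine ⟨K, hK, ?_⟩
  have hcl : IsClosed (interior K)ᶜ := isOpen_interior.isClosed_compl
  have hdiff : ∀ φ φ' : Sections n F V, (∀ x ∈ K, φ x = φ' x) →
      sectionSupport (φ - φ') ⊆ (interior K)ᶜ := fun φ φ' h =>
    sectionSupport_subset_of_eq_zero fun x hx => sub_eq_zero.2 (h x hx)
  obtain ⟨D, hD⟩ := hX
  have hXc : Continuous X := by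
    refine ((hD.continuous 0).comp (f := fun φ => (φ, Fin.elim0)) (by fun_prop)).congr fun φ => ?_
    exact hD.zero _ _
  cases k with
  | zero =>
    refine ⟨fun φ φ' h => ?_, fun _ _ i => i.elim0⟩
    -- Quantifying over all base points `ψ` makes this condition additive in `d` although `X` is
    -- nonlinear.
    have h1 : φ - φ' ∈ {d : Sections n F V | ∀ ψ, X (ψ + d) = X ψ} := by
      refine mem_of_locally_of_isClosed ?_ (by simp) (fun s hs t ht ψ => ?_) hcl (fun x hx => ?_)
        (hdiff φ φ' h)
      · rw [ofPred_forall]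
        exact isClosed_iInter fun ψ => isClosed_eq (by fun_prop) continuous_const
      · rw [← add_assoc, ht, hs]
      · obtain ⟨U, hU, hxU, h2⟩ := notMem_compl_iff.1 fun hx' => hx (hSK hx')
        refine ⟨U, hU, hxU, fun s hs ψ => h2 _ _ fun y hy => ?_⟩
        change ψ y + s y = ψ y
        rw [apply_eq_zero_of_notMem_sectionSupport fun hy' => hy (hs hy'), add_zero]
    simpa using h1 φ'
  | succ k =>
    have hnot : ∀ x ∈ (interior K)ᶜ, ∀ φ, x ∉ distributionSupport (dirDeriv X φ) ∪
        (fun x => x 0) '' (X φ).support := fun x hx φ hx' =>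
      hx (hSK (subset_closure (mem_iUnion.2 ⟨φ, hx'⟩)))
    refine ⟨fun φ φ' h => ?_, fun φ h i hi => ?_⟩
    · have h1 : ∀ ψ, φ - φ' ∈ {d : Sections n F V | dirDeriv X ψ d = 0} := fun ψ => by
        refine mem_of_locally_of_isClosed ?_ (dirDeriv_eq_zero_of_forall (by simp))
          (fun s hs t ht => ?_) hcl (fun x hx => ?_) (hdiff φ φ' h)
        · simp only [hD.dirDeriv_eq]
          refine isClosed_eq ((hD.continuous 1).comp (f := fun d =>
            (ψ, (Fin.cons d Fin.elim0 : Fin 1 → Sections n F V))) ?_) continuous_const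
          exact continuous_const.prodMk (continuous_cons_left _)
        · rw [mem_ofPred_eq, hD.dirDeriv_eq] at hs ht ⊢
          refine ContinuousAlternatingMap.ext fun v => ?_
          rw [hD.scalar.first_add 0, hs, ht]
          exact add_zero _
        · obtain ⟨U, hU, hxU, h2⟩ := notMem_compl_iff.1 fun hx' => hnot x hx ψ (Or.inl hx')
          exact ⟨U, hU, hxU, h2⟩
      refine ContinuousAlternatingMap.ext fun v => ?_
      -- The derivative in direction `φ - φ'` vanishes everywhere, hence `X` is constant along the
      -- segment.
      have h2 := hD.scalar.sub_eq_integral 0 φ' (φ - φ') Fin.elim0 v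
      simp only [← cons_eq_snoc_fin_zero] at h2
      have h3 : ∀ ψ, D (0 + 1) ψ (Fin.cons (φ - φ') Fin.elim0) = 0 := fun ψ => by
        rw [← hD.dirDeriv_eq]
        exact h1 ψ
      simpa [h3, hD.zero, sub_eq_zero] using h2
    · have h1 : ∀ h : Fin (k + 1) → Sections n F' W, (∀ x ∈ K, h 0 x = 0) → X φ h = 0 := by
        intro h h0
        refine alternating_eq_zero_of_locally (X φ)
          (C := fun i => if i = 0 then (interior K)ᶜ else univ) (fun i => ?_) (fun z hz hz' => ?_)
          fun i => ?_
        · by_cases hi : i = 0 <;> simp [hi]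
        · exact hnot (z 0) (by simpa using hz 0) φ (Or.inr ⟨z, hz', rfl⟩)
        · by_cases hi : i = 0
          · subst hi
            simpa using sectionSupport_subset_of_eq_zero h0
          · simp [hi]
      by_cases hi0 : i = 0
      · exact h1 h (hi0 ▸ hi)
      -- The support only records the first variable; antisymmetry transfers the conclusion to the
      -- other slots.
      · have h2 := h1 (h ∘ Equiv.swap 0 i) (by simpa using hi)
        have h3 := (X φ).toAlternatingMap.map_swap h (Ne.symm hi0)
        rw [ContinuousAlternatingMap.coe_toAlternatingMap, h2] at h3
        exact neg_eq_zero.1 h3.symm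

end Support

/-! ## Derivatives of the Koszul differential and of the homotopy operator -/

theorem removeNth_castSucc_snoc {X : Type*} {m : ℕ} (i : Fin (m + 1)) (ψ : Fin (m + 1) → X)
    (χ : X) : i.castSucc.removeNth (Fin.snoc ψ χ : Fin (m + 2) → X) =
      (Fin.snoc (i.removeNth ψ) χ : Fin (m + 1) → X) := by
  funext j
  induction j using Fin.lastCases with
  | last => simp [Fin.removeNth_apply]
  | cast j => simp [Fin.removeNth_apply]

theorem removeNth_succ_cons {X : Type*} {m : ℕ} (i : Fin (m + 1)) (v : Fin (m + 1) → X)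
    (a : X) : i.succ.removeNth (Fin.cons a v : Fin (m + 2) → X) =
      (Fin.cons a (i.removeNth v) : Fin (m + 1) → X) := by
  funext j
  induction j using Fin.cases with
  | zero => simp [Fin.removeNth_apply]
  | succ j => simp [Fin.removeNth_apply]

section ScalarSequences

variable {A : Type*} [AddCommGroup A] [Module ℝ A] [TopologicalSpace A]
  [IsTopologicalAddGroup A] [ContinuousSMul ℝ A]
  {B : Type*} [AddCommGroup B] [Module ℝ B] [TopologicalSpace B]
  [IsTopologicalAddGroup B] [ContinuousSMul ℝ B] {k : ℕ}

theorem BastianiSmooth.dirDeriv_apply_eq {f : A → B [⋀^Fin k]→L[ℝ] ℂ}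
    {D : (m : ℕ) → A → (Fin m → A) → (Fin k → B) → ℂ} (hf : BastianiSmooth f)
    (hD : IsScalarDerivativeSequence f D) (φ χ : A) (h : Fin k → B) :
    dirDeriv f φ χ h = D 1 φ (Fin.cons χ Fin.elim0 : Fin 1 → A) h := by
  have h1 := ((continuous_eval_const (F := B [⋀^Fin k]→L[ℝ] ℂ) h).tendsto _).comp
    (hf.tendsto_dirDeriv φ χ)
  have h2 := hD.succ 0 φ Fin.elim0 χ h
  simp only [hD.zero, ← cons_eq_snoc_fin_zero] at h2
  exact tendsto_nhds_unique h1 h2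

/-- The iterated derivatives of the Koszul differential, by the Leibniz rule. -/
def koszulDerivative (P : A → B) (D : (m : ℕ) → A → (Fin m → A) → (Fin (k + 1) → B) → ℂ) :
    (m : ℕ) → A → (Fin m → A) → (Fin k → B) → ℂ
  | 0, φ, ψ, h => D 0 φ ψ (Fin.cons (P φ) h)
  | m + 1, φ, ψ, h => D (m + 1) φ ψ (Fin.cons (P φ) h) +
      ∑ i : Fin (m + 1), D m φ (i.removeNth ψ) (Fin.cons (P (ψ i)) h)

namespace IsScalarDerivativeSequence

theorem continuous_comp {k : ℕ} {f : A → B [⋀^Fin k]→L[ℝ] ℂ}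
    {D : (m : ℕ) → A → (Fin m → A) → (Fin k → B) → ℂ} (hD : IsScalarDerivativeSequence f D)
    {m : ℕ} {X : Type*} [TopologicalSpace X] {a : X → A} {b : X → Fin m → A} {c : X → Fin k → B}
    (ha : Continuous a) (hb : Continuous b) (hc : Continuous c) :
    Continuous fun x => D m (a x) (b x) (c x) :=
  (hD.continuous m).comp (ha.prodMk (hb.prodMk hc))

theorem map_cons_add {f : A → B [⋀^Fin (k + 1)]→L[ℝ] ℂ}
    {D : (m : ℕ) → A → (Fin m → A) → (Fin (k + 1) → B) → ℂ} (hD : IsScalarDerivativeSequence f D)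
    (m : ℕ) (φ : A) (ψ : Fin m → A) (b b' : B) (h : Fin k → B) :
    D m φ ψ (Fin.cons (b + b') h) = D m φ ψ (Fin.cons b h) + D m φ ψ (Fin.cons b' h) := by
  obtain ⟨T, hT⟩ := hD.exists_alternating m φ ψ
  simp only [← hT]
  have h1 := T.map_update_add (Fin.cons b h) 0 b b'
  simpa only [Fin.update_cons_zero] using h1

theorem map_cons_smul {f : A → B [⋀^Fin (k + 1)]→L[ℝ] ℂ}
    {D : (m : ℕ) → A → (Fin m → A) → (Fin (k + 1) → B) → ℂ} (hD : IsScalarDerivativeSequence f D)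
    (m : ℕ) (φ : A) (ψ : Fin m → A) (c : ℝ) (b : B) (h : Fin k → B) :
    D m φ ψ (Fin.cons (c • b) h) = c • D m φ ψ (Fin.cons b h) := by
  obtain ⟨T, hT⟩ := hD.exists_alternating m φ ψ
  simp only [← hT]
  have h1 := T.map_update_smul (Fin.cons b h) 0 c b
  simpa only [Fin.update_cons_zero] using h1

/-- Linearity of `P` makes the product rule exact: the factor `t` from `P (φ + t χ)` cancels `t⁻¹`
and leaves a continuous term. -/
theorem tendsto_slope_cons {f : A → B [⋀^Fin (k + 1)]→L[ℝ] ℂ}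
    {D : (m : ℕ) → A → (Fin m → A) → (Fin (k + 1) → B) → ℂ} (hD : IsScalarDerivativeSequence f D)
    (P : A →L[ℝ] B) (m : ℕ) (φ : A) (ψ : Fin m → A) (χ : A) (h : Fin k → B) :
    Tendsto (fun t : ℝ => t⁻¹ • (D m (φ + t • χ) ψ (Fin.cons (P (φ + t • χ)) h) -
      D m φ ψ (Fin.cons (P φ) h))) (𝓝[≠] 0)
      (𝓝 (D (m + 1) φ (Fin.snoc ψ χ) (Fin.cons (P φ) h) + D m φ ψ (Fin.cons (P χ) h))) := by
  have h1 : Continuous fun t : ℝ => D m (φ + t • χ) ψ (Fin.cons (P χ) h) :=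
    hD.continuous_comp (by fun_prop) continuous_const continuous_const
  have h2 := (h1.tendsto' 0 (D m φ ψ (Fin.cons (P χ) h)) (by simp)).mono_left
    (nhdsWithin_le_nhds (s := {0}ᶜ))
  refine ((hD.succ m φ ψ χ (Fin.cons (P φ) h)).add h2).congr' ?_
  filter_upwards [self_mem_nhdsWithin] with t ht
  rw [map_add, map_smul, hD.map_cons_add, hD.map_cons_smul, add_sub_right_comm, smul_add,
    smul_smul, inv_mul_cancel₀ ht, one_smul]

theorem koszul {f : A → B [⋀^Fin (k + 1)]→L[ℝ] ℂ}
    {D : (m : ℕ) → A → (Fin m → A) → (Fin (k + 1) → B) → ℂ} (hD : IsScalarDerivativeSequence f D)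
    (P : A →L[ℝ] B) : IsScalarDerivativeSequence (koszulDifferential (P : A →ₗ[ℝ] B) f)
      (koszulDerivative P D) where
  zero φ ψ h := hD.zero φ ψ _
  succ m φ ψ χ h := by
    cases m with
    | zero =>
      have h1 := hD.tendsto_slope_cons P 0 φ ψ χ h
      have h2 : koszulDerivative P D 1 φ (Fin.snoc ψ χ) h =
          D 1 φ (Fin.snoc ψ χ) (Fin.cons (P φ) h) + D 0 φ ψ (Fin.cons (P χ) h) := by
        rw [koszulDerivative, ← cons_eq_snoc_fin_zero]
        simp
      rw [h2]
      exact h1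
    | succ m =>
      have h1 := hD.tendsto_slope_cons P (m + 1) φ ψ χ h
      have h2 : ∀ i : Fin (m + 1), _ := fun i =>
        hD.succ m φ (i.removeNth ψ) χ (Fin.cons (P (ψ i)) h)
      -- The last summand of the Leibniz sum, where the new direction `χ` enters through `P χ`,
      -- joins the derivative of the leading term; the other summands are merely differentiated once
      -- more.
      have h3 : koszulDerivative P D (m + 2) φ (Fin.snoc ψ χ) h =
          (D (m + 2) φ (Fin.snoc ψ χ) (Fin.cons (P φ) h) + D (m + 1) φ ψ (Fin.cons (P χ) h)) +
          ∑ i : Fin (m + 1), D (m + 1) φ (Fin.snoc (i.removeNth ψ) χ)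
            (Fin.cons (P (ψ i)) h) := by
        rw [koszulDerivative, Fin.sum_univ_castSucc]
        simp only [removeNth_castSucc_snoc, Fin.snoc_castSucc, Fin.snoc_last, Fin.removeNth_last,
          Fin.init_snoc]
        ring
      rw [h3]
      refine (h1.add (tendsto_finsetSum Finset.univ fun i _ => h2 i)).congr fun t => ?_
      simp only [koszulDerivative]
      rw [← Finset.smul_sum, ← smul_add, Finset.sum_sub_distrib]
      congr 1
      ring
  continuous m := by
    have h1 : ∀ {X : Type _} [TopologicalSpace X] {b : X → B} {h : X → Fin k → B},
        Continuous b → Continuous h →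
          Continuous fun x => (Fin.cons (b x) (h x) : Fin (k + 1) → B) :=
      fun hb hh => Continuous.finCons (A := fun _ => B) hb hh
    cases m with
    | zero =>
      exact hD.continuous_comp continuous_fst (by fun_prop)
        (h1 (P.continuous.comp continuous_fst) (by fun_prop))
    | succ m =>
      refine (hD.continuous_comp continuous_fst (by fun_prop)
        (h1 (P.continuous.comp continuous_fst) (by fun_prop))).add
        (continuous_finsetSum _ fun i _ => ?_)
      refine hD.continuous_comp continuous_fst ?_ (h1 (P.continuous.comp (by fun_prop))
        (by fun_prop))
      exact continuous_pi fun j => by simp only [Fin.removeNth_apply]; fun_prop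

end IsScalarDerivativeSequence

/-- The integrals entering the derivatives of the homotopy operator. -/
def homotopyIntegral (γ : ℝ → A → A) (D : (m : ℕ) → A → (Fin m → A) → (Fin k → B) → ℂ) (m : ℕ)
    (φ : A) (ψ : Fin m → A) (a : A) (v : Fin k → B) : ℂ :=
  -- By the chain rule for the linear maps `γ l`, each differentiation in direction `ψ j` inserts `γ
  -- l (ψ j)`.
  ∫ l in (0 : ℝ)..1, D (m + 1) (γ l φ) (Fin.cons a fun j => γ l (ψ j) : Fin (m + 1) → A) v *
    (l : ℂ) ^ k

/-- The iterated derivatives of the homotopy operator. -/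
def homotopyDerivative (γ : ℝ → A → A) (α : B → A)
    (D : (m : ℕ) → A → (Fin m → A) → (Fin k → B) → ℂ) (m : ℕ)
    (φ : A) (ψ : Fin m → A) (h : Fin (k + 1) → B) : ℂ :=
  ∑ i : Fin (k + 1), (-1) ^ (i : ℕ) * homotopyIntegral γ D m φ ψ (α (h i)) (i.removeNth h)

namespace IsScalarDerivativeSequence

variable {f : A → B [⋀^Fin k]→L[ℝ] ℂ} {D : (m : ℕ) → A → (Fin m → A) → (Fin k → B) → ℂ}
  {γ : ℝ → A →L[ℝ] A}

theorem continuous_homotopyIntegrand (hD : IsScalarDerivativeSequence f D)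
    (hγ : Continuous fun p : ℝ × A => γ p.1 p.2) (m : ℕ) :
    Continuous fun q : (A × (Fin m → A) × A × (Fin k → B)) × ℝ =>
      D (m + 1) (γ q.2 q.1.1) (Fin.cons q.1.2.2.1 fun j => γ q.2 (q.1.2.1 j) : Fin (m + 1) → A)
        q.1.2.2.2 * (q.2 : ℂ) ^ k := by
  refine Continuous.mul (hD.continuous_comp ?_ ?_ (by fun_prop)) (by fun_prop)
  · exact hγ.comp (f := fun q : (A × (Fin m → A) × A × (Fin k → B)) × ℝ => (q.2, q.1.1))
      (by fun_prop)
  · refine Continuous.finCons (A := fun _ => A) (by fun_prop) (continuous_pi fun j => ?_)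
    exact hγ.comp (f := fun q : (A × (Fin m → A) × A × (Fin k → B)) × ℝ => (q.2, q.1.2.1 j))
      (by fun_prop)

theorem continuous_homotopyIntegral (hD : IsScalarDerivativeSequence f D)
    (hγ : Continuous fun p : ℝ × A => γ p.1 p.2) (m : ℕ) :
    Continuous fun q : A × (Fin m → A) × A × (Fin k → B) =>
      homotopyIntegral (fun l => γ l) D m q.1 q.2.1 q.2.2.1 q.2.2.2 :=
  intervalIntegral.continuous_parametric_intervalIntegral_of_continuous'
    (hD.continuous_homotopyIntegrand hγ m) 0 1

theorem intervalIntegrable_homotopyIntegrand (hD : IsScalarDerivativeSequence f D)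
    (hγ : Continuous fun p : ℝ × A => γ p.1 p.2) (m : ℕ) (φ : A) (ψ : Fin m → A) (a : A)
    (v : Fin k → B) : IntervalIntegrable (fun l : ℝ => D (m + 1) (γ l φ)
      (Fin.cons a fun j => γ l (ψ j) : Fin (m + 1) → A) v * (l : ℂ) ^ k) MeasureTheory.volume 0 1 :=
  Continuous.intervalIntegrable ((hD.continuous_homotopyIntegrand hγ m).comp
    (f := fun l : ℝ => ((φ, ψ, a, v), l)) (by fun_prop)) 0 1

theorem exists_alternating_homotopyIntegral (hD : IsScalarDerivativeSequence f D)
    (hγ : Continuous fun p : ℝ × A => γ p.1 p.2) (m : ℕ) (φ : A) (ψ : Fin m → A) :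
    ∃ T : A →ₗ[ℝ] B [⋀^Fin k]→ₗ[ℝ] ℂ,
      ∀ a v, T a v = homotopyIntegral (fun l => γ l) D m φ ψ a v := by
  choose T hT using hD.exists_alternating (m + 1)
  have hi := hD.intervalIntegrable_homotopyIntegrand hγ m φ ψ
  let S : A → B [⋀^Fin k]→ₗ[ℝ] ℂ := fun a =>
    { toFun := fun v => homotopyIntegral (fun l => γ l) D m φ ψ a v
      map_update_add' := by
        intro _ v i x y
        rw [homotopyIntegral, homotopyIntegral, homotopyIntegral,
          ← intervalIntegral.integral_add (hi _ _) (hi _ _)]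
        simp only [← hT, ContinuousAlternatingMap.map_update_add, add_mul]
      map_update_smul' := by
        intro _ v i c x
        rw [homotopyIntegral, homotopyIntegral, ← intervalIntegral.integral_smul]
        simp only [← hT, ContinuousAlternatingMap.map_update_smul, smul_mul_assoc]
      map_eq_zero_of_eq' := by
        intro v i j hij hne
        rw [homotopyIntegral]
        simp only [← hT, ContinuousAlternatingMap.map_eq_zero_of_eq _ v hij hne, zero_mul,
          intervalIntegral.integral_zero] }
  refine ⟨{ toFun := S, map_add' := fun a b => ?_, map_smul' := fun c a => ?_ }, fun a v => rfl⟩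
  · ext v
    change homotopyIntegral _ D m φ ψ (a + b) v = homotopyIntegral _ D m φ ψ a v +
      homotopyIntegral _ D m φ ψ b v
    rw [homotopyIntegral, homotopyIntegral, homotopyIntegral,
      ← intervalIntegral.integral_add (hi _ _) (hi _ _)]
    simp only [hD.first_add, add_mul]
  · ext v
    change homotopyIntegral _ D m φ ψ (c • a) v = c • homotopyIntegral _ D m φ ψ a v
    rw [homotopyIntegral, homotopyIntegral, ← intervalIntegral.integral_smul]
    simp only [hD.first_smul, smul_mul_assoc]

theorem tendsto_slope_homotopyIntegral (hD : IsScalarDerivativeSequence f D)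
    (hγ : Continuous fun p : ℝ × A => γ p.1 p.2) (m : ℕ) (φ : A) (ψ : Fin m → A) (χ a : A)
    (v : Fin k → B) :
    Tendsto (fun t : ℝ => t⁻¹ • (homotopyIntegral (fun l => γ l) D m (φ + t • χ) ψ a v -
      homotopyIntegral (fun l => γ l) D m φ ψ a v)) (𝓝[≠] 0)
      (𝓝 (homotopyIntegral (fun l => γ l) D (m + 1) φ (Fin.snoc ψ χ) a v)) := by
  have hsnoc : ∀ l : ℝ, (fun j => γ l ((Fin.snoc ψ χ : Fin (m + 1) → A) j)) =
      (Fin.snoc (fun j => γ l (ψ j)) (γ l χ) : Fin (m + 1) → A) := fun l => by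
    funext j
    induction j using Fin.lastCases with
    | last => simp
    | cast j => simp
  -- For `t ≠ 0` this is the difference quotient of the integrand without the weight. Its joint
  -- continuity up to `t = 0` justifies differentiation under the integral.
  let E : ℝ → ℝ → ℂ := fun t l => ∫ s in (0 : ℝ)..1, D (m + 2) (γ l φ + s • (t • γ l χ))
    (Fin.snoc (Fin.cons a fun j => γ l (ψ j) : Fin (m + 1) → A) (γ l χ)) v
  have hE : Continuous fun p : ℝ × ℝ => E p.1 p.2 := by
    refine intervalIntegral.continuous_parametric_intervalIntegral_of_continuous' ?_ 0 1
    have h1 : ∀ a : A, Continuous fun q : (ℝ × ℝ) × ℝ => γ q.1.2 a := fun a =>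
      hγ.comp (f := fun q : (ℝ × ℝ) × ℝ => (q.1.2, a)) (by fun_prop)
    refine hD.continuous_comp ?_ ?_ continuous_const
    · have := h1 φ
      have := h1 χ
      fun_prop
    · exact Continuous.finSnoc (A := fun _ => A) (Continuous.finCons (A := fun _ => A)
        continuous_const (continuous_pi fun j => h1 (ψ j))) (h1 χ)
  have hEint : Continuous fun t : ℝ => ∫ l in (0 : ℝ)..1, E t l * (l : ℂ) ^ k := by
    refine intervalIntegral.continuous_parametric_intervalIntegral_of_continuous' ?_ 0 1
    exact hE.mul (by fun_prop)
  refine ((hEint.tendsto' 0 (homotopyIntegral (fun l => γ l) D (m + 1) φ (Fin.snoc ψ χ) a v)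
    ?_).mono_left nhdsWithin_le_nhds).congr' ?_
  · simp only [homotopyIntegral, E, zero_smul, smul_zero, add_zero, hsnoc,
      Fin.cons_snoc_eq_snoc_cons, intervalIntegral.integral_const, sub_zero, one_smul]
  · filter_upwards [self_mem_nhdsWithin] with t ht
    have hi := hD.intervalIntegrable_homotopyIntegrand hγ m
    rw [homotopyIntegral, homotopyIntegral, ← intervalIntegral.integral_sub (hi _ _ _ _)
      (hi _ _ _ _), ← intervalIntegral.integral_smul]
    refine intervalIntegral.integral_congr fun l _ => ?_
    have h1 := hD.sub_eq_integral (m + 1) (γ l φ) (t • γ l χ)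
      (Fin.cons a fun j => γ l (ψ j) : Fin (m + 1) → A) v
    simp only [hD.last_smul, intervalIntegral.integral_smul] at h1
    change E t l * (l : ℂ) ^ k = t⁻¹ • (_ * _ - _ * _)
    rw [← sub_mul, map_add, map_smul, h1, smul_mul_assoc, smul_smul, inv_mul_cancel₀ ht, one_smul]

theorem continuous_homotopyDerivative (hD : IsScalarDerivativeSequence f D)
    (hγ : Continuous fun p : ℝ × A => γ p.1 p.2) (α : B →L[ℝ] A) (m : ℕ) :
    Continuous fun p : A × (Fin m → A) × (Fin (k + 1) → B) =>
      homotopyDerivative (fun l => γ l) α D m p.1 p.2.1 p.2.2 := by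
  refine continuous_finsetSum _ fun i _ => continuous_const.mul ?_
  refine (hD.continuous_homotopyIntegral hγ m).comp
    (f := fun p : A × (Fin m → A) × (Fin (k + 1) → B) =>
      (p.1, p.2.1, α (p.2.2 i), i.removeNth p.2.2)) ?_
  refine continuous_fst.prodMk (Continuous.prodMk (by fun_prop) (Continuous.prodMk
    (α.continuous.comp (by fun_prop)) (continuous_pi fun j => ?_)))
  simp only [Fin.removeNth_apply]
  fun_prop

theorem exists_alternating_homotopy (hD : IsScalarDerivativeSequence f D)
    (hγ : Continuous fun p : ℝ × A => γ p.1 p.2) (α : B →L[ℝ] A) (m : ℕ) (φ : A)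
    (ψ : Fin m → A) : ∃ T : B [⋀^Fin (k + 1)]→L[ℝ] ℂ,
      ∀ h, T h = homotopyDerivative (fun l => γ l) α D m φ ψ h := by
  obtain ⟨S, hS⟩ := hD.exists_alternating_homotopyIntegral hγ m φ ψ
  -- The signed sum over the removed slots is the alternatization of `b ↦ S (α b)`, so antisymmetry
  -- needs no separate computation.
  let T := AlternatingMap.alternatizeUncurryFin (S.comp (α : B →ₗ[ℝ] A))
  have hT : ∀ h, T h = homotopyDerivative (fun l => γ l) α D m φ ψ h := fun h => by
    rw [AlternatingMap.alternatizeUncurryFin_apply, homotopyDerivative]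
    refine Finset.sum_congr rfl fun i _ => ?_
    simp [hS]
  refine ⟨⟨⟨T.toMultilinearMap, ?_⟩, T.map_eq_zero_of_eq'⟩, hT⟩
  exact ((hD.continuous_homotopyDerivative hγ α m).comp
    (f := fun h => (φ, ψ, h)) (by fun_prop)).congr fun h => (hT h).symm

theorem homotopy (hD : IsScalarDerivativeSequence f D)
    (hγ : Continuous fun p : ℝ × A => γ p.1 p.2) (α : B →L[ℝ] A)
    {Z : A → B [⋀^Fin (k + 1)]→L[ℝ] ℂ}
    (hZ : ∀ φ h, Z φ h = homotopyDerivative (fun l => γ l) α D 0 φ Fin.elim0 h) :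
    IsScalarDerivativeSequence Z (homotopyDerivative (fun l => γ l) α D) where
  zero φ ψ h := by rw [hZ, Subsingleton.elim ψ]
  succ m φ ψ χ h := by
    refine (tendsto_finsetSum Finset.univ fun i _ => (hD.tendsto_slope_homotopyIntegral hγ m φ ψ χ
      (α (h i)) (i.removeNth h)).const_mul ((-1) ^ (i : ℕ))).congr fun t => ?_
    simp only [homotopyDerivative]
    rw [← Finset.sum_sub_distrib, Finset.smul_sum]
    refine Finset.sum_congr rfl fun i _ => ?_
    rw [mul_smul_comm, mul_sub]
  continuous m := hD.continuous_homotopyDerivative hγ α m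

end IsScalarDerivativeSequence

end ScalarSequences

/-! ## The homotopy identities -/

section Identities

variable {A : Type*} [AddCommGroup A] [Module ℝ A] [TopologicalSpace A]
  [IsTopologicalAddGroup A] [ContinuousSMul ℝ A]
  {B : Type*} [AddCommGroup B] [Module ℝ B] [TopologicalSpace B]
  [IsTopologicalAddGroup B] [ContinuousSMul ℝ B] {k : ℕ}

/-- The family of maps contracting `A` to the kernel of `P`, for a right inverse `α` of `P`. -/
def contraction (P : A →L[ℝ] B) (α : B →L[ℝ] A) (l : ℝ) : A →L[ℝ] A :=
  ContinuousLinearMap.id ℝ A + (l - 1) • α.comp P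

/-- The formula of the homotopy operator, for an arbitrary right inverse and contraction. -/
def homotopySum (α : B → A) (γ : ℝ → A → A) (Y : A → B [⋀^Fin k]→L[ℝ] ℂ) (φ : A)
    (h : Fin (k + 1) → B) : ℂ :=
  ∑ i : Fin (k + 1), (-1) ^ (i : ℕ) * ∫ l in (0 : ℝ)..1,
    dirDeriv Y (γ l φ) (α (h i)) (i.removeNth h) * (l : ℂ) ^ k

variable {P : A →L[ℝ] B} {α : B →L[ℝ] A}

theorem contraction_apply (l : ℝ) (φ : A) :
    contraction P α l φ = φ + (l - 1) • α (P φ) := rfl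

theorem continuous_contraction : Continuous fun p : ℝ × A => contraction P α p.1 p.2 := by
  have := P.continuous
  have := α.continuous
  simp only [contraction_apply]
  fun_prop

/-- The orbit of `φ` is a straight line with velocity `α (P φ)`, so derivatives in `l` are
directional derivatives. -/
theorem contraction_eq_line (l : ℝ) (φ : A) :
    contraction P α l φ = contraction P α 0 φ + l • α (P φ) := by
  rw [contraction_apply, contraction_apply, add_assoc, ← add_smul]
  congr 2
  ring

theorem contraction_one (φ : A) : contraction P α 1 φ = φ := by simp [contraction_apply]

theorem apply_contraction (hα : ∀ h, P (α h) = h) (l : ℝ) (φ : A) :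
    P (contraction P α l φ) = l • P φ := by
  rw [contraction_apply, map_add, map_smul, hα, sub_smul, one_smul, add_sub_cancel]

theorem neg_one_pow_mul_apply_cons_removeNth (u : B [⋀^Fin (k + 1)]→L[ℝ] ℂ) (i : Fin (k + 1))
    (h : Fin (k + 1) → B) :
    (-1) ^ (i : ℕ) * u (Fin.cons (h i) (i.removeNth h)) = u h := by
  have h1 := u.toAlternatingMap.map_insertNth i (h i) (i.removeNth h)
  rw [Fin.insertNth_self_removeNth] at h1
  change u h = (-1 : ℤ) ^ (i : ℕ) • u (Fin.cons (h i) (i.removeNth h)) at h1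
  rw [h1, zsmul_eq_mul]
  push_cast
  rfl

section FirstCountable

variable [FirstCountableTopology A] [FirstCountableTopology B]

theorem homotopySum_eq_homotopyDerivative {Y : A → B [⋀^Fin k]→L[ℝ] ℂ} (hY : BastianiSmooth Y)
    {D : (m : ℕ) → A → (Fin m → A) → (Fin k → B) → ℂ} (hD : IsScalarDerivativeSequence Y D)
    (α : B → A) (γ : ℝ → A → A) (φ : A) (h : Fin (k + 1) → B) :
    homotopySum α γ Y φ h = homotopyDerivative γ α D 0 φ Fin.elim0 h := by
  simp only [homotopySum, homotopyDerivative, homotopyIntegral, hY.dirDeriv_apply_eq hD]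
  refine Finset.sum_congr rfl fun i _ => ?_
  congr 1
  refine intervalIntegral.integral_congr fun l _ => ?_
  congr 3
  exact Subsingleton.elim _ _

theorem BastianiSmooth.continuous_apply {Y : A → B [⋀^Fin k]→L[ℝ] ℂ} (hY : BastianiSmooth Y)
    (v : Fin k → B) : Continuous fun φ => Y φ v := by
  obtain ⟨D, hD⟩ := hY
  simp only [← hD.scalar.zero _ Fin.elim0]
  exact hD.scalar.continuous_comp continuous_id continuous_const continuous_const

theorem BastianiSmooth.continuous_dirDeriv_apply {Y : A → B [⋀^Fin k]→L[ℝ] ℂ}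
    (hY : BastianiSmooth Y) (a : A) (v : Fin k → B) : Continuous fun φ => dirDeriv Y φ a v := by
  obtain ⟨D, hD⟩ := id hY
  simp only [hY.dirDeriv_apply_eq hD.scalar]
  exact hD.scalar.continuous_comp continuous_id continuous_const continuous_const

theorem BastianiSmooth.hasDerivAt_line {Y : A → B [⋀^Fin k]→L[ℝ] ℂ} (hY : BastianiSmooth Y)
    (φ a : A) (v : Fin k → B) (l : ℝ) :
    HasDerivAt (fun t : ℝ => Y (φ + t • a) v) (dirDeriv Y (φ + l • a) a v) l :=
  Koszul.hasDerivAt_line (G := fun φ => Y φ v)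
    (((continuous_eval_const (F := B [⋀^Fin k]→L[ℝ] ℂ) v).tendsto _).comp
      (hY.tendsto_dirDeriv (φ + l • a) a))

theorem BastianiSmooth.continuous_dirDeriv_contraction {Y : A → B [⋀^Fin k]→L[ℝ] ℂ}
    (hY : BastianiSmooth Y) (φ a : A) (v : Fin k → B) :
    Continuous fun l : ℝ => dirDeriv Y (contraction P α l φ) a v :=
  (hY.continuous_dirDeriv_apply a v).comp
    (continuous_contraction.comp (f := fun l : ℝ => (l, φ)) (by fun_prop))

theorem BastianiSmooth.hasDerivAt_contraction {Y : A → B [⋀^Fin k]→L[ℝ] ℂ}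
    (hY : BastianiSmooth Y) (φ : A) (v : Fin k → B) (l : ℝ) :
    HasDerivAt (fun l : ℝ => Y (contraction P α l φ) v)
      (dirDeriv Y (contraction P α l φ) (α (P φ)) v) l := by
  have h1 := hY.hasDerivAt_line (contraction P α 0 φ) (α (P φ)) v l
  rw [← contraction_eq_line] at h1
  exact h1.congr_of_eventuallyEq (Eventually.of_forall fun t =>
    congrArg (fun ψ => Y ψ v) (contraction_eq_line t φ))

theorem intervalIntegrable_mul_pow {u : ℝ → ℂ} (hu : Continuous u) (j : ℕ) :
    IntervalIntegrable (fun l : ℝ => u l * (l : ℂ) ^ j) MeasureTheory.volume 0 1 :=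
  (hu.mul (by fun_prop)).intervalIntegrable _ _

theorem homotopySum_add {Y Y' : A → B [⋀^Fin k]→L[ℝ] ℂ} (hY : BastianiSmooth Y)
    (hY' : BastianiSmooth Y') (φ : A) (h : Fin (k + 1) → B) :
    homotopySum α (fun l => contraction P α l) (Y + Y') φ h =
      homotopySum α (fun l => contraction P α l) Y φ h +
        homotopySum α (fun l => contraction P α l) Y' φ h := by
  simp only [homotopySum]
  rw [← Finset.sum_add_distrib]
  refine Finset.sum_congr rfl fun i _ => ?_
  rw [← mul_add, ← intervalIntegral.integral_add
    (intervalIntegrable_mul_pow (hY.continuous_dirDeriv_contraction _ _ _) _)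
    (intervalIntegrable_mul_pow (hY'.continuous_dirDeriv_contraction _ _ _) _)]
  simp only [dirDeriv_add hY hY', ContinuousAlternatingMap.add_apply, add_mul]

theorem homotopySum_smul (c : ℂ) {Y : A → B [⋀^Fin k]→L[ℝ] ℂ} (hY : BastianiSmooth Y)
    (γ : ℝ → A → A) (φ : A) (h : Fin (k + 1) → B) :
    homotopySum α γ (c • Y) φ h = c • homotopySum α γ Y φ h := by
  simp only [homotopySum, dirDeriv_const_smul c hY, ContinuousAlternatingMap.smul_apply,
    smul_mul_assoc, intervalIntegral.integral_smul, Finset.smul_sum, mul_smul_comm]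

theorem dirDeriv_koszulDifferential {X : A → B [⋀^Fin (k + 1)]→L[ℝ] ℂ} (hX : BastianiSmooth X)
    (hX' : BastianiSmooth (koszulDifferential (P : A →ₗ[ℝ] B) X)) (φ a : A) (v : Fin k → B) :
    dirDeriv (koszulDifferential (P : A →ₗ[ℝ] B) X) φ a v =
      dirDeriv X φ a (Fin.cons (P φ) v) + X φ (Fin.cons (P a) v) := by
  obtain ⟨D, hD⟩ := id hX
  rw [hX'.dirDeriv_apply_eq (hD.scalar.koszul P), hX.dirDeriv_apply_eq hD.scalar,
    koszulDerivative]
  simp [hD.zero]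

/-- In degree zero the weight is `l ^ 0 = 1`, so the lower endpoint survives in the fundamental
theorem of calculus. -/
theorem sub_eq_homotopySum {X : A → B [⋀^Fin 0]→L[ℝ] ℂ} (hX : BastianiSmooth X) (φ : A)
    (h : Fin 0 → B) : X φ h - X (contraction P α 0 φ) h =
      homotopySum α (fun l => contraction P α l) X φ (Fin.cons (P φ) h) := by
  have h2 := intervalIntegral.integral_eq_sub_of_hasDerivAt (a := 0) (b := 1)
    (fun l _ => hX.hasDerivAt_contraction (P := P) (α := α) φ h l)
    ((hX.continuous_dirDeriv_contraction _ _ _).intervalIntegrable _ _)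
  rw [contraction_one] at h2
  rw [← h2, homotopySum]
  simp

/-- Since `X` has degree `k + 1`, its own homotopy carries the weight `l ^ (k + 1)` and that of its
Koszul differential the weight `l ^ k`. The missing factor `l` comes from `P γ_l = l P`, which makes
the mixed terms cancel. -/
theorem eq_homotopySum_add {X : A → B [⋀^Fin (k + 1)]→L[ℝ] ℂ} (hX : BastianiSmooth X)
    (hX' : BastianiSmooth (koszulDifferential (P : A →ₗ[ℝ] B) X)) (hα : ∀ h, P (α h) = h)
    (φ : A) (h : Fin (k + 1) → B) :
    X φ h = homotopySum α (fun l => contraction P α l) X φ (Fin.cons (P φ) h) +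
      homotopySum α (fun l => contraction P α l) (koszulDifferential (P : A →ₗ[ℝ] B) X) φ h := by
  set γ := contraction P α with hγ
  have hc : ∀ a v, Continuous fun l : ℝ => dirDeriv X (γ l φ) a v :=
    hX.continuous_dirDeriv_contraction φ
  have hc0 : ∀ v, Continuous fun l : ℝ => X (γ l φ) v := fun v =>
    (hX.continuous_apply v).comp
      (continuous_contraction.comp (f := fun l : ℝ => (l, φ)) (by fun_prop))
  -- The fundamental theorem is applied to `l ^ (k + 1) X(γ_l φ){h}`, which vanishes at `l = 0`.
  have hftc : X φ h = (∫ l in (0 : ℝ)..1, dirDeriv X (γ l φ) (α (P φ)) h * (l : ℂ) ^ (k + 1)) +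
      (k + 1) * ∫ l in (0 : ℝ)..1, X (γ l φ) h * (l : ℂ) ^ k := by
    have h1 : ∀ l ∈ uIcc (0 : ℝ) 1, HasDerivAt (fun l : ℝ => X (γ l φ) h * (l : ℂ) ^ (k + 1))
        (dirDeriv X (γ l φ) (α (P φ)) h * (l : ℂ) ^ (k + 1) +
          (k + 1) * (X (γ l φ) h * (l : ℂ) ^ k)) l := fun l _ => by
      have h3 : HasDerivAt (fun l : ℝ => (l : ℂ) ^ (k + 1)) ((k + 1) * (l : ℂ) ^ k) l := by
        simpa using (hasDerivAt_pow (k + 1) (l : ℂ)).comp_ofReal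
      refine ((hX.hasDerivAt_contraction φ h l).mul h3).congr_deriv ?_
      ring
    have h4 := intervalIntegral.integral_eq_sub_of_hasDerivAt h1
      ((intervalIntegrable_mul_pow (hc _ _) _).add ((intervalIntegrable_mul_pow (hc0 _) _).const_mul _))
    rw [intervalIntegral.integral_add (intervalIntegrable_mul_pow (hc _ _) _) ((intervalIntegrable_mul_pow (hc0 _) _).const_mul _),
      intervalIntegral.integral_const_mul] at h4
    rw [h4]
    simp [hγ, contraction_one]
  -- The slot of `P φ` gives the leading term; the other slots are shifted by one, which reverses
  -- their signs.
  have h1 : homotopySum α (fun l => γ l) X φ (Fin.cons (P φ) h) =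
      (∫ l in (0 : ℝ)..1, dirDeriv X (γ l φ) (α (P φ)) h * (l : ℂ) ^ (k + 1)) -
        ∑ i : Fin (k + 1), (-1) ^ (i : ℕ) * ∫ l in (0 : ℝ)..1,
          dirDeriv X (γ l φ) (α (h i)) (Fin.cons (P φ) (i.removeNth h)) * (l : ℂ) ^ (k + 1) := by
    rw [homotopySum, Fin.sum_univ_succ, sub_eq_add_neg, ← Finset.sum_neg_distrib]
    congr 1
    · simp
    · refine Finset.sum_congr rfl fun i _ => ?_
      rw [removeNth_succ_cons, Fin.cons_succ, Fin.val_succ, pow_succ]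
      ring
  have h2 : homotopySum α (fun l => γ l) (koszulDifferential (P : A →ₗ[ℝ] B) X) φ h =
      (∑ i : Fin (k + 1), (-1) ^ (i : ℕ) * ∫ l in (0 : ℝ)..1,
        dirDeriv X (γ l φ) (α (h i)) (Fin.cons (P φ) (i.removeNth h)) * (l : ℂ) ^ (k + 1)) +
      (k + 1) * ∫ l in (0 : ℝ)..1, X (γ l φ) h * (l : ℂ) ^ k := by
    -- Moving `h i` back to its place absorbs the sign, so all `k + 1` summands are equal.
    have h3 : ((k : ℂ) + 1) * ∫ l in (0 : ℝ)..1, X (γ l φ) h * (l : ℂ) ^ k =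
        ∑ i : Fin (k + 1), (-1) ^ (i : ℕ) * ∫ l in (0 : ℝ)..1,
          X (γ l φ) (Fin.cons (h i) (i.removeNth h)) * (l : ℂ) ^ k := by
      have h4 : ∀ i : Fin (k + 1), (-1) ^ (i : ℕ) * (∫ l in (0 : ℝ)..1,
          X (γ l φ) (Fin.cons (h i) (i.removeNth h)) * (l : ℂ) ^ k) =
            ∫ l in (0 : ℝ)..1, X (γ l φ) h * (l : ℂ) ^ k := fun i => by
        rw [← intervalIntegral.integral_const_mul]
        simp only [← mul_assoc, neg_one_pow_mul_apply_cons_removeNth]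
      simp [h4]
    rw [h3, ← Finset.sum_add_distrib, homotopySum]
    refine Finset.sum_congr rfl fun i _ => ?_
    rw [← mul_add, ← intervalIntegral.integral_add (intervalIntegrable_mul_pow (hc _ _) _) (intervalIntegrable_mul_pow (hc0 _) _)]
    congr 1
    refine intervalIntegral.integral_congr fun l _ => ?_
    have h4 : (Fin.cons (P (γ l φ)) (i.removeNth h) : Fin (k + 1) → B) =
        Function.update (Fin.cons (P φ) (i.removeNth h)) 0 (l • P φ) := by
      rw [Fin.update_cons_zero, apply_contraction hα]
    have h5 : dirDeriv X (γ l φ) (α (h i)) (Fin.cons (P (γ l φ)) (i.removeNth h)) =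
        l • dirDeriv X (γ l φ) (α (h i)) (Fin.cons (P φ) (i.removeNth h)) := by
      rw [h4, ContinuousAlternatingMap.map_update_smul, Fin.update_cons_zero]
    change dirDeriv (koszulDifferential (P : A →ₗ[ℝ] B) X) (γ l φ) (α (h i)) (i.removeNth h) *
      (l : ℂ) ^ k = _
    rw [dirDeriv_koszulDifferential hX hX', hα, h5, Complex.real_smul]
    ring
  rw [h1, h2, hftc]
  ring

end FirstCountable

end Identities

/-! ## The Koszul complex of multivector fields -/

section Complex

variable {n : ℕ} {M : Type*} [TopologicalSpace M] [ChartedSpace (EuclideanSpace ℝ (Fin n)) M]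
  [IsManifold (𝓡 n) ∞ M]
  {F : Type*} [NormedAddCommGroup F] [NormedSpace ℝ F]
  {V : M → Type*} [TopologicalSpace (TotalSpace F V)] [∀ x, AddCommGroup (V x)]
  [∀ x, Module ℝ (V x)] [∀ x, TopologicalSpace (V x)] [FiberBundle F V] [VectorBundle ℝ F V]
  [ContMDiffVectorBundle ∞ F V (𝓡 n)]
  {F' : Type*} [NormedAddCommGroup F'] [NormedSpace ℝ F']
  {W : M → Type*} [TopologicalSpace (TotalSpace F' W)] [∀ x, AddCommGroup (W x)]
  [∀ x, Module ℝ (W x)] [∀ x, TopologicalSpace (W x)] [FiberBundle F' W] [VectorBundle ℝ F' W]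
  [ContMDiffVectorBundle ∞ F' W (𝓡 n)]
  [T2Space M] [SecondCountableTopology M] [FiniteDimensional ℝ F] [CompleteSpace F]
  [FiniteDimensional ℝ F'] [CompleteSpace F']

/-- The values of `T s` on a compact set are determined by the values of `s` on some compact
set. -/
def PropagatesCompactly (T : Sections n F V → Sections n F' W) : Prop :=
  ∀ K : Set M, IsCompact K → ∃ K' : Set M, IsCompact K' ∧
    ∀ s, (∀ x ∈ K', s x = 0) → ∀ x ∈ K, T s x = 0

theorem IsDifferentialOperator.propagatesCompactly {P : Sections n F V →ₗ[ℝ] Sections n F' W}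
    (hP : IsDifferentialOperator P) : PropagatesCompactly P := fun K hK => by
  have : LocallyCompactSpace M := ChartedSpace.locallyCompactSpace (EuclideanSpace ℝ (Fin n)) M
  obtain ⟨K', hK', hKK'⟩ := exists_compact_superset hK
  refine ⟨K', hK', fun s hs x hx => apply_eq_zero_of_notMem_sectionSupport fun hx' => ?_⟩
  exact sectionSupport_subset_of_eq_zero hs (hP.sectionSupport_subset s hx') (hKK' hx)

variable {P : Sections n F V →L[ℝ] Sections n F' W} {α : Sections n F' W →L[ℝ] Sections n F V}
  {k : ℕ}

theorem sub_eq_zero_on {K : Set M} {s t : Sections n F V} :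
    (∀ x ∈ K, (s - t) x = 0) ↔ ∀ x ∈ K, s x = t x :=
  forall₂_congr fun _ _ => sub_eq_zero

theorem SupportedOn.koszulDifferential (hP : PropagatesCompactly P)
    {X : Sections n F V → AltDistribution n F' W (k + 1)} {K : Set M} (hK : IsCompact K)
    (hX : SupportedOn X K) : ∃ K', IsCompact K' ∧
      SupportedOn (koszulDifferential (P : Sections n F V →ₗ[ℝ] Sections n F' W) X) K' := by
  obtain ⟨K', hK', hKK'⟩ := hP K hK
  refine ⟨K ∪ K', hK.union hK', fun φ φ' h => ContinuousAlternatingMap.ext fun v => ?_,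
    fun φ h i hi => hX.eq_zero φ _ i.succ fun x hx => hi x (Or.inl hx)⟩
  change X φ (Fin.cons (P φ) v) = X φ' (Fin.cons (P φ') v)
  rw [hX.congr φ φ' fun x hx => h x (Or.inl hx)]
  have h1 := (X φ').map_update_sub (Fin.cons (P φ) v) 0 (P φ) (P φ')
  simp only [Fin.update_cons_zero] at h1
  rw [← sub_eq_zero, ← h1]
  refine hX.eq_zero φ' _ 0 fun x hx => ?_
  rw [Fin.cons_zero, ← map_sub]
  exact hKK' _ (sub_eq_zero_on.2 fun y hy => h y (Or.inr hy)) x hx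

theorem bastianiSmooth_koszulDifferential {X : Sections n F V → AltDistribution n F' W (k + 1)}
    (hX : BastianiSmooth X) :
    BastianiSmooth (koszulDifferential (P : Sections n F V →ₗ[ℝ] Sections n F' W) X) := by
  obtain ⟨D, hD⟩ := hX
  exact (hD.scalar.koszul P).bastianiSmooth

/-- The Koszul differential on multivector fields. -/
def koszulMap {P : Sections n F V →ₗ[ℝ] Sections n F' W} (hPc : Continuous P)
    (hP : PropagatesCompactly P) (k : ℕ) : multivectorFields n F V F' W (k + 1) →ₗ[ℂ]
      multivectorFields n F V F' W k where
  toFun X := ⟨koszulDifferential P X.1,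
    bastianiSmooth_koszulDifferential (P := ⟨P, hPc⟩) X.2.1, by
      obtain ⟨K, hK, hX⟩ := exists_supportedOn X.2.1 X.2.2
      obtain ⟨K', hK', hX'⟩ := hX.koszulDifferential (P := ⟨P, hPc⟩) hP hK
      exact hX'.isCompact_multivectorSupport hK'⟩
  map_add' _ _ := rfl
  map_smul' _ _ := rfl

theorem exists_contraction_eq_zero (hP : PropagatesCompactly P) (hα : PropagatesCompactly α)
    {K : Set M} (hK : IsCompact K) : ∃ K' : Set M, IsCompact K' ∧
      ∀ φ φ' : Sections n F V, (∀ x ∈ K', φ x = φ' x) →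
        ∀ l, ∀ x ∈ K, contraction P α l φ x = contraction P α l φ' x := by
  obtain ⟨K₁, hK₁, h1⟩ := hα K hK
  obtain ⟨K₂, hK₂, h2⟩ := hP K₁ hK₁
  refine ⟨K ∪ K₂, hK.union hK₂, fun φ φ' h l => sub_eq_zero_on.1 fun x hx => ?_⟩
  rw [← map_sub, contraction_apply]
  have h3 := h1 _ (h2 _ (sub_eq_zero_on.2 fun y hy => h y (Or.inr hy))) x hx
  change (φ - φ') x + (l - 1) • α (P (φ - φ')) x = 0
  rw [h3, smul_zero, add_zero]
  exact sub_eq_zero.2 (h x (Or.inl hx))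

theorem SupportedOn.dirDeriv_congr {Y : Sections n F V → AltDistribution n F' W k} {K : Set M}
    (hY : SupportedOn Y K) {φ φ' : Sections n F V} (h : ∀ x ∈ K, φ x = φ' x)
    (a : Sections n F V) : dirDeriv Y φ a = dirDeriv Y φ' a := by
  have h1 : ∀ t : ℝ, Y (φ + t • a) = Y (φ' + t • a) := fun t => hY.congr _ _ fun x hx => by
    change φ x + t • a x = φ' x + t • a x
    rw [h x hx]
  rw [dirDeriv, dirDeriv, hY.congr φ φ' h]
  simp only [h1]

theorem SupportedOn.dirDeriv_eq_zero {Y : Sections n F V → AltDistribution n F' W k} {K : Set M}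
    (hY : SupportedOn Y K) (φ : Sections n F V) {a : Sections n F V} (ha : ∀ x ∈ K, a x = 0) :
    dirDeriv Y φ a = 0 :=
  dirDeriv_eq_zero_of_forall fun t => hY.congr _ _ fun x hx => by
    change φ x + t • a x = φ x
    rw [ha x hx, smul_zero, add_zero]

theorem SupportedOn.dirDeriv_apply_eq_zero {Y : Sections n F V → AltDistribution n F' W k}
    {K : Set M} (hY : SupportedOn Y K) (hs : BastianiSmooth Y) (φ a : Sections n F V)
    {v : Fin k → Sections n F' W} {i : Fin k} (hv : ∀ x ∈ K, v i x = 0) :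
    dirDeriv Y φ a v = 0 := by
  have h1 := ((continuous_eval_const (F := AltDistribution n F' W k) v).tendsto _).comp
    (hs.tendsto_dirDeriv φ a)
  refine tendsto_nhds_unique h1 ((tendsto_const_nhds (x := (0 : ℂ))).congr fun t => ?_)
  change 0 = t⁻¹ • (Y (φ + t • a) v - Y φ v)
  rw [hY.eq_zero _ v i hv, hY.eq_zero _ v i hv, sub_zero, smul_zero]

/-- In each summand an argument vanishing on the enlarged compact set either is the removed one, so
that the direction `α (h i)` vanishes on `K`, or remains an argument of the form. -/
theorem SupportedOn.homotopy (hP : PropagatesCompactly P) (hα : PropagatesCompactly α)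
    {Y : Sections n F V → AltDistribution n F' W k}
    {Z : Sections n F V → AltDistribution n F' W (k + 1)} {K : Set M} (hK : IsCompact K)
    (hY : SupportedOn Y K) (hs : BastianiSmooth Y)
    (hZ : ∀ φ h, Z φ h = homotopySum α (fun l => contraction P α l) Y φ h) :
    ∃ K', IsCompact K' ∧ SupportedOn Z K' := by
  obtain ⟨K₁, hK₁, h1⟩ := exists_contraction_eq_zero hP hα hK
  obtain ⟨K₂, hK₂, h2⟩ := hα K hK
  refine ⟨K₁ ∪ (K ∪ K₂), hK₁.union (hK.union hK₂), fun φ φ' h =>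
    ContinuousAlternatingMap.ext fun v => ?_, fun φ h i hi => ?_⟩
  · rw [hZ, hZ]
    simp only [homotopySum,
      hY.dirDeriv_congr (h1 φ φ' (fun x hx => h x (Or.inl hx)) _)]
  · rw [hZ, homotopySum]
    refine Finset.sum_eq_zero fun j _ => ?_
    have h3 : ∀ l, dirDeriv Y (contraction P α l φ) (α (h j)) (j.removeNth h) = 0 := fun l => by
      by_cases hij : i = j
      · subst hij
        rw [hY.dirDeriv_eq_zero _ (h2 _ fun x hx => hi x (Or.inr (Or.inr hx)))]
        rfl
      · obtain ⟨i', rfl⟩ := Fin.exists_succAbove_eq hij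
        exact hY.dirDeriv_apply_eq_zero hs _ _ (i := i') fun x hx => hi x (Or.inr (Or.inl hx))
    simp [h3]

theorem exists_homotopy (hP : PropagatesCompactly P) (hα : PropagatesCompactly α)
    (Y : multivectorFields n F V F' W k) : ∃ Z : multivectorFields n F V F' W (k + 1),
      ∀ φ h, Z.1 φ h = homotopySum α (fun l => contraction P α l) Y.1 φ h := by
  obtain ⟨K, hK, hYK⟩ := exists_supportedOn Y.2.1 Y.2.2
  obtain ⟨D, hD⟩ := id Y.2.1
  have hγ := continuous_contraction (P := P) (α := α)
  choose Z hZ using fun φ => hD.scalar.exists_alternating_homotopy hγ α 0 φ Fin.elim0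
  have hZ' : ∀ φ h, Z φ h = homotopySum α (fun l => contraction P α l) Y.1 φ h := fun φ h => by
    rw [hZ, homotopySum_eq_homotopyDerivative Y.2.1 hD.scalar]
  obtain ⟨K', hK', hZK'⟩ := hYK.homotopy hP hα hK Y.2.1 hZ'
  exact ⟨⟨Z, (hD.scalar.homotopy hγ α hZ).bastianiSmooth,
    hZK'.isCompact_multivectorSupport hK'⟩, hZ'⟩

theorem multivectorFields_ext {X Y : multivectorFields n F V F' W k}
    (h : ∀ φ v, X.1 φ v = Y.1 φ v) : X = Y :=
  Subtype.ext (funext fun φ => ContinuousAlternatingMap.ext (h φ))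

theorem exists_homotopyMap (hP : PropagatesCompactly P) (hα : PropagatesCompactly α) (k : ℕ) :
    ∃ H : multivectorFields n F V F' W k →ₗ[ℂ] multivectorFields n F V F' W (k + 1),
      ∀ Y φ h, (H Y).1 φ h = homotopySum α (fun l => contraction P α l) Y.1 φ h := by
  choose Z hZ using fun Y : multivectorFields n F V F' W k => exists_homotopy hP hα Y
  refine ⟨{ toFun := Z, map_add' := fun Y Y' => ?_, map_smul' := fun c Y => ?_ }, hZ⟩
  · refine multivectorFields_ext fun φ v => ?_
    change _ = (Z Y).1 φ v + (Z Y').1 φ v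
    rw [hZ, hZ, hZ, ← homotopySum_add Y.2.1 Y'.2.1]
    rfl
  · refine multivectorFields_ext fun φ v => ?_
    change _ = c • (Z Y).1 φ v
    rw [hZ, hZ, ← homotopySum_smul c Y.2.1]
    rfl

/-- The restriction of functionals to the solution space. -/
def onShellRestriction (P : Sections n F V →ₗ[ℝ] Sections n F' W) :
    multivectorFields n F V F' W 0 →ₗ[ℂ] onShellFunctionals P where
  toFun X := ⟨fun φ => X.1 φ.1 ![], by
    obtain ⟨D, hD⟩ := X.2.1
    refine ⟨fun m φ ψ => D m φ.1 (fun i => (ψ i).1) ![], fun φ ψ => ?_, fun m φ ψ χ => ?_,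
      fun m => ?_⟩
    · rw [hD.zero]
    · have h1 := hD.scalar.succ m φ.1 (fun i => (ψ i).1) χ.1 ![]
      have h2 : (fun i => ((Fin.snoc ψ χ : Fin (m + 1) → LinearMap.ker P) i).1) =
          (Fin.snoc (fun i => (ψ i).1) χ.1 : Fin (m + 1) → Sections n F V) := by
        funext j
        induction j using Fin.lastCases with
        | last => simp
        | cast j => simp
      rw [h2]
      exact h1
    · exact hD.scalar.continuous_comp (by fun_prop) (by fun_prop) continuous_const, by
    obtain ⟨K, hK, hX⟩ := exists_supportedOn X.2.1 X.2.2
    exact ⟨K, hK, fun φ φ' h => congrArg (fun u => u ![]) (hX.congr _ _ h)⟩⟩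
  map_add' _ _ := rfl
  map_smul' _ _ := rfl

theorem exists_onShellExtension (hP : PropagatesCompactly P) (hα : PropagatesCompactly α)
    (h0 : ∀ φ, contraction P α 0 φ ∈
      LinearMap.ker (P : Sections n F V →ₗ[ℝ] Sections n F' W)) :
    ∃ σ : onShellFunctionals (P : Sections n F V →ₗ[ℝ] Sections n F' W) →ₗ[ℂ]
      multivectorFields n F V F' W 0, ∀ f φ v, (σ f).1 φ v = f.1 ⟨contraction P α 0 φ, h0 φ⟩ := by
  -- As a continuous linear projection onto the solutions, `L` pulls the derivatives of an on-shell
  -- functional back by inserting `L` into every direction.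
  let L : Sections n F V →L[ℝ] LinearMap.ker (P : Sections n F V →ₗ[ℝ] Sections n F' W) :=
    (contraction P α 0).codRestrict _ h0
  refine ⟨{ toFun := fun f => ⟨fun φ => ContinuousAlternatingMap.constOfIsEmpty ℝ _ (Fin 0)
    (f.1 (L φ)), ?_, ?_⟩, map_add' := fun f f' => ?_, map_smul' := fun c f => ?_ },
    fun f φ v => rfl⟩
  · obtain ⟨D, hD⟩ := f.2.1
    refine IsScalarDerivativeSequence.bastianiSmooth
      (D := fun m φ ψ _ => D m (L φ) fun i => L (ψ i)) ⟨fun φ ψ h => ?_, fun m φ ψ χ h => ?_,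
        fun m => ?_⟩
    · rw [hD.zero]
      rfl
    · have h1 := hD.succ m (L φ) (fun i => L (ψ i)) (L χ)
      have h2 : (fun i => L ((Fin.snoc ψ χ : Fin (m + 1) → Sections n F V) i)) =
          (Fin.snoc (fun i => L (ψ i)) (L χ) : Fin (m + 1) → LinearMap.ker _) := by
        funext j
        induction j using Fin.lastCases with
        | last => simp
        | cast j => simp
      rw [h2]
      simpa only [map_add, map_smul] using h1
    · exact (hD.continuous m).comp (f := fun p : Sections n F V × (Fin m → Sections n F V) ×
        (Fin 0 → Sections n F' W) => (L p.1, fun i => L (p.2.1 i))) (by fun_prop)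
  · obtain ⟨K, hK, hf⟩ := f.2.2
    obtain ⟨K', hK', h1⟩ := exists_contraction_eq_zero hP hα hK
    refine SupportedOn.isCompact_multivectorSupport (K := K') ⟨fun φ φ' h => ?_,
      fun _ _ i => i.elim0⟩ hK'
    rw [hf (L φ) (L φ') (h1 φ φ' h 0)]
  · rfl
  · rfl

end Complex

/-! ## Globally hyperbolic spacetimes -/

section Spacetime

variable {n : ℕ} {M : Type*} [TopologicalSpace M] [ChartedSpace (EuclideanSpace ℝ (Fin n)) M]
  [IsManifold (𝓡 n) ∞ M]
  {F : Type*} [NormedAddCommGroup F] [NormedSpace ℝ F]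
  {V : M → Type*} [TopologicalSpace (TotalSpace F V)] [∀ x, AddCommGroup (V x)]
  [∀ x, Module ℝ (V x)] [∀ x, TopologicalSpace (V x)] [FiberBundle F V] [VectorBundle ℝ F V]
  [ContMDiffVectorBundle ∞ F V (𝓡 n)]
  {F' : Type*} [NormedAddCommGroup F'] [NormedSpace ℝ F']
  {W : M → Type*} [TopologicalSpace (TotalSpace F' W)] [∀ x, AddCommGroup (W x)]
  [∀ x, Module ℝ (W x)] [∀ x, TopologicalSpace (W x)] [FiberBundle F' W] [VectorBundle ℝ F' W]
  [ContMDiffVectorBundle ∞ F' W (𝓡 n)]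
  [T2Space M] [SecondCountableTopology M]
  {g : LorentzianStructure n M} {P : Sections n F V →ₗ[ℝ] Sections n F' W}

theorem bijOn_pastCompactSections (hg : g.GloballyHyperbolic) (hP : HasGreenOperators g P) :
    BijOn P (pastCompactSections V g) (pastCompactSections W g) ∧
      ∀ h ∈ pastCompactSections W g,
        sectionSupport (retarded g P h) ⊆ g.causalFuture (sectionSupport h) := by
  have : LocallyCompactSpace M := ChartedSpace.locallyCompactSpace (EuclideanSpace ℝ (Fin n)) M
  obtain ⟨G, hG⟩ := hP.exists_retarded
  exact ⟨green_bijOn (g.properCausality hg) hP.isDifferentialOperator hG, fun h hh =>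
    sectionSupport_greenInverse_subset (g.properCausality hg) hP.isDifferentialOperator hG hh⟩

theorem bijOn_futureCompactSections (hg : g.GloballyHyperbolic) (hP : HasGreenOperators g P) :
    BijOn P (futureCompactSections V g) (futureCompactSections W g) ∧
      ∀ h ∈ futureCompactSections W g,
        sectionSupport (advanced g P h) ⊆ g.causalPast (sectionSupport h) := by
  have : LocallyCompactSpace M := ChartedSpace.locallyCompactSpace (EuclideanSpace ℝ (Fin n)) M
  obtain ⟨G, hG⟩ := hP.exists_advanced
  exact ⟨green_bijOn (g.properCausality hg).swap hP.isDifferentialOperator hG, fun h hh =>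
    sectionSupport_greenInverse_subset (g.properCausality hg).swap hP.isDifferentialOperator
      hG hh⟩

theorem PropagatesCompactly.add {S T : Sections n F V → Sections n F' W}
    (hS : PropagatesCompactly S) (hT : PropagatesCompactly T) :
    PropagatesCompactly fun s => S s + T s := fun K hK => by
  obtain ⟨K₁, hK₁, h1⟩ := hS K hK
  obtain ⟨K₂, hK₂, h2⟩ := hT K hK
  refine ⟨K₁ ∪ K₂, hK₁.union hK₂, fun s hs x hx => ?_⟩
  change S s x + T s x = 0
  rw [h1 s (fun y hy => hs y (Or.inl hy)) x hx, h2 s (fun y hy => hs y (Or.inr hy)) x hx, add_zero]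

/-- The two parts of the source, `(1 - θ) h` and `θ h`, have future and past compact support and add
up to `h`, so the sum of the two solutions is a right inverse of `P`. -/
theorem exists_continuousLinearMap_alpha [CompleteSpace F] [CompleteSpace F']
    (hg : g.GloballyHyperbolic) (hP : HasGreenOperators g P) {θ : C^∞⟮𝓡 n, M; ℝ⟯}
    (hθ : g.IsTimeCutoff θ) : ∃ α : Sections n F' W →L[ℝ] Sections n F V,
      (∀ h, α h = alpha g P θ h) ∧ (∀ h, P (α h) = h) ∧ PropagatesCompactly α := by
  have : LocallyCompactSpace M := ChartedSpace.locallyCompactSpace (EuclideanSpace ℝ (Fin n)) M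
  have hr := g.properCausality hg
  obtain ⟨G, hG⟩ := hP.exists_retarded
  obtain ⟨G', hG'⟩ := hP.exists_advanced
  obtain ⟨T, hT, hPT, hTK⟩ := exists_continuous_green hr hP.isDifferentialOperator hG hθ.1
  obtain ⟨T', hT', hPT', hTK'⟩ :=
    exists_continuous_green hr.swap hP.isDifferentialOperator hG' hθ.2
  refine ⟨T' + T, fun h => congrArg₂ (· + ·) (hT' h) (hT h), fun h => ?_, PropagatesCompactly.add hTK' hTK⟩
  change P (T' h + T h) = h
  rw [map_add, hPT, hPT']
  refine ContMDiffSection.ext fun x => ?_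
  change (1 - θ x) • h x + θ x • h x = h x
  rw [← add_smul, sub_add_cancel, one_smul]

theorem exists_homotopy_operators [FiniteDimensional ℝ F] [FiniteDimensional ℝ F']
    [CompleteSpace F] [CompleteSpace F'] (hg : g.GloballyHyperbolic)
    (hP : HasGreenOperators g P) (hPc : Continuous P) (hPK : PropagatesCompactly P)
    {θ : C^∞⟮𝓡 n, M; ℝ⟯} (hθ : g.IsTimeCutoff θ) :
    (∀ h, P (alpha g P θ h) = h) ∧
    ∃ (hγ : ∀ φ, gamma g P θ 0 φ ∈ LinearMap.ker P)
      (σ : onShellFunctionals P →ₗ[ℂ] multivectorFields n F V F' W 0)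
      (H : ∀ k, multivectorFields n F V F' W k →ₗ[ℂ] multivectorFields n F V F' W (k + 1))
      (γpull : multivectorFields n F V F' W 0 →ₗ[ℂ] multivectorFields n F V F' W 0),
      (∀ f φ, (σ f).1 φ ![] = f.1 ⟨gamma g P θ 0 φ, hγ φ⟩) ∧
      (∀ k Y φ h, (H k Y).1 φ h = homotopyValue g P θ Y.1 φ h) ∧
      (∀ X φ, (γpull X).1 φ = X.1 (gamma g P θ 0 φ)) ∧
      (∀ X, γpull X = σ (onShellRestriction P X)) ∧
      (∀ k X, X = koszulMap hPc hPK (k + 1) (H (k + 1) X) + H k (koszulMap hPc hPK k X)) ∧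
      (∀ X, X = koszulMap hPc hPK 0 (H 0 X) + γpull X) ∧
      (∀ f, onShellRestriction P (σ f) = f) := by
  let Q : Sections n F V →L[ℝ] Sections n F' W := ⟨P, hPc⟩
  have hQ : PropagatesCompactly Q := hPK
  obtain ⟨α, hα, hPα, hαK⟩ := exists_continuousLinearMap_alpha hg hP hθ
  have hQα : ∀ h, Q (α h) = h := hPα
  have hα' : (α : _ → Sections n F V) = alpha g P θ := funext hα
  have hγ' : (fun l => (contraction Q α l : Sections n F V → Sections n F V)) =
      gamma g P θ := by
    funext l φ
    rw [contraction_apply, hα]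
    rfl
  have hval : ∀ {k : ℕ} (Y : Sections n F V →
      AltDistribution n F' W k) φ h,
      homotopySum α (fun l => contraction Q α l) Y φ h = homotopyValue g P θ Y φ h := by
    intro k Y φ h
    rw [hα', hγ']
    rfl
  have h0 : ∀ φ, contraction Q α 0 φ ∈ LinearMap.ker P := fun φ => by
    rw [LinearMap.mem_ker]
    change Q _ = 0
    rw [apply_contraction hQα, zero_smul]
  have hγ0 : ∀ φ, contraction Q α 0 φ = gamma g P θ 0 φ := fun φ =>
    congrFun (congrFun hγ' 0) φ
  obtain ⟨σ, hσ⟩ := exists_onShellExtension hQ hαK h0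
  choose H hH using fun k => exists_homotopyMap hQ hαK k
  refine ⟨fun h => hα h ▸ hPα h, fun φ => hγ0 φ ▸ h0 φ, σ, H,
    σ ∘ₗ onShellRestriction P, fun f φ => ?_, fun k Y φ h => ?_,
    fun X φ => ?_, fun X => rfl, fun k X => ?_, fun X => ?_, fun f => ?_⟩
  · simp only [hσ, hγ0]
  · rw [hH, hval]
  · refine ContinuousAlternatingMap.ext fun v => ?_
    rw [LinearMap.comp_apply, hσ, ← hγ0, Subsingleton.elim v ![]]
    rfl
  · refine multivectorFields_ext fun φ v => ?_
    rw [eq_homotopySum_add (P := Q) X.2.1 (bastianiSmooth_koszulDifferential X.2.1) hQα]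
    change _ = (H (k + 1) X).1 φ (Fin.cons (Q φ) v) + (H k (koszulMap hPc hPK k X)).1 φ v
    rw [hH, hH]
    rfl
  · refine multivectorFields_ext fun φ v => ?_
    have h1 := sub_eq_homotopySum (P := Q) (α := α) X.2.1 φ v
    change _ = (H 0 X).1 φ (Fin.cons (Q φ) v) + (σ (onShellRestriction _ X)).1 φ v
    rw [hH, hσ, ← h1, Subsingleton.elim v ![]]
    exact (sub_add_cancel _ _).symm
  · refine Subtype.ext (funext fun φ => ?_)
    change (σ f).1 φ.1 ![] = f.1 φ
    rw [hσ]
    have h1 : Q φ.1 = 0 := LinearMap.mem_ker.1 φ.2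
    -- The contraction fixes solutions, so extending by `γ_0` and then restricting is the identity.
    have h2 : contraction Q α 0 φ.1 = φ.1 := by
      rw [contraction_apply, h1, map_zero, smul_zero, add_zero]
    exact congrArg f.1 (Subtype.ext h2)

/-- The resolution of the on-shell functionals by multivector fields, for an operator with values
in an arbitrary vector bundle. -/
theorem koszul_resolution [FiniteDimensional ℝ F] [FiniteDimensional ℝ F']
    (hg : g.GloballyHyperbolic) (hP : HasGreenOperators g P) :
    (BijOn P (pastCompactSections V g) (pastCompactSections W g) ∧
      BijOn P (futureCompactSections V g)
        (futureCompactSections W g) ∧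
      (∀ h ∈ pastCompactSections W g,
        sectionSupport (retarded g P h) ⊆ g.causalFuture (sectionSupport h)) ∧
      (∀ h ∈ futureCompactSections W g,
        sectionSupport (advanced g P h) ⊆ g.causalPast (sectionSupport h))) ∧
    ∃ (δ : ∀ k, multivectorFields n F V F' W (k + 1) →ₗ[ℂ] multivectorFields n F V F' W k)
      (ι : multivectorFields n F V F' W 0 →ₗ[ℂ] onShellFunctionals P),
      (∀ k X, (δ k X).1 = koszulDifferential P X.1) ∧
      (∀ X φ, (ι X).1 φ = X.1 φ.1 ![]) ∧
      (∃ θ, g.IsTimeCutoff θ) ∧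
      (∀ θ, g.IsTimeCutoff θ →
        (∀ h, P (alpha g P θ h) = h) ∧
        ∃ (hγ : ∀ φ, gamma g P θ 0 φ ∈ LinearMap.ker P)
          (σ : onShellFunctionals P →ₗ[ℂ] multivectorFields n F V F' W 0)
          (H : ∀ k, multivectorFields n F V F' W k →ₗ[ℂ] multivectorFields n F V F' W (k + 1))
          (γpull : multivectorFields n F V F' W 0 →ₗ[ℂ] multivectorFields n F V F' W 0),
          (∀ f φ, (σ f).1 φ ![] = f.1 ⟨gamma g P θ 0 φ, hγ φ⟩) ∧
          (∀ k Y φ h, (H k Y).1 φ h = homotopyValue g P θ Y.1 φ h) ∧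
          (∀ X φ, (γpull X).1 φ = X.1 (gamma g P θ 0 φ)) ∧
          (∀ X, γpull X = σ (ι X)) ∧
          (∀ k X, X = δ (k + 1) (H (k + 1) X) + H k (δ k X)) ∧
          (∀ X, X = δ 0 (H 0 X) + γpull X) ∧
          (∀ f, ι (σ f) = f)) ∧
      (∀ k, LinearMap.range (δ (k + 1)) = LinearMap.ker (δ k)) ∧
      LinearMap.range (δ 0) = LinearMap.ker ι ∧
      Function.Surjective ι := by
  have hFc : CompleteSpace F := FiniteDimensional.complete ℝ F
  have hDc : CompleteSpace F' := FiniteDimensional.complete ℝ F'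
  have hPc := hP.isDifferentialOperator.continuous
  have hPK := hP.isDifferentialOperator.propagatesCompactly
  obtain ⟨θ₀, hθ₀⟩ := g.exists_isTimeCutoff hg
  have hmain := fun θ (hθ : g.IsTimeCutoff θ) => exists_homotopy_operators hg hP hPc hPK hθ
  obtain ⟨-, -, σ, H, γpull, -, -, -, h4, h5, h6, h7⟩ := hmain θ₀ hθ₀
  -- The section `P φ` occupies two slots of an alternating form.
  have hδδ : ∀ k X, koszulMap hPc hPK k (koszulMap hPc hPK (k + 1) X) = 0 := fun k X =>
    multivectorFields_ext fun φ v =>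
      (X.1 φ).map_eq_zero_of_eq (i := 0) (j := 1) _ rfl Fin.zero_ne_one
  have hιδ : ∀ X, onShellRestriction P (koszulMap hPc hPK 0 X) = 0 :=
    fun X => Subtype.ext (funext fun φ => by
      have h1 : P φ.1 = 0 := φ.2
      exact (X.1 φ.1).map_coord_zero 0 h1)
  refine ⟨⟨(bijOn_pastCompactSections hg hP).1, (bijOn_futureCompactSections hg hP).1,
    (bijOn_pastCompactSections hg hP).2, (bijOn_futureCompactSections hg hP).2⟩,
    koszulMap hPc hPK, onShellRestriction _, fun k X => rfl, fun X φ => rfl, ⟨θ₀, hθ₀⟩, hmain,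
    fun k => le_antisymm ?_ fun X hX => ?_, le_antisymm ?_ fun X hX => ?_, fun f => ⟨σ f, h7 f⟩⟩
  · rintro _ ⟨X, rfl⟩
    exact hδδ k X
  · refine ⟨H (k + 1) X, ?_⟩
    have h := h5 k X
    rw [LinearMap.mem_ker.1 hX, map_zero, add_zero] at h
    exact h.symm
  · rintro _ ⟨X, rfl⟩
    exact hιδ X
  · refine ⟨H 0 X, ?_⟩
    have h := h6 X
    rw [h4, LinearMap.mem_ker.1 hX, map_zero, add_zero] at h
    exact h.symm

end Spacetime

end Koszul

end

open Koszul
-- The argument uses only that the target of `P` is a smooth bundle of finite rank, so the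
-- density-valued dual is a special case.
theorem mainTheorem6 {n : ℕ} {M : Type*} [TopologicalSpace M] [T2Space M]
    [SecondCountableTopology M] [ChartedSpace (EuclideanSpace ℝ (Fin n)) M]
    [IsManifold (𝓡 n) ∞ M]
    (g : LorentzianStructure n M) (hg : g.GloballyHyperbolic)
    {F : Type*} [NormedAddCommGroup F] [NormedSpace ℝ F] [FiniteDimensional ℝ F]
    {V : M → Type*} [TopologicalSpace (TotalSpace F V)] [∀ x, AddCommGroup (V x)]
    [∀ x, Module ℝ (V x)] [∀ x, TopologicalSpace (V x)] [FiberBundle F V] [VectorBundle ℝ F V]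
    [ContMDiffVectorBundle ∞ F V (𝓡 n)]
    (P : Sections n F V →ₗ[ℝ] Sections n (F →L[ℝ] ℝ) (FunctionalDual n M (V := V)))
    (hP : HasGreenOperators g P) :
    -- `P` is invertible on sections with past (future) compact support, so that `retarded g P` and
    -- `advanced g P` are the genuine inverses, and these have the expected support property
    (BijOn P (pastCompactSections V g) (pastCompactSections (FunctionalDual n M (V := V)) g) ∧
      BijOn P (futureCompactSections V g)
        (futureCompactSections (FunctionalDual n M (V := V)) g) ∧
      (∀ h ∈ pastCompactSections (FunctionalDual n M (V := V)) g,
        sectionSupport (retarded g P h) ⊆ g.causalFuture (sectionSupport h)) ∧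
      (∀ h ∈ futureCompactSections (FunctionalDual n M (V := V)) g,
        sectionSupport (advanced g P h) ⊆ g.causalPast (sectionSupport h))) ∧
    -- the differential `δ` and the restriction `ι^*` to the solution space are well defined
    ∃ (δ : ∀ k, multivectorFields n F V (F →L[ℝ] ℝ) (FunctionalDual n M (V := V)) (k + 1) →ₗ[ℂ]
          multivectorFields n F V (F →L[ℝ] ℝ) (FunctionalDual n M (V := V)) k)
      (ι : multivectorFields n F V (F →L[ℝ] ℝ) (FunctionalDual n M (V := V)) 0 →ₗ[ℂ] onShellFunctionals P),
      (∀ k X, (δ k X).1 = koszulDifferential P X.1) ∧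
      (∀ X φ, (ι X).1 φ = X.1 φ.1 ![]) ∧
      -- admissible cutoff functions exist, and each of them yields a chain homotopy
      (∃ θ, g.IsTimeCutoff θ) ∧
      (∀ θ, g.IsTimeCutoff θ →
        (∀ h, P (alpha g P θ h) = h) ∧
        ∃ (hγ : ∀ φ, gamma g P θ 0 φ ∈ LinearMap.ker P)
          (σ : onShellFunctionals P →ₗ[ℂ]
            multivectorFields n F V (F →L[ℝ] ℝ) (FunctionalDual n M (V := V)) 0)
          (H : ∀ k, multivectorFields n F V (F →L[ℝ] ℝ) (FunctionalDual n M (V := V)) k →ₗ[ℂ]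
            multivectorFields n F V (F →L[ℝ] ℝ) (FunctionalDual n M (V := V)) (k + 1))
          (γpull : multivectorFields n F V (F →L[ℝ] ℝ) (FunctionalDual n M (V := V)) 0 →ₗ[ℂ]
            multivectorFields n F V (F →L[ℝ] ℝ) (FunctionalDual n M (V := V)) 0),
          (∀ f φ, (σ f).1 φ ![] = f.1 ⟨gamma g P θ 0 φ, hγ φ⟩) ∧
          (∀ k Y φ h, (H k Y).1 φ h = homotopyValue g P θ Y.1 φ h) ∧
          (∀ X φ, (γpull X).1 φ = X.1 (gamma g P θ 0 φ)) ∧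
          (∀ X, γpull X = σ (ι X)) ∧
          (∀ k X, X = δ (k + 1) (H (k + 1) X) + H k (δ k X)) ∧
          (∀ X, X = δ 0 (H 0 X) + γpull X) ∧
          (∀ f, ι (σ f) = f)) ∧
      -- the sequence `⋯ → 𝒳² → 𝒳¹ → 𝓕 → 𝓕_S → 0` is an exact complex
      (∀ k, LinearMap.range (δ (k + 1)) = LinearMap.ker (δ k)) ∧
      LinearMap.range (δ 0) = LinearMap.ker ι ∧
      Function.Surjective ι :=
  koszul_resolution hg hP
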